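/- **Conventions.** A Wang tile is a tuple (right, top, left, bottom) $\in I\times J\times I\times J$, where $I,J$ are finite sets of (vertical, horizontal) colors. For a finite set $\mathcal T$ of Wang tiles, $\Omega_{\mathcal T}\subset\mathcal T^{\mathbb Z^2}$ is its Wang shift, i.e. the set of all $x:\mathbb Z^2\to\mathcal T$ with $\mathrm{right}(x_n)=\mathrm{left}(x_{n+e_1})$ and $\mathrm{top}(x_n)=\mathrm{bottom}(x_{n+e_2})$ for all $n$; tiles are discrete and $\mathcal T^{\mathbb Z^2}$ has the product topology. The shift is $(\sigma^n x)_m=x_{m+n}$, and $\overline X^{\sigma}=\{\sigma^k x: k\in\mathbb Z^2, x\in X\}$. Sets of tiles $\mathcal T,\mathcal S$ are *equivalent* if some bijections $i$ of the vertical and $j$ of the horizontal color sets give $\mathcal S=\{(i(a),j(b),i(c),j(d)):(a,b,c,d)\in\mathcal T\}$. A *2-dimensional morphism* $\omega:X\to Y$ between sets of configurations over alphabets $A$ and $B$ is a map from the language of $X$ (the nonempty rectangular words occurring in elements of $X$) to nonempty rectangular words over $B$, such that, for $i=1,2$, whenever $u$, $v$ and the concatenation $u\odot^i v$ in direction $e_i$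 are in the language, $\omega(u)\odot^i\omega(v)$ is defined and equals $\omega(u\odot^i v)$, and whose extension to configurations (placing the lower left corner of $\omega(x_0)$ at the origin) maps $X$ into $Y$. It is *recognizable* if every $y\in B^{\mathbb Z^2}$ has at most one representation $y=\sigma^k\omega(x)$ with $x\in X$ and $0\le k<\mathrm{shape}(\omega(x_0))$ coordinatewise. It is *onto up to a shift* if $\overline{\omega(X)}^{\sigma}=Y$. When $X=Y$, it is *expansive* if for every letter $a$ and every $K$ there is $m$ such that both sides of $\omega^m(a)$ exceed $K$. A subshift $X$ is *self-similar* if $X=\overline{\omega(X)}^\sigma$ for some expansive 2-dimensional morphism $\omega:X\to X$; *minimal* if it contains no nonempty proper closed shift-invariant subset; *aperiodic* if it is nonempty and no $x\in X$ satisfies $\sigma^n x=x$ with $n\ne0$. Let $\mathcal T_0$ be the Jeandel–Rao set of 11 tiles (right, top, left, bottom): $(2,4,2,1)$, $(2,2,2,0)$, $(1,1,3,1)$, $(1,2,3,2)$, $(3,1,3,3)$, $(0,1,3,1)$, $(0,0,0,1)$, $(3,1,0,2)$, $(0,2,1,2)$, $(1,2,1,4)$, $(3,3,1,2)$. Let $\mathcal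 U$ be the set of 19 tiles with vertical colors $A,\dots,J$ and horizontal colors $K,\dots,P$ (written right–top–left–bottom): FOJO, FOHL, JMFP, DMFK, HPJP, HPHN, HKFP, HKDP, BOIO, GLEO, GLCL, ALIO, EPGP, EPIP, IPGK, IPIK, IKBM, IKAK, CNIP. **Theorem.** There exist sets of Wang tiles $\mathcal T_1,\dots,\mathcal T_{12}$ with Wang shifts $\Omega_i=\Omega_{\mathcal T_i}$ ($0\le i\le 12$) such that: 1. For each $i\in\{0,1,2,3\}$ there is a recognizable 2-dimensional morphism $\omega_i:\Omega_{i+1}\to\Omega_i$ that is onto up to a shift: $\overline{\omega_i(\Omega_{i+1})}^\sigma=\Omega_i$. 2. There is an embedding $\jmath:\Omega_5\to\Omega_4$ (an injective continuous map commuting with the shifts) whose image is a subshift and which is a topological conjugacy onto its image. 3. There is a shear conjugacy $\eta:\Omega_6\to\Omega_5$ with matrix $M=\begin{pmatrix}1&1\\0&1\end{pmatrix}$: a homeomorphism with $\eta\circ\sigma^{k}=\sigma^{Mk}\circ\eta$ for all $k\in\mathbb Z^2$; it shears tilings by $M$, i.e. there is a map $f:\mathcal T_6\to\mathcal T_5$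 with $\eta(y)_{Mp}=f(y_p)$ for all $y\in\Omega_6$ and $p\in\mathbb Z^2$. 4. For each $i\in\{6,7,8,9,10,11\}$ there is a recognizable 2-dimensional morphism $\omega_i:\Omega_{i+1}\to\Omega_i$ that is onto up to a shift: $\overline{\omega_i(\Omega_{i+1})}^\sigma=\Omega_i$. 5. $\mathcal T_{12}$ is equivalent to $\mathcal U$, and both $\Omega_{12}$ and $\Omega_{\mathcal U}$ are self-similar, aperiodic and minimal. -/

import Mathlib

/-! ## Wang tiles -/

/-- A Wang tile with vertical colors in `I` (right and left edges) and horizontal colors in `J`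
(top and bottom edges), written `(right, top, left, bottom)`. -/
@[ext]
structure WangTile (I J : Type) where
  right : I
  top : J
  left : I
  bottom : J
deriving DecidableEq

/-- Tiles carry the discrete topology. -/
instance (I J : Type) : TopologicalSpace (WangTile I J) := ⊥

instance (I J : Type) : DiscreteTopology (WangTile I J) := ⟨rfl⟩

/-- A set of Wang tiles over finite sets `I` of vertical and `J` of horizontal colors. -/
structure WangTileSet where
  I : Type
  J : Type
  finite_I : Finite I
  finite_J : Finite J
  tiles : Finset (WangTile I J)

/-- The set of tiles, used as an alphabet (with the discrete topology). -/
abbrev WangTileSet.Alphabet (T : WangTileSet) : Type := {t : WangTile T.I T.J // t ∈ T.tiles}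

/-- Two sets of Wang tiles are equivalent if they agree up to a bijective renaming of the
vertical colors and a bijective renaming of the horizontal colors. -/
def WangTileSet.Equivalent (T S : WangTileSet) : Prop :=
  ∃ (i : T.I ≃ S.I) (j : T.J ≃ S.J), ∀ s : WangTile S.I S.J,
    s ∈ S.tiles ↔ ∃ t ∈ T.tiles, s = ⟨i t.right, j t.top, i t.left, j t.bottom⟩

/-! ## Configurations and subshifts -/

/-- Maps `ℤ² → A`, with the product topology when `A` is a topological space. -/
abbrev Config (A : Type) : Type := ℤ × ℤ → A

/-- The shift action `(σ^n x)_m = x_{m+n}`. -/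
def shift {A : Type} (n : ℤ × ℤ) (x : Config A) : Config A := fun m => x (m + n)

/-- The Wang shift of `T`: all valid tilings of `ℤ²` by `T`. -/
def WangTileSet.wangShift (T : WangTileSet) : Set (Config T.Alphabet) :=
  {x | ∀ n : ℤ × ℤ, (x n).1.right = (x (n + (1, 0))).1.left ∧
    (x n).1.top = (x (n + (0, 1))).1.bottom}

def IsShiftInvariant {A : Type} (X : Set (Config A)) : Prop :=
  ∀ n : ℤ × ℤ, shift n '' X = X

def IsSubshift {A : Type} [TopologicalSpace A] (X : Set (Config A)) : Prop :=
  IsClosed X ∧ IsShiftInvariant X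

/-- The closure of `X` under the shift. -/
def shiftClosure {A : Type} (X : Set (Config A)) : Set (Config A) :=
  {y | ∃ k : ℤ × ℤ, ∃ x ∈ X, y = shift k x}

/-- A minimal subshift: it contains no nonempty, proper, closed, shift-invariant subset. -/
def IsMinimalSubshift {A : Type} [TopologicalSpace A] (X : Set (Config A)) : Prop :=
  IsSubshift X ∧ ∀ Z ⊆ X, Z.Nonempty → IsClosed Z → IsShiftInvariant Z → Z = X

/-- Nonempty and without configurations having a nontrivial period. -/
def IsAperiodic {A : Type} (X : Set (Config A)) : Prop :=
  X.Nonempty ∧ ∀ x ∈ X, ∀ n : ℤ × ℤ, shift n x = x → n = 0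

/-! ## Homomorphisms and conjugacies -/

/-- A homomorphism: a continuous map commuting with the shift actions. -/
def IsHomomorphism {A B : Type} [TopologicalSpace A] [TopologicalSpace B]
    {X : Set (Config A)} {Y : Set (Config B)} (θ : X → Y) : Prop :=
  Continuous θ ∧ ∀ (k : ℤ × ℤ) (x x' : X), x'.1 = shift k x.1 → (θ x').1 = shift k (θ x).1

/-- A one-to-one homomorphism. -/
def IsShiftEmbedding {A B : Type} [TopologicalSpace A] [TopologicalSpace B]
    {X : Set (Config A)} {Y : Set (Config B)} (θ : X → Y) : Prop :=
  IsHomomorphism θ ∧ Function.Injective θ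

/-- A bijective homomorphism with continuous inverse. -/
def IsTopologicalConjugacy {A B : Type} [TopologicalSpace A] [TopologicalSpace B]
    {X : Set (Config A)} {Y : Set (Config B)} (θ : X → Y) : Prop :=
  IsHomomorphism θ ∧ IsHomeomorph θ

/-- The image of `θ`, as a set of configurations. -/
def imageSet {A B : Type} {X : Set (Config A)} {Y : Set (Config B)} (θ : X → Y) :
    Set (Config B) :=
  Set.range fun x => (θ x).1

/-- `θ` seen as a map onto its image. -/
def toImage {A B : Type} {X : Set (Config A)} {Y : Set (Config B)} (θ : X → Y) :
    X → imageSet θ :=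
  fun x => ⟨(θ x).1, x, rfl⟩

/-- The image of `θ` is a subshift and `θ` is a topological conjugacy onto it. -/
def IsConjugacyOntoImage {A B : Type} [TopologicalSpace A] [TopologicalSpace B]
    {X : Set (Config A)} {Y : Set (Config B)} (θ : X → Y) : Prop :=
  IsSubshift (imageSet θ) ∧ IsTopologicalConjugacy (toImage θ)

/-- The action of an integer matrix on `ℤ²` (column vectors). -/
def matAct (M : Matrix (Fin 2) (Fin 2) ℤ) (n : ℤ × ℤ) : ℤ × ℤ :=
  (M 0 0 * n.1 + M 0 1 * n.2, M 1 0 * n.1 + M 1 1 * n.2)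

/-- A `GL₂(ℤ)`-conjugacy with matrix `M`: a homeomorphism with `σ^{Mk} ∘ θ = θ ∘ σ^k`. -/
def IsGLConjugacy {A B : Type} [TopologicalSpace A] [TopologicalSpace B]
    {X : Set (Config A)} {Y : Set (Config B)} (M : GL (Fin 2) ℤ) (θ : X → Y) : Prop :=
  IsHomeomorph θ ∧ ∀ (k : ℤ × ℤ) (x x' : X), x'.1 = shift k x.1 →
    (θ x').1 = shift (matAct M.1 k) (θ x).1

/-- The shear matrix `(1 1; 0 1)`. -/
def shearMatrix : GL (Fin 2) ℤ where
  val := !![1, 1; 0, 1]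
  inv := !![1, -1; 0, 1]
  val_inv := by decide
  inv_val := by decide

/-! ## Two-dimensional words, languages and morphisms -/

/-- A (nonempty) `2`-dimensional word of shape `(width, height)`; `letter a b` is the letter in
column `a` and row `b`, in Cartesian coordinates. -/
structure Word (A : Type) where
  width : ℕ
  height : ℕ
  width_pos : 0 < width
  height_pos : 0 < height
  letter : Fin width → Fin height → A

/-- A letter as a word of shape `(1, 1)`. -/
def Word.single {A : Type} (a : A) : Word A where
  width := 1
  height := 1
  width_pos := Nat.one_pos
  height_pos := Nat.one_pos
  letter := fun _ _ => a

/-- The concatenation of `u` and `v` in the direction `e₁` (`v` to the right of `u`), defined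
when the heights agree. -/
def Word.hcat {A : Type} (u v : Word A) (h : u.height = v.height) : Word A where
  width := u.width + v.width
  height := u.height
  width_pos := Nat.add_pos_left u.width_pos _
  height_pos := u.height_pos
  letter := fun a b =>
    Fin.addCases (fun a' => u.letter a' b) (fun a' => v.letter a' (Fin.cast h b)) a

/-- The concatenation of `u` and `v` in the direction `e₂` (`v` on top of `u`), defined when the
widths agree. -/
def Word.vcat {A : Type} (u v : Word A) (h : u.width = v.width) : Word A where
  width := u.width
  height := u.height + v.height
  width_pos := u.width_pos
  height_pos := Nat.add_pos_left u.height_pos _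
  letter := fun a b =>
    Fin.addCases (fun b' => u.letter a b') (fun b' => v.letter (Fin.cast h a) b') b

/-- `u` occurs in the configuration `x` at position `p`. -/
def Word.OccursAt {A : Type} (u : Word A) (x : Config A) (p : ℤ × ℤ) : Prop :=
  ∀ (a : Fin u.width) (b : Fin u.height), x (p.1 + (a : ℕ), p.2 + (b : ℕ)) = u.letter a b

/-- The language of `X`: all words occurring in some element of `X`. -/
def language {A : Type} (X : Set (Config A)) : Set (Word A) :=
  {u | ∃ x ∈ X, ∃ p : ℤ × ℤ, u.OccursAt x p}

/-- `ω` is a `2`-dimensional morphism on the language `L` (its values outside `L` are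
irrelevant): whenever `u`, `v` and the concatenation of `u` and `v` in direction `eᵢ` belong to
`L`, the concatenation of `ω u` and `ω v` in direction `eᵢ` is defined and is the image of the
concatenation of `u` and `v`. -/
structure IsMorphismOn {A B : Type} (L : Set (Word A)) (ω : Word A → Word B) : Prop where
  map_hcat : ∀ u ∈ L, ∀ v ∈ L, ∀ h : u.height = v.height, u.hcat v h ∈ L →
    ∃ h' : (ω u).height = (ω v).height, ω (u.hcat v h) = (ω u).hcat (ω v) h'
  map_vcat : ∀ u ∈ L, ∀ v ∈ L, ∀ h : u.width = v.width, u.vcat v h ∈ L →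
    ∃ h' : (ω u).width = (ω v).width, ω (u.vcat v h) = (ω u).vcat (ω v) h'

/-- `y = ω(x)`: the plane is cut into a grid of rectangles, the rectangle with index `(i, j)` has
its lower left corner at `(W i, H j)` and carries the word `ω(x_{(i,j)})`; the rectangle with
index `(0, 0)` has its lower left corner at the origin. -/
def IsImage {A B : Type} (ω : Word A → Word B) (x : Config A) (y : Config B) : Prop :=
  ∃ W H : ℤ → ℤ, W 0 = 0 ∧ H 0 = 0 ∧ ∀ i j : ℤ,
    W (i + 1) = W i + (ω (Word.single (x (i, j)))).width ∧
    H (j + 1) = H j + (ω (Word.single (x (i, j)))).height ∧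
    (ω (Word.single (x (i, j)))).OccursAt y (W i, H j)

/-- `ω(X)`. -/
def morphismImage {A B : Type} (ω : Word A → Word B) (X : Set (Config A)) : Set (Config B) :=
  {y | ∃ x ∈ X, IsImage ω x y}

/-- `ω` is a `2`-dimensional morphism `X → Y`: a morphism on the language of `X` whose extension
to configurations maps `X` to `Y`. -/
def IsMorphismBetween {A B : Type} (X : Set (Config A)) (Y : Set (Config B))
    (ω : Word A → Word B) : Prop :=
  IsMorphismOn (language X) ω ∧ ∀ x ∈ X, ∃ y ∈ Y, IsImage ω x y

/-- `(k, x)` is a centered `ω`-representation of `y`: `y = σ^k ω(x)` and `y_0` lies inside the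
image of `x_0`. -/
def IsCenteredRepresentation {A B : Type} (ω : Word A → Word B) (k : ℤ × ℤ) (x : Config A)
    (y : Config B) : Prop :=
  (∃ z, IsImage ω x z ∧ y = shift k z) ∧
    0 ≤ k.1 ∧ k.1 < (ω (Word.single (x 0))).width ∧
    0 ≤ k.2 ∧ k.2 < (ω (Word.single (x 0))).height

/-- Every configuration has at most one centered `ω`-representation `(k, x)` with `x ∈ X`. -/
def IsRecognizable {A B : Type} (X : Set (Config A)) (ω : Word A → Word B) : Prop :=
  ∀ (y : Config B) (k k' : ℤ × ℤ), ∀ x ∈ X, ∀ x' ∈ X,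
    IsCenteredRepresentation ω k x y → IsCenteredRepresentation ω k' x' y → k = k' ∧ x = x'

/-- `ω` is onto `Y` up to a shift. -/
def IsOntoUpToShift {A B : Type} (X : Set (Config A)) (Y : Set (Config B))
    (ω : Word A → Word B) : Prop :=
  shiftClosure (morphismImage ω X) = Y

/-- `ω` is expansive on the language `L`: its iterates are defined on the letters and the
width and height of `ω^m(a)` are simultaneously as large as desired, for every letter `a`. -/
def IsExpansiveOn {A : Type} (L : Set (Word A)) (ω : Word A → Word A) : Prop :=
  Set.MapsTo ω L L ∧ ∀ a : A, Word.single a ∈ L ∧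
    ∀ K : ℕ, ∃ m : ℕ, K < min (ω^[m] (Word.single a)).width (ω^[m] (Word.single a)).height

/-- A subshift is self-similar if it is the closure under the shift of its image under an
expansive `2`-dimensional morphism. -/
def IsSelfSimilar {A : Type} [TopologicalSpace A] (X : Set (Config A)) : Prop :=
  IsSubshift X ∧ ∃ ω : Word A → Word A, IsMorphismBetween X X ω ∧
    IsExpansiveOn (language X) ω ∧ IsOntoUpToShift X X ω

/-! ## The two explicit sets of Wang tiles -/

/-- The set of 11 Wang tiles of Jeandel and Rao, as `(right, top, left, bottom)`. -/
def jeandelRaoTiles : WangTileSet where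
  I := Fin 4
  J := Fin 5
  finite_I := inferInstance
  finite_J := inferInstance
  tiles := {⟨2, 4, 2, 1⟩, ⟨2, 2, 2, 0⟩, ⟨1, 1, 3, 1⟩, ⟨1, 2, 3, 2⟩, ⟨3, 1, 3, 3⟩, ⟨0, 1, 3, 1⟩,
    ⟨0, 0, 0, 1⟩, ⟨3, 1, 0, 2⟩, ⟨0, 2, 1, 2⟩, ⟨1, 2, 1, 4⟩, ⟨3, 3, 1, 2⟩}

/-- The vertical colors of the tile set `U`. -/
inductive UVertical
  | A | B | C | D | E | F | G | H | I | J
deriving DecidableEq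

instance : Fintype UVertical :=
  ⟨{.A, .B, .C, .D, .E, .F, .G, .H, .I, .J}, fun x => by cases x <;> decide⟩

/-- The horizontal colors of the tile set `U`. -/
inductive UHorizontal
  | K | L | M | N | O | P
deriving DecidableEq

instance : Fintype UHorizontal :=
  ⟨{.K, .L, .M, .N, .O, .P}, fun x => by cases x <;> decide⟩

/-- The set `U` of 19 Wang tiles, as `(right, top, left, bottom)`. -/
def tilesU : WangTileSet where
  I := UVertical
  J := UHorizontal
  finite_I := inferInstance
  finite_J := inferInstance
  tiles := {⟨.F, .O, .J, .O⟩, ⟨.F, .O, .H, .L⟩, ⟨.J, .M, .F, .P⟩, ⟨.D, .M, .F, .K⟩,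
    ⟨.H, .P, .J, .P⟩, ⟨.H, .P, .H, .N⟩, ⟨.H, .K, .F, .P⟩, ⟨.H, .K, .D, .P⟩, ⟨.B, .O, .I, .O⟩,
    ⟨.G, .L, .E, .O⟩, ⟨.G, .L, .C, .L⟩, ⟨.A, .L, .I, .O⟩, ⟨.E, .P, .G, .P⟩, ⟨.E, .P, .I, .P⟩,
    ⟨.I, .P, .G, .K⟩, ⟨.I, .P, .I, .K⟩, ⟨.I, .K, .B, .M⟩, ⟨.I, .K, .A, .K⟩, ⟨.C, .N, .I, .P⟩}

/-! ## Words -/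

/-- The letter in column `p` and row `q`, with indices beyond the shape clamped. -/
def Word.entry {A : Type} (u : Word A) (p q : ℕ) : A :=
  u.letter ⟨min p (u.width - 1), by have := u.width_pos; omega⟩
    ⟨min q (u.height - 1), by have := u.height_pos; omega⟩

theorem Word.entry_eq {A : Type} (u : Word A) (a : Fin u.width) (b : Fin u.height) :
    u.entry a b = u.letter a b := by
  unfold Word.entry
  congr 1 <;> ext <;> simp <;> omega

theorem Word.occursAt_iff {A : Type} {u : Word A} {x : Config A} {p : ℤ × ℤ} :
    u.OccursAt x p ↔ ∀ a b : ℕ, a < u.width → b < u.height →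
      x (p.1 + a, p.2 + b) = u.entry a b := by
  constructor
  · intro h a b ha hb
    have := h ⟨a, ha⟩ ⟨b, hb⟩
    rw [← Word.entry_eq] at this
    exact this
  · intro h a b
    rw [← Word.entry_eq]
    exact h a b a.2 b.2

theorem Word.ext_entry {A : Type} {u v : Word A} (hw : u.width = v.width)
    (hh : u.height = v.height)
    (h : ∀ a b : ℕ, a < u.width → b < u.height → u.entry a b = v.entry a b) : u = v := by
  have key : ∀ (a : Fin u.width) (b : Fin u.height),
      u.letter a b = v.letter (Fin.cast hw a) (Fin.cast hh b) := by
    intro a b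
    have := h a b a.2 b.2
    rw [Word.entry_eq] at this
    rw [this, ← Word.entry_eq]
    rfl
  obtain ⟨w, h', _, _, l⟩ := u
  obtain ⟨w', h'', _, _, l'⟩ := v
  simp only at hw hh
  subst hw hh
  congr
  funext a b
  exact key a b

theorem Word.OccursAt.unique {A : Type} {u v : Word A} {x : Config A} {p : ℤ × ℤ}
    (hu : u.OccursAt x p) (hv : v.OccursAt x p) (hw : u.width = v.width)
    (hh : u.height = v.height) : u = v := by
  rw [Word.occursAt_iff] at hu hv
  refine Word.ext_entry hw hh fun a b ha hb => ?_
  rw [← hu a b ha hb, ← hv a b (hw ▸ ha) (hh ▸ hb)]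

/-- The word of shape `(w, h)` of `x` with lower left corner at `p`. -/
def Word.window {A : Type} (x : Config A) (p : ℤ × ℤ) (w h : ℕ) (hw : 0 < w) (hh : 0 < h) :
    Word A :=
  ⟨w, h, hw, hh, fun a b => x (p.1 + (a : ℕ), p.2 + (b : ℕ))⟩

theorem Word.window_occursAt {A : Type} (x : Config A) (p : ℤ × ℤ) (w h : ℕ) (hw : 0 < w)
    (hh : 0 < h) : (Word.window x p w h hw hh).OccursAt x p := fun _ _ => rfl

theorem Word.hcat_occursAt_iff {A : Type} {u v : Word A} (h : u.height = v.height)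
    {x : Config A} {p : ℤ × ℤ} : (u.hcat v h).OccursAt x p ↔
      u.OccursAt x p ∧ v.OccursAt x (p.1 + u.width, p.2) := by
  constructor
  · intro H
    refine ⟨fun a b => ?_, fun a b => ?_⟩
    · have := H (Fin.castAdd v.width a) b
      simpa [Word.hcat] using this
    · have := H (Fin.natAdd u.width a) (Fin.cast h.symm b)
      simpa [Word.hcat, add_assoc] using this
  · rintro ⟨hu, hv⟩ a b
    refine Fin.addCases (fun a => ?_) (fun a => ?_) a
    · simpa [Word.hcat] using hu a b
    · simp only [Word.hcat, Fin.addCases_right, Fin.val_natAdd, Nat.cast_add, ← add_assoc]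
      exact hv a (Fin.cast h b)

theorem Word.vcat_occursAt_iff {A : Type} {u v : Word A} (h : u.width = v.width)
    {x : Config A} {p : ℤ × ℤ} : (u.vcat v h).OccursAt x p ↔
      u.OccursAt x p ∧ v.OccursAt x (p.1, p.2 + u.height) := by
  constructor
  · intro H
    refine ⟨fun a b => ?_, fun a b => ?_⟩
    · have := H a (Fin.castAdd v.height b)
      simpa [Word.vcat] using this
    · have := H (Fin.cast h.symm a) (Fin.natAdd u.height b)
      simpa [Word.vcat, add_assoc] using this
  · rintro ⟨hu, hv⟩ a b
    refine Fin.addCases (fun b => ?_) (fun b => ?_) b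
    · simpa [Word.vcat] using hu a b
    · simp only [Word.vcat, Fin.addCases_right, Fin.val_natAdd, Nat.cast_add, ← add_assoc]
      exact hv (Fin.cast h a) b

theorem Word.single_occursAt_iff {A : Type} {a : A} {x : Config A} {p : ℤ × ℤ} :
    (Word.single a).OccursAt x p ↔ x p = a := by
  simp [Word.OccursAt, Word.single]

/-! ## Cuts of the line -/

theorem exists_int_orbit {α : Type*} (e : Equiv.Perm α) (a : α) :
    ∃ f : ℤ → α, f 0 = a ∧ ∀ i, f (i + 1) = e (f i) :=
  ⟨fun i => (e ^ i) a, by simp, fun i => by simp [add_comm i 1, zpow_add]⟩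

theorem exists_int_partial_sums (w : ℤ → ℤ) :
    ∃ W : ℤ → ℤ, W 0 = 0 ∧ ∀ i, W (i + 1) = W i + w i := by
  let e : Equiv.Perm (ℤ × ℤ) :=
    { toFun := fun s => (s.1 + 1, s.2 + w s.1)
      invFun := fun s => (s.1 - 1, s.2 - w (s.1 - 1))
      left_inv := fun s => by simp
      right_inv := fun s => by simp }
  obtain ⟨f, hf0, hf⟩ := exists_int_orbit e (0, 0)
  have h1 : ∀ i, (f i).1 = i := by
    intro i
    induction i using Int.induction_on with
    | zero => simp [hf0]
    | succ n ih => rw [hf]; simp [e, ih]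
    | pred n ih =>
      have := hf (-(n : ℤ) - 1)
      rw [sub_add_cancel] at this
      rw [this] at ih
      simp only [e, Equiv.coe_fn_mk] at ih
      omega
  exact ⟨fun i => (f i).2, by simp [hf0], fun i => by simp [hf, e, h1]⟩

theorem cut_add_le {W : ℤ → ℤ} (hW : ∀ i, W i < W (i + 1)) {i j : ℤ} (h : i ≤ j) :
    W i + (j - i) ≤ W j := by
  induction j, h using Int.leInduction with
  | base => simp
  | succ j _ ih => have := hW j; omega

theorem exists_cell {W : ℤ → ℤ} (hW : ∀ i, W i < W (i + 1)) (p : ℤ) :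
    ∃ i, W i ≤ p ∧ p < W (i + 1) := by
  obtain ⟨i, hi, hmax⟩ := Int.exists_greatest_of_bdd (P := fun i => W i ≤ p)
    ⟨max 0 (p - W 0), fun i hi => by
      by_contra hlt
      have := cut_add_le hW (i := 0) (j := i) (by omega)
      omega⟩
    ⟨min 0 (p - W 0), by
      have := cut_add_le hW (i := min 0 (p - W 0)) (j := 0) (by omega)
      omega⟩
  exact ⟨i, hi, by
    by_contra hlt
    have := hmax (i + 1) (by omega)
    omega⟩

theorem cell_unique {W : ℤ → ℤ} (hW : ∀ i, W i < W (i + 1)) {p i j : ℤ}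
    (hi : W i ≤ p) (hi' : p < W (i + 1)) (hj : W j ≤ p) (hj' : p < W (j + 1)) : i = j := by
  have hm := (strictMono_int_of_lt_succ hW).monotone
  rcases lt_trichotomy i j with h | h | h
  · have := hm (show i + 1 ≤ j by omega); omega
  · exact h
  · have := hm (show j + 1 ≤ i by omega); omega

/-- Two cuts of the line with the same set of cut points differ by a translation of indices. -/
theorem cut_reindex {W W' : ℤ → ℤ} (hW : ∀ i, W i < W (i + 1)) (hW' : ∀ i, W' i < W' (i + 1))
    (h : ∀ m, (∃ i, W i = m) ↔ ∃ i, W' i = m) {j : ℤ} (hj : W 0 = W' j) (i : ℤ) :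
    W i = W' (i + j) := by
  have step : ∀ i k, W i = W' k ↔ W (i + 1) = W' (k + 1) := by
    intro i k
    have m := strictMono_int_of_lt_succ hW
    have m' := strictMono_int_of_lt_succ hW'
    constructor
    · intro e
      obtain ⟨a, ha⟩ := (h _).1 ⟨i + 1, rfl⟩
      obtain ⟨b, hb⟩ := (h _).2 ⟨k + 1, rfl⟩
      have h1 : k < a := m'.lt_iff_lt.1 (by rw [ha, ← e]; exact hW i)
      have h2 : i < b := m.lt_iff_lt.1 (by rw [hb, e]; exact hW' k)
      have h3 := m'.monotone (show k + 1 ≤ a by omega)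
      have h4 := m.monotone (show i + 1 ≤ b by omega)
      omega
    · intro e
      obtain ⟨a, ha⟩ := (h _).1 ⟨i, rfl⟩
      obtain ⟨b, hb⟩ := (h _).2 ⟨k, rfl⟩
      have h1 : a < k + 1 := m'.lt_iff_lt.1 (by rw [ha, ← e]; exact hW i)
      have h2 : b < i + 1 := m.lt_iff_lt.1 (by rw [hb, e]; exact hW' k)
      have h3 := m'.monotone (show a ≤ k by omega)
      have h4 := m.monotone (show b ≤ i by omega)
      omega
  induction i using Int.induction_on with
  | zero => simpa using hj
  | succ n ih => rw [show (n : ℤ) + 1 + j = n + j + 1 by ring]; exact (step _ _).1 ih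
  | pred n ih =>
    refine (step _ _).2 ?_
    rw [show -(n : ℤ) - 1 + 1 = -n by ring, show -(n : ℤ) - 1 + j + 1 = -n + j by ring]
    exact ih

theorem eq_zero_of_ordConnected {α : Type*} {J : Set ℤ} (hJ : J.OrdConnected) (h0 : (0 : ℤ) ∈ J)
    {f : ℤ → α} (hf : ∀ j ∈ J, j + 1 ∈ J → f (j + 1) = f j) {j : ℤ} (hj : j ∈ J) :
    f j = f 0 := by
  induction j using Int.induction_on with
  | zero => rfl
  | succ n ih =>
    have hn : (n : ℤ) ∈ J := hJ.out h0 hj ⟨by omega, by omega⟩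
    rw [hf _ hn hj, ih hn]
  | pred n ih =>
    have hn : -(n : ℤ) ∈ J := hJ.out hj h0 ⟨by omega, by omega⟩
    have := hf _ hj (by simpa using hn)
    rw [sub_add_cancel] at this
    rw [← this, ih hn]

/-! ## Nearest-neighbour shifts and block images -/

/-- The configurations whose horizontal and vertical neighbours satisfy `h` and `v`. -/
def nnShift {A : Type} (h v : A → A → Prop) : Set (Config A) :=
  {x | ∀ n : ℤ × ℤ, h (x n) (x (n + (1, 0))) ∧ v (x n) (x (n + (0, 1)))}

/-- The neighbour conditions of `nnShift` inside the box `I × J`. -/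
def ValidOn {A : Type} (h v : A → A → Prop) (I J : Set ℤ) (x : Config A) : Prop :=
  ∀ i ∈ I, ∀ j ∈ J, (i + 1 ∈ I → h (x (i, j)) (x (i + 1, j))) ∧
    (j + 1 ∈ J → v (x (i, j)) (x (i, j + 1)))

theorem mem_nnShift_iff {A : Type} {h v : A → A → Prop} {x : Config A} :
    x ∈ nnShift h v ↔ ∀ i j : ℤ, h (x (i, j)) (x (i + 1, j)) ∧ v (x (i, j)) (x (i, j + 1)) := by
  simp [nnShift]

theorem validOn_univ_iff {A : Type} {h v : A → A → Prop} {x : Config A} :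
    ValidOn h v Set.univ Set.univ x ↔ x ∈ nnShift h v := by
  simp [ValidOn, mem_nnShift_iff]

theorem shift_mem_nnShift {A : Type} {h v : A → A → Prop} {x : Config A} (k : ℤ × ℤ)
    (hx : x ∈ nnShift h v) : shift k x ∈ nnShift h v := by
  intro n
  have := hx (n + k)
  simp only [shift]
  rwa [add_right_comm n (1, 0) k, add_right_comm n (0, 1) k]

theorem shift_shift {A : Type} (k l : ℤ × ℤ) (x : Config A) :
    shift k (shift l x) = shift (k + l) x := by
  funext m
  simp [shift, add_assoc]

theorem shift_zero {A : Type} (x : Config A) : shift 0 x = x := by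
  funext m
  simp [shift]

/-- Inside the box `I × J` of `x`, the configuration `z` is obtained from `x` by replacing each
letter `x (i, j)` by the block `τ (x (i, j))` placed at `(W i, H j)`. -/
structure IsBlockImageOn {A B : Type} (τ : A → Word B) (I J : Set ℤ) (x : Config A)
    (z : Config B) (W H : ℤ → ℤ) : Prop where
  W_zero : W 0 = 0
  H_zero : H 0 = 0
  W_lt : ∀ i, W i < W (i + 1)
  H_lt : ∀ j, H j < H (j + 1)
  W_succ : ∀ i ∈ I, ∀ j ∈ J, W (i + 1) = W i + (τ (x (i, j))).width
  H_succ : ∀ i ∈ I, ∀ j ∈ J, H (j + 1) = H j + (τ (x (i, j))).height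
  occursAt : ∀ i ∈ I, ∀ j ∈ J, (τ (x (i, j))).OccursAt z (W i, H j)

/-- `z` is the block image of the whole configuration `x`. -/
abbrev IsBlockImage {A B : Type} (τ : A → Word B) (x : Config A) (z : Config B)
    (W H : ℤ → ℤ) : Prop :=
  IsBlockImageOn τ Set.univ Set.univ x z W H

theorem IsBlockImageOn.apply {A B : Type} {τ : A → Word B} {I J : Set ℤ} {x : Config A}
    {z : Config B} {W H : ℤ → ℤ} (h : IsBlockImageOn τ I J x z W H) {i j m n : ℤ} (hi : i ∈ I)
    (hj : j ∈ J) (hm : W i ≤ m) (hm' : m < W (i + 1)) (hn : H j ≤ n) (hn' : n < H (j + 1)) :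
    z (m, n) = (τ (x (i, j))).entry (m - W i).toNat (n - H j).toNat := by
  have hw := h.W_succ i hi j hj
  have hh := h.H_succ i hi j hj
  have := Word.occursAt_iff.1 (h.occursAt i hi j hj) (m - W i).toNat (n - H j).toNat
    (by omega) (by omega)
  rw [← this]
  congr 2 <;> simp only <;> omega

/-- The set of positions covered by the cells of a cut with index in `I`. -/
def coveredBy (W : ℤ → ℤ) (I : Set ℤ) : Set ℤ := {m | ∃ i ∈ I, W i ≤ m ∧ m < W (i + 1)}

/-- `τ` is a substitution by blocks of width and height at most two which is compatible with the
neighbour conditions, and the cuts of the image are read off from the image: in an image, a column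
(a row) starts in the interior of a block exactly if its letters and the letters before satisfy
`Q₁` (satisfy `Q₂`). -/
structure IsBlockSubstitution {A B : Type} (hA vA : A → A → Prop) (hB vB Q₁ Q₂ : B → B → Prop)
    (τ : A → Word B) : Prop where
  width_le : ∀ a, (τ a).width ≤ 2
  height_le : ∀ a, (τ a).height ≤ 2
  inner_h : ∀ a p q, p + 1 < (τ a).width → q < (τ a).height →
    hB ((τ a).entry p q) ((τ a).entry (p + 1) q)
  inner_v : ∀ a p q, p < (τ a).width → q + 1 < (τ a).height →
    vB ((τ a).entry p q) ((τ a).entry p (q + 1))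
  h_iff : ∀ a b, hA a b ↔ (τ a).height = (τ b).height ∧ ∀ q < (τ a).height,
    hB ((τ a).entry ((τ a).width - 1) q) ((τ b).entry 0 q)
  v_iff : ∀ a b, vA a b ↔ (τ a).width = (τ b).width ∧ ∀ p < (τ a).width,
    vB ((τ a).entry p ((τ a).height - 1)) ((τ b).entry p 0)
  start_h : ∀ a b, hA a b → ∀ q < (τ a).height,
    ¬ Q₁ ((τ a).entry ((τ a).width - 1) q) ((τ b).entry 0 q)
  start_v : ∀ a b, vA a b → ∀ p < (τ a).width,
    ¬ Q₂ ((τ a).entry p ((τ a).height - 1)) ((τ b).entry p 0)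
  cont_h : ∀ a p q, p + 1 < (τ a).width → q < (τ a).height →
    Q₁ ((τ a).entry p q) ((τ a).entry (p + 1) q)
  cont_v : ∀ a p q, p < (τ a).width → q + 1 < (τ a).height →
    Q₂ ((τ a).entry p q) ((τ a).entry p (q + 1))
  inj : Function.Injective τ
  col : ∀ y ∈ nnShift hB vB, ∀ m n : ℤ,
    Q₁ (y (m, n)) (y (m + 1, n)) ↔ Q₁ (y (m, n + 1)) (y (m + 1, n + 1))
  row : ∀ y ∈ nnShift hB vB, ∀ m n : ℤ,
    Q₂ (y (m, n)) (y (m, n + 1)) ↔ Q₂ (y (m + 1, n)) (y (m + 1, n + 1))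
  sep_h : ∀ y ∈ nnShift hB vB, ∀ m n : ℤ,
    Q₁ (y (m, n)) (y (m + 1, n)) → ¬ Q₁ (y (m + 1, n)) (y (m + 1 + 1, n))
  sep_v : ∀ y ∈ nnShift hB vB, ∀ m n : ℤ,
    Q₂ (y (m, n)) (y (m, n + 1)) → ¬ Q₂ (y (m, n + 1)) (y (m, n + 1 + 1))
  cover : ∀ y ∈ nnShift hB vB, ∀ m n : ℤ, ¬ Q₁ (y (m - 1, n)) (y (m, n)) →
    ¬ Q₂ (y (m, n - 1)) (y (m, n)) → ∃ a, (τ a).OccursAt y (m, n) ∧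
      ((τ a).width = 2 ↔ Q₁ (y (m, n)) (y (m + 1, n))) ∧
      ((τ a).height = 2 ↔ Q₂ (y (m, n)) (y (m, n + 1)))

namespace IsBlockSubstitution

variable {A B : Type} {hA vA : A → A → Prop} {hB vB Q₁ Q₂ : B → B → Prop} {τ : A → Word B}

/-- Every valid configuration has a block image. -/
theorem exists_image (S : IsBlockSubstitution hA vA hB vB Q₁ Q₂ τ) {I J : Set ℤ}
    (hI : I.OrdConnected) (hJ : J.OrdConnected) (hI0 : (0 : ℤ) ∈ I) (hJ0 : (0 : ℤ) ∈ J)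
    {x : Config A} (hx : ValidOn hA vA I J x) : ∃ z W H, IsBlockImageOn τ I J x z W H := by
  obtain ⟨W, hW0, hW⟩ := exists_int_partial_sums fun i => ((τ (x (i, 0))).width : ℤ)
  obtain ⟨H, hH0, hH⟩ := exists_int_partial_sums fun j => ((τ (x (0, j))).height : ℤ)
  have hWlt : ∀ i, W i < W (i + 1) := fun i => by
    have := (τ (x (i, 0))).width_pos; have := hW i; omega
  have hHlt : ∀ i, H i < H (i + 1) := fun i => by
    have := (τ (x (0, i))).height_pos; have := hH i; omega
  have hw : ∀ i ∈ I, ∀ j ∈ J, (τ (x (i, j))).width = (τ (x (i, 0))).width := fun i hi j hj =>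
    eq_zero_of_ordConnected (f := fun j => (τ (x (i, j))).width) hJ hJ0
      (fun j hj hj' => (((S.v_iff _ _).1 ((hx i hi j hj).2 hj')).1).symm) hj
  have hh : ∀ i ∈ I, ∀ j ∈ J, (τ (x (i, j))).height = (τ (x (0, j))).height := fun i hi j hj =>
    eq_zero_of_ordConnected (f := fun i => (τ (x (i, j))).height) hI hI0
      (fun i hi hi' => (((S.h_iff _ _).1 ((hx i hi j hj).1 hi')).1).symm) hi
  choose c hc hc' using exists_cell hWlt
  choose d hd hd' using exists_cell hHlt
  refine ⟨fun m => (τ (x (c m.1, d m.2))).entry (m.1 - W (c m.1)).toNat (m.2 - H (d m.2)).toNat,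
    W, H, hW0, hH0, hWlt, hHlt, fun i hi j hj => by rw [hW, hw i hi j hj],
    fun i hi j hj => by rw [hH, hh i hi j hj], fun i hi j hj => ?_⟩
  rw [Word.occursAt_iff]
  intro a b ha hb
  rw [hw i hi j hj] at ha
  rw [hh i hi j hj] at hb
  have hci : c (W i + a) = i := cell_unique hWlt (hc _) (hc' _) (by omega) (by have := hW i; omega)
  have hdj : d (H j + b) = j := cell_unique hHlt (hd _) (hd' _) (by omega) (by have := hH j; omega)
  simp [hci, hdj]

/-- The block image of a valid configuration is valid. -/
theorem image_valid (S : IsBlockSubstitution hA vA hB vB Q₁ Q₂ τ) {I J : Set ℤ}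
    {x : Config A} (hx : ValidOn hA vA I J x) {z : Config B} {W H : ℤ → ℤ}
    (h : IsBlockImageOn τ I J x z W H) : ValidOn hB vB (coveredBy W I) (coveredBy H J) z := by
  rintro m ⟨i, hi, hm, hm'⟩ n ⟨j, hj, hn, hn'⟩
  have hw := h.W_succ i hi j hj
  have hh := h.H_succ i hi j hj
  have e := h.apply hi hj hm hm' hn hn'
  have hW2 := h.W_lt (i + 1)
  have hH2 := h.H_lt (j + 1)
  constructor
  · rintro ⟨i', hi', hm1, hm1'⟩
    rw [e]
    by_cases hlt : m + 1 < W (i + 1)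
    · rw [h.apply hi hj (by omega) hlt hn hn']
      have := S.inner_h (x (i, j)) (m - W i).toNat (n - H j).toNat (by omega) (by omega)
      rwa [show (m - W i).toNat + 1 = (m + 1 - W i).toNat by omega] at this
    · obtain rfl : i' = i + 1 := cell_unique h.W_lt hm1 hm1' (by omega) (by omega)
      rw [h.apply hi' hj (by omega) (by omega) hn hn']
      have := ((S.h_iff _ _).1 ((hx i hi j hj).1 hi')).2 (n - H j).toNat (by omega)
      rwa [show (τ (x (i, j))).width - 1 = (m - W i).toNat by omega,
        show 0 = (m + 1 - W (i + 1)).toNat by omega] at this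
  · rintro ⟨j', hj', hn1, hn1'⟩
    rw [e]
    by_cases hlt : n + 1 < H (j + 1)
    · rw [h.apply hi hj hm hm' (by omega) hlt]
      have := S.inner_v (x (i, j)) (m - W i).toNat (n - H j).toNat (by omega) (by omega)
      rwa [show (n - H j).toNat + 1 = (n + 1 - H j).toNat by omega] at this
    · obtain rfl : j' = j + 1 := cell_unique h.H_lt hn1 hn1' (by omega) (by omega)
      rw [h.apply hi hj' hm hm' (by omega) (by omega)]
      have := ((S.v_iff _ _).1 ((hx i hi j hj).2 hj')).2 (m - W i).toNat (by omega)
      rwa [show (τ (x (i, j))).height - 1 = (n - H j).toNat by omega,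
        show 0 = (n + 1 - H (j + 1)).toNat by omega] at this

theorem image_mem (S : IsBlockSubstitution hA vA hB vB Q₁ Q₂ τ) {x : Config A}
    (hx : x ∈ nnShift hA vA) {z : Config B} {W H : ℤ → ℤ} (h : IsBlockImage τ x z W H) :
    z ∈ nnShift hB vB := by
  have := S.image_valid (validOn_univ_iff.2 hx) h
  have hW : coveredBy W Set.univ = Set.univ := Set.eq_univ_of_forall fun m => by
    simpa [coveredBy] using exists_cell h.W_lt m
  have hH : coveredBy H Set.univ = Set.univ := Set.eq_univ_of_forall fun m => by
    simpa [coveredBy] using exists_cell h.H_lt m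
  rwa [hW, hH, validOn_univ_iff] at this

theorem exists_image_mem (S : IsBlockSubstitution hA vA hB vB Q₁ Q₂ τ) {x : Config A}
    (hx : x ∈ nnShift hA vA) : ∃ z ∈ nnShift hB vB, ∃ W H, IsBlockImage τ x z W H := by
  obtain ⟨z, W, H, h⟩ := S.exists_image Set.ordConnected_univ Set.ordConnected_univ
    (Set.mem_univ _) (Set.mem_univ _) (validOn_univ_iff.2 hx)
  exact ⟨z, S.image_mem hx h, W, H, h⟩

/-- The vertical cuts of an image are the columns which do not satisfy `Q₁`. -/
theorem exists_W_eq_iff (S : IsBlockSubstitution hA vA hB vB Q₁ Q₂ τ) {x : Config A}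
    (hx : x ∈ nnShift hA vA) {z : Config B} {W H : ℤ → ℤ} (h : IsBlockImage τ x z W H)
    (m n : ℤ) : (∃ i, W i = m) ↔ ¬ Q₁ (z (m - 1, n)) (z (m, n)) := by
  have t : ∀ i : ℤ, i ∈ Set.univ := Set.mem_univ
  obtain ⟨j, hn, hn'⟩ := exists_cell h.H_lt n
  obtain ⟨i, hm, hm'⟩ := exists_cell h.W_lt m
  have hh := h.H_succ i (t _) j (t _)
  have hw := h.W_succ i (t _) j (t _)
  rw [h.apply (t i) (t j) hm hm' hn hn']
  by_cases hlt : W i = m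
  · refine iff_of_true ⟨i, hlt⟩ ?_
    have h1 := h.W_lt (i - 1)
    have hw1 := h.W_succ (i - 1) (t _) j (t _)
    have hh1 := h.H_succ (i - 1) (t _) j (t _)
    rw [sub_add_cancel] at h1 hw1
    rw [h.apply (t (i - 1)) (t j) (m := m - 1) (by omega) (by rw [sub_add_cancel]; omega) hn hn']
    have h2 := (mem_nnShift_iff.1 hx (i - 1) j).1
    rw [sub_add_cancel] at h2
    have := S.start_h _ _ h2 (n - H j).toNat (by omega)
    rwa [show (τ (x (i - 1, j))).width - 1 = (m - 1 - W (i - 1)).toNat by omega,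
      show 0 = (m - W i).toNat by omega] at this
  · refine iff_of_false ?_ ?_
    · rintro ⟨i', rfl⟩
      exact hlt (congrArg W (cell_unique h.W_lt hm hm' le_rfl (h.W_lt i')))
    · rw [not_not, h.apply (t i) (t j) (m := m - 1) (by omega) (by omega) hn hn']
      have := S.cont_h (x (i, j)) (m - 1 - W i).toNat (n - H j).toNat (by omega) (by omega)
      rwa [show (m - 1 - W i).toNat + 1 = (m - W i).toNat by omega] at this

/-- The horizontal cuts of an image are the rows which do not satisfy `Q₂`. -/
theorem exists_H_eq_iff (S : IsBlockSubstitution hA vA hB vB Q₁ Q₂ τ) {x : Config A}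
    (hx : x ∈ nnShift hA vA) {z : Config B} {W H : ℤ → ℤ} (h : IsBlockImage τ x z W H)
    (m n : ℤ) : (∃ j, H j = n) ↔ ¬ Q₂ (z (m, n - 1)) (z (m, n)) := by
  have t : ∀ i : ℤ, i ∈ Set.univ := Set.mem_univ
  obtain ⟨j, hn, hn'⟩ := exists_cell h.H_lt n
  obtain ⟨i, hm, hm'⟩ := exists_cell h.W_lt m
  have hh := h.H_succ i (t _) j (t _)
  have hw := h.W_succ i (t _) j (t _)
  rw [h.apply (t i) (t j) hm hm' hn hn']
  by_cases hlt : H j = n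
  · refine iff_of_true ⟨j, hlt⟩ ?_
    have h1 := h.H_lt (j - 1)
    have hw1 := h.W_succ i (t _) (j - 1) (t _)
    have hh1 := h.H_succ i (t _) (j - 1) (t _)
    rw [sub_add_cancel] at h1 hh1
    rw [h.apply (t i) (t (j - 1)) (n := n - 1) hm hm' (by omega) (by rw [sub_add_cancel]; omega)]
    have h2 := (mem_nnShift_iff.1 hx i (j - 1)).2
    rw [sub_add_cancel] at h2
    have := S.start_v _ _ h2 (m - W i).toNat (by omega)
    rwa [show (τ (x (i, j - 1))).height - 1 = (n - 1 - H (j - 1)).toNat by omega,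
      show 0 = (n - H j).toNat by omega] at this
  · refine iff_of_false ?_ ?_
    · rintro ⟨j', rfl⟩
      exact hlt (congrArg H (cell_unique h.H_lt hn hn' le_rfl (h.H_lt j')))
    · rw [not_not, h.apply (t i) (t j) (n := n - 1) hm hm' (by omega) (by omega)]
      have := S.cont_v (x (i, j)) (m - W i).toNat (n - 1 - H j).toNat (by omega) (by omega)
      rwa [show (n - 1 - H j).toNat + 1 = (n - H j).toNat by omega] at this

end IsBlockSubstitution

theorem exists_cut_of_sparse {P : ℤ → Prop} (hP : ∀ m, ¬ P m → P (m + 1)) :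
    ∃ W : ℤ → ℤ, (∀ i, P (W i)) ∧
      (∀ i, (P (W i + 1) → W (i + 1) = W i + 1) ∧ (¬ P (W i + 1) → W (i + 1) = W i + 2)) ∧
      W 0 ≤ 0 ∧ 0 < W 1 := by
  classical
  have hP' : ∀ m, ¬ P (m - 1) → P (m - 2) := fun m hm => by
    by_contra h
    exact hm (by simpa [show m - 2 + 1 = m - 1 by ring] using hP _ h)
  let e : Equiv.Perm {m // P m} :=
    { toFun := fun m => if h : P (m + 1) then ⟨m + 1, h⟩ else ⟨m + 1 + 1, hP _ h⟩
      invFun := fun m => if h : P (m - 1) then ⟨m - 1, h⟩ else ⟨m - 2, hP' _ h⟩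
      left_inv := fun ⟨m, hm⟩ => by
        by_cases h : P (m + 1)
        · simp [h, hm]
        · simp [h, show m + 1 + 1 - 2 = m by ring]
      right_inv := fun ⟨m, hm⟩ => by
        by_cases h : P (m - 1)
        · simp [h, hm]
        · simp [h, show m - 2 + 1 = m - 1 by ring] }
  obtain ⟨s, hs, hs'⟩ : ∃ s : {m // P m}, s.1 ≤ 0 ∧ 0 < (e s).1 := by
    by_cases h0 : P 0
    · refine ⟨⟨0, h0⟩, le_rfl, ?_⟩
      by_cases h : P 1 <;> simp [e, h]
    · refine ⟨⟨-1, by simpa using hP' 1 (by simpa using h0)⟩, by simp, ?_⟩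
      simp [e, h0]
  obtain ⟨f, hf0, hf⟩ := exists_int_orbit e s
  refine ⟨fun i => (f i).1, fun i => (f i).2, fun i => ⟨fun h => ?_, fun h => ?_⟩, ?_, ?_⟩
  · simp [hf, e, h]
  · simp [hf, e, h, add_assoc]
  · simpa [hf0] using hs
  · have := hf 0
    rw [zero_add, hf0] at this
    simpa [this] using hs'

namespace IsBlockSubstitution

variable {A B : Type} {hA vA : A → A → Prop} {hB vB Q₁ Q₂ : B → B → Prop} {τ : A → Word B}

theorem col_iff (S : IsBlockSubstitution hA vA hB vB Q₁ Q₂ τ) {y : Config B}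
    (hy : y ∈ nnShift hB vB) (m n n' : ℤ) :
    Q₁ (y (m, n)) (y (m + 1, n)) ↔ Q₁ (y (m, n')) (y (m + 1, n')) := by
  have key : ∀ n, Q₁ (y (m, n)) (y (m + 1, n)) ↔ Q₁ (y (m, 0)) (y (m + 1, 0)) := by
    intro n
    induction n using Int.induction_on with
    | zero => rfl
    | succ n ih => rw [← S.col y hy, ih]
    | pred n ih => rw [S.col y hy, sub_add_cancel, ih]
  rw [key n, key n']

theorem row_iff (S : IsBlockSubstitution hA vA hB vB Q₁ Q₂ τ) {y : Config B}
    (hy : y ∈ nnShift hB vB) (m m' n : ℤ) :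
    Q₂ (y (m, n)) (y (m, n + 1)) ↔ Q₂ (y (m', n)) (y (m', n + 1)) := by
  have key : ∀ m, Q₂ (y (m, n)) (y (m, n + 1)) ↔ Q₂ (y (0, n)) (y (0, n + 1)) := by
    intro m
    induction m using Int.induction_on with
    | zero => rfl
    | succ n ih => rw [← S.row y hy, ih]
    | pred n ih => rw [S.row y hy, sub_add_cancel, ih]
  rw [key m, key m']

/-- Every configuration of the target is, up to a shift, a block image. -/
theorem exists_preimage (S : IsBlockSubstitution hA vA hB vB Q₁ Q₂ τ) {y : Config B}
    (hy : y ∈ nnShift hB vB) : ∃ x ∈ nnShift hA vA, ∃ z W H, ∃ k : ℤ × ℤ,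
      IsBlockImage τ x z W H ∧ y = shift k z ∧ 0 ≤ k.1 ∧ k.1 < W 1 ∧ 0 ≤ k.2 ∧ k.2 < H 1 := by
  obtain ⟨W, hWP, hW, hW0, hW1⟩ := exists_cut_of_sparse
    (P := fun m => ¬ Q₁ (y (m - 1, 0)) (y (m, 0))) (fun m hm => by
      have := S.sep_h y hy (m - 1) 0
      rw [sub_add_cancel] at this
      rw [add_sub_cancel_right]
      exact this (not_not.1 hm))
  obtain ⟨H, hHP, hH, hH0, hH1⟩ := exists_cut_of_sparse
    (P := fun n => ¬ Q₂ (y (0, n - 1)) (y (0, n))) (fun n hn => by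
      have := S.sep_v y hy 0 (n - 1)
      rw [sub_add_cancel] at this
      rw [add_sub_cancel_right]
      exact this (not_not.1 hn))
  simp only [add_sub_cancel_right] at hW hH
  have hc : ∀ p : ℤ × ℤ, ∃ a, (τ a).OccursAt y (W p.1, H p.2) ∧
      W (p.1 + 1) = W p.1 + (τ a).width ∧ H (p.2 + 1) = H p.2 + (τ a).height := by
    rintro ⟨i, j⟩
    obtain ⟨a, ha, h1, h2⟩ := S.cover y hy (W i) (H j)
      (by have := S.col_iff hy (W i - 1) (H j) 0
          rw [sub_add_cancel] at this
          rw [this]; exact hWP i)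
      (by have := S.row_iff hy (W i) 0 (H j - 1)
          rw [sub_add_cancel] at this
          rw [this]; exact hHP j)
    rw [S.col_iff hy _ _ 0] at h1
    rw [S.row_iff hy _ 0 _] at h2
    have w0 := (τ a).width_pos
    have w1 := S.width_le a
    have l0 := (τ a).height_pos
    have l1 := S.height_le a
    refine ⟨a, ha, ?_, ?_⟩
    · by_cases hq : Q₁ (y (W i, 0)) (y (W i + 1, 0))
      · rw [(hW i).2 (not_not.2 hq), h1.2 hq]; rfl
      · have : (τ a).width = 1 := by have := mt h1.1 hq; omega
        rw [(hW i).1 hq, this]; rfl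
    · by_cases hq : Q₂ (y (0, H j)) (y (0, H j + 1))
      · rw [(hH j).2 (not_not.2 hq), h2.2 hq]; rfl
      · have : (τ a).height = 1 := by have := mt h2.1 hq; omega
        rw [(hH j).1 hq, this]; rfl
  choose x hx hxW hxH using hc
  have hWlt : ∀ i, W i < W (i + 1) := fun i => by
    have h := hxW (i, 0); have := (τ (x (i, 0))).width_pos; simp only at h; omega
  have hHlt : ∀ j, H j < H (j + 1) := fun j => by
    have h := hxH (0, j); have := (τ (x (0, j))).height_pos; simp only at h; omega
  refine ⟨x, ?_, shift (W 0, H 0) y, fun i => W i - W 0, fun j => H j - H 0, (-W 0, -H 0),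
    ⟨by simp, by simp, fun i => by have := hWlt i; omega, fun j => by have := hHlt j; omega,
      fun i _ j _ => by have := hxW (i, j); simp only at this; omega,
      fun i _ j _ => by have := hxH (i, j); simp only at this; omega, fun i _ j _ => ?_⟩,
    ?_, by simpa using hW0, by simp only; omega, by simpa using hH0, by simp only; omega⟩
  · rw [mem_nnShift_iff]
    rw [mem_nnShift_iff] at hy
    refine fun i j => ⟨(S.h_iff _ _).2 ⟨?_, fun q hq => ?_⟩,
      (S.v_iff _ _).2 ⟨?_, fun q hq => ?_⟩⟩
    · have h1 := hxH (i, j); have h2 := hxH (i + 1, j); simp only at h1 h2; omega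
    · have h1 := hxW (i, j)
      have h2 := hxH (i, j); have h3 := hxH (i + 1, j)
      have h4 := (τ (x (i, j))).width_pos
      simp only at h1 h2 h3
      rw [← Word.occursAt_iff.1 (hx (i, j)) _ _ (by omega) hq,
        ← Word.occursAt_iff.1 (hx (i + 1, j)) 0 q (Word.width_pos _) (by omega)]
      have := (hy (W i + ((τ (x (i, j))).width - 1 : ℕ)) (H j + q)).1
      rwa [show W i + ((τ (x (i, j))).width - 1 : ℕ) + 1 = W (i + 1) + (0 : ℕ) by omega] at this
    · have h1 := hxW (i, j); have h2 := hxW (i, j + 1); simp only at h1 h2; omega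
    · have h1 := hxH (i, j)
      have h2 := hxW (i, j); have h3 := hxW (i, j + 1)
      have h4 := (τ (x (i, j))).height_pos
      simp only at h1 h2 h3
      rw [← Word.occursAt_iff.1 (hx (i, j)) _ _ hq (by omega),
        ← Word.occursAt_iff.1 (hx (i, j + 1)) q 0 (by omega) (Word.height_pos _)]
      have := (hy (W i + q) (H j + ((τ (x (i, j))).height - 1 : ℕ))).2
      rwa [show H j + ((τ (x (i, j))).height - 1 : ℕ) + 1 = H (j + 1) + (0 : ℕ) by omega] at this
  · have := hx (i, j)
    intro a b
    rw [← this a b]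
    simp only [shift, Prod.mk_add_mk]
    congr 2 <;> ring
  · rw [shift_shift]; simp [Prod.mk_zero_zero, shift_zero]

/-- If two block images are shifts of one another, so are the configurations they come from. -/
theorem exists_shift_eq (S : IsBlockSubstitution hA vA hB vB Q₁ Q₂ τ) {x x' : Config A}
    (hx : x ∈ nnShift hA vA) (hx' : x' ∈ nnShift hA vA) {z z' : Config B} {W H W' H' : ℤ → ℤ}
    (h : IsBlockImage τ x z W H) (h' : IsBlockImage τ x' z' W' H') {p : ℤ × ℤ}
    (hz : z' = shift p z) : ∃ q : ℤ × ℤ, (∀ i, W' i + p.1 = W (i + q.1)) ∧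
      (∀ j, H' j + p.2 = H (j + q.2)) ∧ x' = shift q x := by
  have t : ∀ i : ℤ, i ∈ Set.univ := Set.mem_univ
  obtain ⟨p₁, p₂⟩ := p
  have hW : ∀ m, (∃ i, W' i + p₁ = m) ↔ ∃ i, W i = m := fun m => by
    rw [S.exists_W_eq_iff hx h m (0 + p₂)]
    have := S.exists_W_eq_iff hx' h' (m - p₁) 0
    simp only [hz, shift, Prod.mk_add_mk, sub_add_cancel, eq_sub_iff_add_eq,
      show m - p₁ - 1 + p₁ = m - 1 by ring] at this
    exact this
  have hH : ∀ n, (∃ j, H' j + p₂ = n) ↔ ∃ j, H j = n := fun n => by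
    rw [S.exists_H_eq_iff hx h (0 + p₁) n]
    have := S.exists_H_eq_iff hx' h' 0 (n - p₂)
    simp only [hz, shift, Prod.mk_add_mk, sub_add_cancel, eq_sub_iff_add_eq,
      show n - p₂ - 1 + p₂ = n - 1 by ring] at this
    exact this
  obtain ⟨q₁, hq₁⟩ := (hW _).1 ⟨0, rfl⟩
  obtain ⟨q₂, hq₂⟩ := (hH _).1 ⟨0, rfl⟩
  have e₁ := cut_reindex (W := fun i => W' i + p₁) (fun i => by have := h'.W_lt i; omega) h.W_lt
    hW hq₁.symm
  have e₂ := cut_reindex (W := fun i => H' i + p₂) (fun i => by have := h'.H_lt i; omega) h.H_lt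
    hH hq₂.symm
  refine ⟨(q₁, q₂), e₁, e₂, ?_⟩
  funext ⟨i, j⟩
  apply S.inj
  have o' := h'.occursAt i (t _) j (t _)
  have o := h.occursAt (i + q₁) (t _) (j + q₂) (t _)
  have w := h.W_succ (i + q₁) (t _) (j + q₂) (t _)
  have w' := h'.W_succ i (t _) j (t _)
  have l := h.H_succ (i + q₁) (t _) (j + q₂) (t _)
  have l' := h'.H_succ i (t _) j (t _)
  have a1 := e₁ i
  have a2 := e₁ (i + 1)
  have a3 := e₂ j
  have a4 := e₂ (j + 1)
  rw [add_right_comm] at a2 a4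
  refine Word.OccursAt.unique (x := z) (p := (W (i + q₁), H (j + q₂))) ?_ o ?_ ?_
  · intro a b
    rw [← o' a b, hz]
    simp only [shift, Prod.mk_add_mk]
    congr 2 <;> omega
  · simp only [shift, Prod.mk_add_mk]; omega
  · simp only [shift, Prod.mk_add_mk]; omega

theorem centered_unique (S : IsBlockSubstitution hA vA hB vB Q₁ Q₂ τ) {x x' : Config A}
    (hx : x ∈ nnShift hA vA) (hx' : x' ∈ nnShift hA vA) {z z' : Config B} {W H W' H' : ℤ → ℤ}
    (h : IsBlockImage τ x z W H) (h' : IsBlockImage τ x' z' W' H') {k k' : ℤ × ℤ}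
    (hz : shift k z = shift k' z') (hk : 0 ≤ k.1 ∧ k.1 < W 1 ∧ 0 ≤ k.2 ∧ k.2 < H 1)
    (hk' : 0 ≤ k'.1 ∧ k'.1 < W' 1 ∧ 0 ≤ k'.2 ∧ k'.2 < H' 1) : k = k' ∧ x = x' := by
  have hz' : z' = shift (k - k') z := by
    rw [sub_eq_neg_add, ← shift_shift, hz, shift_shift, neg_add_cancel, shift_zero]
  obtain ⟨q, e₁, e₂, rfl⟩ := S.exists_shift_eq hx hx' h h' hz'
  have a0 := e₁ 0
  have a1 := e₁ 1
  have b0 := e₂ 0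
  have b1 := e₂ 1
  rw [h'.W_zero, zero_add, zero_add] at a0
  rw [h'.H_zero, zero_add, zero_add] at b0
  rw [add_comm 1] at a1 b1
  simp only [Prod.fst_sub, Prod.snd_sub] at a0 a1 b0 b1
  have hq1 : q.1 = 0 := cell_unique h.W_lt (p := k.1) (by omega) (by omega)
    (by rw [h.W_zero]; omega) (by rw [zero_add]; omega)
  have hq2 : q.2 = 0 := cell_unique h.H_lt (p := k.2) (by omega) (by omega)
    (by rw [h.H_zero]; omega) (by rw [zero_add]; omega)
  have hq : q = 0 := Prod.ext hq1 hq2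
  rw [hq1, h.W_zero] at a0
  rw [hq2, h.H_zero] at b0
  exact ⟨Prod.ext (by omega) (by omega), by rw [hq, shift_zero]⟩

end IsBlockSubstitution

/-! ## The morphism of a block substitution -/

/-- `v` is the image of the word `u` in the image of some configuration of `X` containing `u`. -/
def IsWordImage {A B : Type} (X : Set (Config A)) (τ : A → Word B) (u : Word A) (v : Word B) :
    Prop :=
  ∃ x ∈ X, ∃ z W H, ∃ p : ℤ × ℤ, IsBlockImage τ x z W H ∧ u.OccursAt x p ∧
    v.OccursAt z (W p.1, H p.2) ∧ (v.width : ℤ) = W (p.1 + u.width) - W p.1 ∧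
    (v.height : ℤ) = H (p.2 + u.height) - H p.2

theorem IsWordImage.unique {A B : Type} {X : Set (Config A)} {τ : A → Word B} {u : Word A}
    {v v' : Word B} (h : IsWordImage X τ u v) (h' : IsWordImage X τ u v') : v = v' := by
  have t : ∀ i : ℤ, i ∈ Set.univ := Set.mem_univ
  obtain ⟨x, -, z, W, H, p, hz, hu, hv, hw, hh⟩ := h
  obtain ⟨x', -, z', W', H', p', hz', hu', hv', hw', hh'⟩ := h'
  rw [Word.occursAt_iff] at hu hu' hv hv'
  have eW : ∀ i : ℕ, i ≤ u.width → W (p.1 + i) - W p.1 = W' (p'.1 + i) - W' p'.1 := by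
    intro i hi
    induction i with
    | zero => simp
    | succ i ih =>
      have h1 := hz.W_succ (p.1 + i) (t _) (p.2 + (0 : ℕ)) (t _)
      have h2 := hz'.W_succ (p'.1 + i) (t _) (p'.2 + (0 : ℕ)) (t _)
      rw [hu i 0 hi u.height_pos] at h1
      rw [hu' i 0 hi u.height_pos] at h2
      have := ih (by omega)
      push_cast
      rw [← add_assoc, ← add_assoc]
      omega
  have eH : ∀ i : ℕ, i ≤ u.height → H (p.2 + i) - H p.2 = H' (p'.2 + i) - H' p'.2 := by
    intro i hi
    induction i with
    | zero => simp
    | succ i ih =>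
      have h1 := hz.H_succ (p.1 + (0 : ℕ)) (t _) (p.2 + i) (t _)
      have h2 := hz'.H_succ (p'.1 + (0 : ℕ)) (t _) (p'.2 + i) (t _)
      rw [hu 0 i u.width_pos hi] at h1
      rw [hu' 0 i u.width_pos hi] at h2
      have := ih (by omega)
      push_cast
      rw [← add_assoc, ← add_assoc]
      omega
  have ew := eW _ le_rfl
  have eh := eH _ le_rfl
  refine Word.ext_entry (by omega) (by omega) fun a b ha hb => ?_
  rw [← hv a b ha hb, ← hv' a b (by omega) (by omega)]
  obtain ⟨i, hi, hi'⟩ := exists_cell hz.W_lt (W p.1 + a)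
  obtain ⟨j, hj, hj'⟩ := exists_cell hz.H_lt (H p.2 + b)
  have mW := strictMono_int_of_lt_succ hz.W_lt
  have mH := strictMono_int_of_lt_succ hz.H_lt
  have i0 : p.1 ≤ i := Int.lt_add_one_iff.1 (mW.lt_iff_lt.1 (by omega : W p.1 < W (i + 1)))
  have i1 : i < p.1 + u.width := mW.lt_iff_lt.1 (by omega)
  have j0 : p.2 ≤ j := Int.lt_add_one_iff.1 (mH.lt_iff_lt.1 (by omega : H p.2 < H (j + 1)))
  have j1 : j < p.2 + u.height := mH.lt_iff_lt.1 (by omega)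
  obtain ⟨c, rfl⟩ : ∃ c : ℕ, i = p.1 + c := ⟨(i - p.1).toNat, by omega⟩
  obtain ⟨d, rfl⟩ : ∃ d : ℕ, j = p.2 + d := ⟨(j - p.2).toNat, by omega⟩
  have c0 := eW c (by omega)
  have c1 := eW (c + 1) (by omega)
  have d0 := eH d (by omega)
  have d1 := eH (d + 1) (by omega)
  push_cast at c1 d1
  rw [← add_assoc, ← add_assoc] at c1 d1
  rw [hz.apply (t _) (t _) hi hi' hj hj',
    hz'.apply (i := p'.1 + c) (j := p'.2 + d) (t _) (t _) (by omega) (by omega) (by omega)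
      (by omega), hu c d (by omega) (by omega), hu' c d (by omega) (by omega)]
  congr 2 <;> omega

open Classical in
/-- The extension of a block map to the words of the language of `X`. -/
noncomputable def wordMap {A B : Type} (X : Set (Config A)) (τ : A → Word B) (u : Word A) :
    Word B :=
  if h : ∃ v, IsWordImage X τ u v then h.choose else τ (u.entry 0 0)

theorem IsWordImage.wordMap_eq {A B : Type} {X : Set (Config A)} {τ : A → Word B} {u : Word A}
    {v : Word B} (h : IsWordImage X τ u v) : wordMap X τ u = v := by
  have h' : ∃ v, IsWordImage X τ u v := ⟨v, h⟩
  rw [wordMap, dif_pos h']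
  exact h'.choose_spec.unique h

theorem IsBlockImageOn.isWordImage {A B : Type} {X : Set (Config A)} {τ : A → Word B}
    {x : Config A} {z : Config B} {W H : ℤ → ℤ} (h : IsBlockImage τ x z W H) (hx : x ∈ X)
    {u : Word A} {p : ℤ × ℤ} (hu : u.OccursAt x p) :
    IsWordImage X τ u (wordMap X τ u) ∧ (wordMap X τ u).OccursAt z (W p.1, H p.2) ∧
      ((wordMap X τ u).width : ℤ) = W (p.1 + u.width) - W p.1 ∧
      ((wordMap X τ u).height : ℤ) = H (p.2 + u.height) - H p.2 := by
  have hw := strictMono_int_of_lt_succ h.W_lt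
    (show p.1 < p.1 + u.width by have := u.width_pos; omega)
  have hh := strictMono_int_of_lt_succ h.H_lt
    (show p.2 < p.2 + u.height by have := u.height_pos; omega)
  let v := Word.window z (W p.1, H p.2) (W (p.1 + u.width) - W p.1).toNat
    (H (p.2 + u.height) - H p.2).toNat (by omega) (by omega)
  have h1 : (v.width : ℤ) = W (p.1 + u.width) - W p.1 := by
    show (((W (p.1 + u.width) - W p.1).toNat : ℕ) : ℤ) = _
    omega
  have h2 : (v.height : ℤ) = H (p.2 + u.height) - H p.2 := by
    show (((H (p.2 + u.height) - H p.2).toNat : ℕ) : ℤ) = _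
    omega
  have h3 : IsWordImage X τ u v :=
    ⟨x, hx, z, W, H, p, h, hu, Word.window_occursAt _ _ _ _ _ _, h1, h2⟩
  rw [h3.wordMap_eq]
  exact ⟨h3, Word.window_occursAt _ _ _ _ _ _, h1, h2⟩

theorem IsBlockImageOn.wordMap_single {A B : Type} {X : Set (Config A)} {τ : A → Word B}
    {x : Config A} {z : Config B} {W H : ℤ → ℤ} (h : IsBlockImage τ x z W H) (hx : x ∈ X)
    (i j : ℤ) : wordMap X τ (Word.single (x (i, j))) = τ (x (i, j)) := by
  have t : ∀ i : ℤ, i ∈ Set.univ := Set.mem_univ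
  refine IsWordImage.wordMap_eq ⟨x, hx, z, W, H, (i, j), h, Word.single_occursAt_iff.2 rfl,
    h.occursAt i (t _) j (t _), ?_, ?_⟩
  · have := h.W_succ i (t _) j (t _)
    simp only [Word.single, Nat.cast_one]
    omega
  · have := h.H_succ i (t _) j (t _)
    simp only [Word.single, Nat.cast_one]
    omega

namespace IsBlockSubstitution

variable {A B : Type} {hA vA : A → A → Prop} {hB vB Q₁ Q₂ : B → B → Prop} {τ : A → Word B}

theorem wordMap_single (S : IsBlockSubstitution hA vA hB vB Q₁ Q₂ τ) {x : Config A}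
    (hx : x ∈ nnShift hA vA) (p : ℤ × ℤ) :
    wordMap (nnShift hA vA) τ (Word.single (x p)) = τ (x p) := by
  obtain ⟨z, -, W, H, h⟩ := S.exists_image_mem hx
  exact h.wordMap_single hx p.1 p.2

theorem isImage_iff (S : IsBlockSubstitution hA vA hB vB Q₁ Q₂ τ) {x : Config A}
    (hx : x ∈ nnShift hA vA) (z : Config B) :
    IsImage (wordMap (nnShift hA vA) τ) x z ↔ ∃ W H, IsBlockImage τ x z W H := by
  constructor
  · rintro ⟨W, H, hW, hH, h⟩
    simp only [S.wordMap_single hx] at h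
    exact ⟨W, H, hW, hH,
      fun i => by have := (τ (x (i, 0))).width_pos; have := (h i 0).1; omega,
      fun j => by have := (τ (x (0, j))).height_pos; have := (h 0 j).2.1; omega,
      fun i _ j _ => (h i j).1, fun i _ j _ => (h i j).2.1, fun i _ j _ => (h i j).2.2⟩
  · rintro ⟨W, H, h⟩
    refine ⟨W, H, h.W_zero, h.H_zero, fun i j => ?_⟩
    rw [S.wordMap_single hx]
    exact ⟨h.W_succ i (Set.mem_univ _) j (Set.mem_univ _),
      h.H_succ i (Set.mem_univ _) j (Set.mem_univ _),
      h.occursAt i (Set.mem_univ _) j (Set.mem_univ _)⟩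

theorem isMorphismOn (S : IsBlockSubstitution hA vA hB vB Q₁ Q₂ τ) :
    IsMorphismOn (language (nnShift hA vA)) (wordMap (nnShift hA vA) τ) := by
  constructor
  · rintro u - v - huv ⟨x, hx, ⟨p₁, p₂⟩, hp⟩
    obtain ⟨z, -, W, H, h⟩ := S.exists_image_mem hx
    obtain ⟨hpu, hpv⟩ := (Word.hcat_occursAt_iff huv).1 hp
    obtain ⟨-, o, w, l⟩ := h.isWordImage hx hp
    obtain ⟨-, ou, wu, lu⟩ := h.isWordImage hx hpu
    obtain ⟨-, ov, wv, lv⟩ := h.isWordImage hx hpv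
    have e : ((u.hcat v huv).width : ℤ) = u.width + v.width := by simp [Word.hcat]
    rw [e, ← add_assoc] at w
    change _ = H (p₂ + u.height) - _ at l
    simp only at wu lu wv lv w l ou ov o
    have hl : (wordMap (nnShift hA vA) τ u).height = (wordMap (nnShift hA vA) τ v).height := by
      simp only [← huv] at lv; omega
    refine ⟨hl, o.unique ((Word.hcat_occursAt_iff hl).2 ⟨ou, ?_⟩) ?_ ?_⟩
    · rw [wu]; simpa using ov
    · show _ = _ + _; omega
    · show _ = (wordMap _ τ u).height; omega
  · rintro u - v - huv ⟨x, hx, ⟨p₁, p₂⟩, hp⟩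
    obtain ⟨z, -, W, H, h⟩ := S.exists_image_mem hx
    obtain ⟨hpu, hpv⟩ := (Word.vcat_occursAt_iff huv).1 hp
    obtain ⟨-, o, w, l⟩ := h.isWordImage hx hp
    obtain ⟨-, ou, wu, lu⟩ := h.isWordImage hx hpu
    obtain ⟨-, ov, wv, lv⟩ := h.isWordImage hx hpv
    have e : ((u.vcat v huv).height : ℤ) = u.height + v.height := by simp [Word.vcat]
    rw [e, ← add_assoc] at l
    change _ = W (p₁ + u.width) - _ at w
    simp only at wu lu wv lv w l ou ov o
    have hl : (wordMap (nnShift hA vA) τ u).width = (wordMap (nnShift hA vA) τ v).width := by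
      simp only [← huv] at wv; omega
    refine ⟨hl, o.unique ((Word.vcat_occursAt_iff hl).2 ⟨ou, ?_⟩) ?_ ?_⟩
    · rw [lu]; simpa using ov
    · show _ = (wordMap _ τ u).width; omega
    · show _ = _ + _; omega

theorem isMorphismBetween (S : IsBlockSubstitution hA vA hB vB Q₁ Q₂ τ) :
    IsMorphismBetween (nnShift hA vA) (nnShift hB vB) (wordMap (nnShift hA vA) τ) := by
  refine ⟨S.isMorphismOn, fun x hx => ?_⟩
  obtain ⟨z, hz, h⟩ := S.exists_image_mem hx
  exact ⟨z, hz, (S.isImage_iff hx z).2 h⟩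

theorem isRecognizable (S : IsBlockSubstitution hA vA hB vB Q₁ Q₂ τ) :
    IsRecognizable (nnShift hA vA) (wordMap (nnShift hA vA) τ) := by
  rintro y k k' x hx x' hx' ⟨⟨z, hz, rfl⟩, hk⟩ ⟨⟨z', hz', e⟩, hk'⟩
  obtain ⟨W, H, h⟩ := (S.isImage_iff hx z).1 hz
  obtain ⟨W', H', h'⟩ := (S.isImage_iff hx' z').1 hz'
  rw [S.wordMap_single hx] at hk
  rw [S.wordMap_single hx'] at hk'
  have t : ∀ i : ℤ, i ∈ Set.univ := Set.mem_univ
  have a := h.W_succ 0 (t _) 0 (t _)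
  have b := h.H_succ 0 (t _) 0 (t _)
  have a' := h'.W_succ 0 (t _) 0 (t _)
  have b' := h'.H_succ 0 (t _) 0 (t _)
  rw [h.W_zero, zero_add, zero_add] at a
  rw [h.H_zero, zero_add, zero_add] at b
  rw [h'.W_zero, zero_add, zero_add] at a'
  rw [h'.H_zero, zero_add, zero_add] at b'
  exact S.centered_unique hx hx' h h' e (by rw [a, b]; exact hk) (by rw [a', b']; exact hk')

theorem isOntoUpToShift (S : IsBlockSubstitution hA vA hB vB Q₁ Q₂ τ) :
    IsOntoUpToShift (nnShift hA vA) (nnShift hB vB) (wordMap (nnShift hA vA) τ) := by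
  ext y
  constructor
  · rintro ⟨k, z, ⟨x, hx, hz⟩, rfl⟩
    obtain ⟨W, H, h⟩ := (S.isImage_iff hx z).1 hz
    exact shift_mem_nnShift k (S.image_mem hx h)
  · intro hy
    obtain ⟨x, hx, z, W, H, k, h, hyz, -⟩ := S.exists_preimage hy
    exact ⟨k, z, ⟨x, hx, (S.isImage_iff hx z).2 ⟨W, H, h⟩⟩, hyz⟩

end IsBlockSubstitution

theorem ValidOn.mono {A : Type} {h v : A → A → Prop} {I J I' J' : Set ℤ} {x : Config A} (hx : ValidOn h v I J x) (hI : I' ⊆ I)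
    (hJ : J' ⊆ J) : ValidOn h v I' J' x := fun i hi j hj =>
  ⟨fun hi' => (hx i (hI hi) j (hJ hj)).1 (hI hi'), fun hj' => (hx i (hI hi) j (hJ hj)).2 (hJ hj')⟩

/-! ## Topology of nearest-neighbour shifts -/

section Topology

variable {A : Type} [TopologicalSpace A] [DiscreteTopology A] {h v : A → A → Prop}

theorem isClosed_rel (r : A → A → Prop) (m n : ℤ × ℤ) :
    IsClosed {x : Config A | r (x m) (x n)} := by
  have hc : Continuous fun x : Config A => (x m, x n) :=
    (continuous_apply m).prodMk (continuous_apply n)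
  exact (isClosed_discrete {p : A × A | r p.1 p.2}).preimage hc

theorem isClosed_validOn (I J : Set ℤ) : IsClosed {x : Config A | ValidOn h v I J x} := by
  simp only [ValidOn, Set.ofPred_forall, Set.ofPred_and]
  refine isClosed_iInter fun i => isClosed_iInter fun _ => isClosed_iInter fun j =>
    isClosed_iInter fun _ => ?_
  exact (isClosed_iInter fun _ => isClosed_rel h _ _).inter
    (isClosed_iInter fun _ => isClosed_rel v _ _)

theorem isClosed_nnShift : IsClosed (nnShift h v) := by
  have := isClosed_validOn (h := h) (v := v) Set.univ Set.univ
  simpa only [validOn_univ_iff, Set.ofPred_mem_eq] using this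

theorem isSubshift_nnShift : IsSubshift (nnShift h v) := by
  refine ⟨isClosed_nnShift, fun n => Set.Subset.antisymm ?_ fun x hx => ?_⟩
  · rintro _ ⟨x, hx, rfl⟩
    exact shift_mem_nnShift n hx
  · exact ⟨shift (-n) x, shift_mem_nnShift _ hx, by
      rw [shift_shift, add_neg_cancel, shift_zero]⟩

theorem nnShift_nonempty_of_boxes [Finite A]
    (hbox : ∀ n : ℕ, ∃ x : Config A, ValidOn h v (Set.Ico 0 (n : ℤ)) (Set.Ico 0 (n : ℤ)) x) :
    (nnShift h v).Nonempty := by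
  let K : ℕ → Set (Config A) := fun n =>
    {x | ValidOn h v (Set.Ico (-(n : ℤ)) n) (Set.Ico (-(n : ℤ)) n) x}
  have hK : ∀ n, (K n).Nonempty := fun n => by
    obtain ⟨x, hx⟩ := hbox (2 * n)
    push_cast at hx
    refine ⟨shift (n, n) x, fun i hi j hj => ?_⟩
    have := hx (i + n) (by simp at hi ⊢; omega) (j + n) (by simp at hj ⊢; omega)
    simp only [shift, Prod.mk_add_mk, add_right_comm _ (1 : ℤ) (n : ℤ)]
    refine ⟨fun hi' => this.1 ?_, fun hj' => this.2 ?_⟩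
    · simp at hi' ⊢; omega
    · simp at hj' ⊢; omega
  obtain ⟨x, hx⟩ := IsCompact.nonempty_iInter_of_sequence_nonempty_isCompact_isClosed K
    (fun n x hx => ValidOn.mono hx
      (Set.Ico_subset_Ico (by push_cast; omega) (by push_cast; omega))
      (Set.Ico_subset_Ico (by push_cast; omega) (by push_cast; omega)))
    hK (isClosed_validOn _ _).isCompact (fun n => isClosed_validOn _ _)
  refine ⟨x, mem_nnShift_iff.2 fun i j => ?_⟩
  have := Set.mem_iInter.1 hx (i.natAbs + j.natAbs + 2) i ⟨by omega, by omega⟩ j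
    ⟨by omega, by omega⟩
  exact ⟨this.1 ⟨by omega, by omega⟩, this.2 ⟨by omega, by omega⟩⟩

/-- A subshift in which every word of the language occurs in every configuration is minimal. -/
theorem isMinimalSubshift_nnShift
    (hX : ∀ u ∈ language (nnShift h v), ∀ y ∈ nnShift h v, ∃ p, u.OccursAt y p) :
    IsMinimalSubshift (nnShift h v) := by
  refine ⟨isSubshift_nnShift, fun Z hZX ⟨y, hy⟩ hZ hZs => Set.Subset.antisymm hZX fun x hx => ?_⟩
  have hz : ∀ n : ℕ, ∃ z ∈ Z, ∀ i j : ℤ, -(n : ℤ) ≤ i → i ≤ n → -(n : ℤ) ≤ j → j ≤ n →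
      z (i, j) = x (i, j) := fun n => by
    have hu := Word.window_occursAt x (-(n : ℤ), -(n : ℤ)) (2 * n + 1) (2 * n + 1)
      (Nat.succ_pos _) (Nat.succ_pos _)
    obtain ⟨p, hp⟩ := hX _ ⟨x, hx, _, hu⟩ y (hZX hy)
    rw [Word.occursAt_iff] at hu hp
    refine ⟨shift (p + ((n : ℤ), (n : ℤ))) y,
      by rw [← hZs (p + ((n : ℤ), (n : ℤ)))]; exact ⟨y, hy, rfl⟩,
      fun i j hi hi' hj hj' => ?_⟩
    have hlt : ∀ i : ℤ, -(n : ℤ) ≤ i → i ≤ n → (i + n).toNat < 2 * n + 1 := fun i _ _ => by omega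
    have e1 := hu (i + n).toNat (j + n).toNat (hlt i hi hi') (hlt j hj hj')
    have e2 := hp (i + n).toNat (j + n).toNat (hlt i hi hi') (hlt j hj hj')
    rw [← e1] at e2
    obtain ⟨p₁, p₂⟩ := p
    simp only [shift, Prod.mk_add_mk]
    convert e2 using 3 <;> simp only <;> omega
  choose z hzZ hz using hz
  refine hZ.mem_of_tendsto (f := z) (b := Filter.atTop) (tendsto_pi_nhds.2 fun m => ?_)
    (Filter.Eventually.of_forall hzZ)
  refine tendsto_const_nhds.congr' ?_
  filter_upwards [Filter.eventually_ge_atTop (m.1.natAbs + m.2.natAbs)] with n hn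
  exact (hz n m.1 m.2 (by omega) (by omega) (by omega) (by omega)).symm

end Topology

/-! ## Self-similarity, aperiodicity and minimality -/

/-- The four letters of `x` at the vertices of the unit square with lower left corner `p`. -/
def squareAt {A : Type} (x : Config A) (p : ℤ × ℤ) : A × A × A × A :=
  (x p, x (p + (1, 0)), x (p + (0, 1)), x (p + (1, 1)))

/-- The letter with coordinates `(p, q)` in the image of a square of four letters. -/
def squareEntry {A B : Type} (τ : A → Word B) (P : A × A × A × A) (p q : ℕ) : B :=
  if p < (τ P.1).width then
    if q < (τ P.1).height then (τ P.1).entry p q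
    else (τ P.2.2.1).entry p (q - (τ P.1).height)
  else
    if q < (τ P.1).height then (τ P.2.1).entry (p - (τ P.1).width) q
    else (τ P.2.2.2).entry (p - (τ P.1).width) (q - (τ P.1).height)

/-- The square `R` occurs in the image of the square `P`. -/
def SquareStep {A B : Type} (τ : A → Word B) (P : A × A × A × A) (R : B × B × B × B) : Prop :=
  ∃ p q, p + 1 < (τ P.1).width + (τ P.2.1).width ∧ q + 1 < (τ P.1).height + (τ P.2.2.1).height ∧
    R = (squareEntry τ P p q, squareEntry τ P (p + 1) q, squareEntry τ P p (q + 1),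
      squareEntry τ P (p + 1) (q + 1))

/-- The `n`-th iterate of `SquareStep`. -/
def SquareSteps {A : Type} (τ : A → Word A) : ℕ → A × A × A × A → A × A × A × A → Prop
  | 0, P, R => P = R
  | n + 1, P, R => ∃ P', SquareStep τ P P' ∧ SquareSteps τ n P' R

theorem IsBlockImageOn.squareEntry_eq {A B : Type} {τ : A → Word B} {x : Config A} {z : Config B}
    {W H : ℤ → ℤ} (h : IsBlockImage τ x z W H) (i j : ℤ) {p q : ℕ} (hp : W i + p < W (i + 2))
    (hq : H j + q < H (j + 2)) : squareEntry τ (squareAt x (i, j)) p q = z (W i + p, H j + q) := by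
  have t : ∀ i : ℤ, i ∈ Set.univ := Set.mem_univ
  have w := h.W_succ i (t _) j (t _)
  have l := h.H_succ i (t _) j (t _)
  rw [show i + 2 = i + 1 + 1 by ring] at hp
  rw [show j + 2 = j + 1 + 1 by ring] at hq
  simp only [squareEntry, squareAt, Prod.mk_add_mk, add_zero]
  split_ifs with h1 h2 h2
  · rw [h.apply (t i) (t j) (by omega) (by omega) (by omega) (by omega)]
    congr 1 <;> omega
  · rw [h.apply (t i) (t (j + 1)) (by omega) (by omega) (by omega) (by omega)]
    congr 1 <;> omega
  · rw [h.apply (t (i + 1)) (t j) (by omega) (by omega) (by omega) (by omega)]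
    congr 1 <;> omega
  · rw [h.apply (t (i + 1)) (t (j + 1)) (by omega) (by omega) (by omega) (by omega)]
    congr 1 <;> omega

theorem IsBlockImageOn.W_add_two {A B : Type} {τ : A → Word B} {x : Config A} {z : Config B}
    {W H : ℤ → ℤ} (h : IsBlockImage τ x z W H) (i j : ℤ) :
    W (i + 2) = W i + ((τ (squareAt x (i, j)).1).width + (τ (squareAt x (i, j)).2.1).width : ℕ) ∧
    H (j + 2) = H j +
      ((τ (squareAt x (i, j)).1).height + (τ (squareAt x (i, j)).2.2.1).height : ℕ) := by
  have t : ∀ i : ℤ, i ∈ Set.univ := Set.mem_univ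
  have w := h.W_succ i (t _) j (t _)
  have w' := h.W_succ (i + 1) (t _) j (t _)
  have l := h.H_succ i (t _) j (t _)
  have l' := h.H_succ i (t _) (j + 1) (t _)
  rw [show i + 2 = i + 1 + 1 by ring, show j + 2 = j + 1 + 1 by ring]
  simp only [squareAt, Prod.mk_add_mk, add_zero]
  constructor <;> push_cast <;> omega

theorem IsBlockImageOn.squareStep {A B : Type} {τ : A → Word B} {x : Config A} {z : Config B}
    {W H : ℤ → ℤ} (h : IsBlockImage τ x z W H) {i j m n : ℤ} (hm : W i ≤ m)
    (hm' : m + 1 < W (i + 2)) (hn : H j ≤ n) (hn' : n + 1 < H (j + 2)) :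
    SquareStep τ (squareAt x (i, j)) (squareAt z (m, n)) := by
  obtain ⟨w, l⟩ := h.W_add_two i j
  refine ⟨(m - W i).toNat, (n - H j).toNat, by omega, by omega, ?_⟩
  rw [h.squareEntry_eq i j (by omega) (by omega), h.squareEntry_eq i j (by omega) (by omega),
    h.squareEntry_eq i j (by omega) (by omega), h.squareEntry_eq i j (by omega) (by omega)]
  have e1 : W i + ((m - W i).toNat : ℤ) = m := by omega
  have e2 : H j + ((n - H j).toNat : ℤ) = n := by omega
  simp only [squareAt, Prod.mk_add_mk, add_zero, Nat.cast_add, Nat.cast_one, ← add_assoc, e1, e2]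

theorem IsBlockImageOn.exists_squareAt_eq {A B : Type} {τ : A → Word B} {x : Config A}
    {z : Config B} {W H : ℤ → ℤ} (h : IsBlockImage τ x z W H) {p : ℤ × ℤ} {R : B × B × B × B}
    (hR : SquareStep τ (squareAt x p) R) : ∃ q, squareAt z q = R := by
  obtain ⟨i, j⟩ := p
  obtain ⟨p, q, hp, hq, rfl⟩ := hR
  obtain ⟨w, l⟩ := h.W_add_two i j
  refine ⟨(W i + p, H j + q), ?_⟩
  rw [h.squareEntry_eq i j (by omega) (by omega), h.squareEntry_eq i j (by omega) (by omega),
    h.squareEntry_eq i j (by omega) (by omega), h.squareEntry_eq i j (by omega) (by omega)]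
  simp only [squareAt, Prod.mk_add_mk, add_zero]
  push_cast
  simp only [add_assoc]

/-- A block substitution from a shift to itself for which narrow (low) blocks come from columns
(rows) in the interior of blocks, such that every square of four letters in an image is, up to
iteration, contained in the image of every square. -/
structure IsExpandingSubstitution {A : Type} (h v Q₁ Q₂ : A → A → Prop) (τ : A → Word A) : Prop
    extends IsBlockSubstitution h v h v Q₁ Q₂ τ where
  narrow : ∀ a b, h a b → (τ b).width = 1 → Q₁ a b
  low : ∀ a b, v a b → (τ b).height = 1 → Q₂ a b
  wide_start : ∀ a q, q < (τ a).height → (τ ((τ a).entry 0 q)).width = 2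
  tall_start : ∀ a p, p < (τ a).width → (τ ((τ a).entry p 0)).height = 2
  primitive : ∃ n, ∀ y ∈ nnShift h v, ∀ q,
    (∀ x ∈ nnShift h v, ∀ p P, SquareStep τ (squareAt x p) P → SquareSteps τ n (squareAt y q) P) ∧
    ∀ a, ∃ P, P.1 = a ∧ SquareSteps τ n (squareAt y q) P

namespace IsExpandingSubstitution

variable {A : Type} {h v Q₁ Q₂ : A → A → Prop} {τ : A → Word A}

/-- A configuration contains all squares which are derived in `n` steps from squares of some
configuration. -/
theorem exists_of_squareSteps (S : IsExpandingSubstitution h v Q₁ Q₂ τ) (n : ℕ) {y : Config A}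
    (hy : y ∈ nnShift h v) : ∃ x ∈ nnShift h v, ∀ q P, SquareSteps τ n (squareAt x q) P →
      ∃ q, squareAt y q = P := by
  induction n generalizing y with
  | zero => exact ⟨y, hy, fun q P hP => ⟨q, hP⟩⟩
  | succ n ih =>
    obtain ⟨x, hx, hxy⟩ := ih hy
    obtain ⟨x', hx', z, W, H, k, hz, rfl, -⟩ := S.exists_preimage hx
    refine ⟨x', hx', fun q P ⟨P', h1, h2⟩ => ?_⟩
    obtain ⟨r, rfl⟩ := hz.exists_squareAt_eq h1
    refine hxy (r - k) P ?_
    convert h2 using 1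
    simp [squareAt, shift, sub_add_cancel, sub_add_eq_add_sub]

/-- The rank of a horizontal (or vertical) interval of length `L`, where `b` tells whether its
second element is in the interior of a block. -/
def intervalRank (L : ℕ) (b : Prop) [Decidable b] : ℕ :=
  if L ≤ 2 then 4 else 2 * L + if b then 0 else 1

theorem intervalRank_le {W : ℤ → ℤ} (hW : ∀ i, W i < W (i + 1)) {m : ℤ} {L : ℕ} (hL : 0 < L)
    {b b' : Prop} [Decidable b] [Decidable b'] {i₀ i₁ : ℤ} (h₀ : W i₀ ≤ m) (h₀' : m < W (i₀ + 1))
    (h₁ : W i₁ ≤ m + L - 1) (h₁' : m + L - 1 < W (i₁ + 1)) (hb : b → ∀ i, W i ≠ m + 1)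
    (hb' : W (i₀ + 1 + 1) = W (i₀ + 1) + 1 → b') :
    i₀ ≤ i₁ ∧ intervalRank (i₁ - i₀ + 1).toNat b' ≤ intervalRank L b ∧
      (3 ≤ L → intervalRank (i₁ - i₀ + 1).toNat b' < intervalRank L b) := by
  have hi : i₀ ≤ i₁ := Int.lt_add_one_iff.1
    ((strictMono_int_of_lt_succ hW).lt_iff_lt.1 (by omega : W i₀ < W (i₁ + 1)))
  have hlen : i₁ - i₀ ≤ L - 1 := by
    rcases hi.eq_or_lt with rfl | hlt
    · omega
    · have := cut_add_le hW (show i₀ + 1 ≤ i₁ by omega); omega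
  have hlen' : b → 3 ≤ L → i₁ - i₀ ≤ L - 2 := fun hb3 h3 => by
    rcases hi.eq_or_lt with rfl | hlt
    · omega
    · have := cut_add_le hW (show i₀ + 1 ≤ i₁ by omega)
      have := hb hb3 (i₀ + 1)
      omega
  have heq : 3 ≤ L → i₁ - i₀ = L - 1 → b' := fun h3 he => hb' (by
    have h1 := cut_add_le hW (show i₀ + 1 + 1 ≤ i₁ by omega)
    have h2 := hW (i₀ + 1)
    omega)
  unfold intervalRank
  refine ⟨hi, ?_, ?_⟩ <;> by_cases h1 : b <;> by_cases h2 : b' <;>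
    simp only [h1, h2, if_true, if_false, true_imp_iff, imp_false] at hlen' heq ⊢ <;>
    split_ifs <;> omega

theorem occursAt_of_subword {A : Type} {u u' : Word A} {z y : Config A} {p p' q' : ℤ × ℤ}
    (hu : u.OccursAt z p) (hu' : u'.OccursAt z p') (hy : u'.OccursAt y q')
    (h1 : p'.1 ≤ p.1) (h1' : p.1 + u.width ≤ p'.1 + u'.width) (h2 : p'.2 ≤ p.2)
    (h2' : p.2 + u.height ≤ p'.2 + u'.height) : u.OccursAt y (q' + (p - p')) := by
  rw [Word.occursAt_iff] at *
  intro a b ha hb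
  rw [← hu a b ha hb]
  have e1 := hu' (p.1 + a - p'.1).toNat (p.2 + b - p'.2).toNat (by omega) (by omega)
  have e2 := hy (p.1 + a - p'.1).toNat (p.2 + b - p'.2).toNat (by omega) (by omega)
  rw [← e1] at e2
  convert e2 using 3 <;> simp <;> omega

/-- Every word of the language occurs in every configuration. -/
theorem exists_occursAt (S : IsExpandingSubstitution h v Q₁ Q₂ τ) :
    ∀ u ∈ language (nnShift h v), ∀ y ∈ nnShift h v, ∃ p, u.OccursAt y p := by
  classical
  suffices key : ∀ (N : ℕ) (x : Config A), x ∈ nnShift h v → ∀ (u : Word A) (m n : ℤ),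
      u.OccursAt x (m, n) → intervalRank u.width (Q₁ (x (m, n)) (x (m + 1, n))) +
        intervalRank u.height (Q₂ (x (m, n)) (x (m, n + 1))) ≤ N →
      ∀ y ∈ nnShift h v, ∃ p, u.OccursAt y p by
    rintro u ⟨x, hx, ⟨m, n⟩, hu⟩ y hy
    exact key _ x hx u m n hu le_rfl y hy
  intro N
  induction N with
  | zero =>
    intro x _ u m n _ h0
    unfold intervalRank at h0
    split_ifs at h0 <;> omega
  | succ N ih =>
    intro x hx u m n hu hN y hy
    have t : ∀ i : ℤ, i ∈ Set.univ := Set.mem_univ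
    obtain ⟨x', hx', z, W, H, k, hz, rfl, -⟩ := S.exists_preimage hx
    obtain ⟨i₀, hi₀, hi₀'⟩ := exists_cell hz.W_lt (m + k.1)
    obtain ⟨j₀, hj₀, hj₀'⟩ := exists_cell hz.H_lt (n + k.2)
    by_cases hsmall : u.width ≤ 2 ∧ u.height ≤ 2
    · have hst := hz.squareStep (m := m + k.1) (n := n + k.2) hi₀
        (by have := hz.W_lt (i₀ + 1); rw [show i₀ + 2 = i₀ + 1 + 1 by ring]; omega) hj₀
        (by have := hz.H_lt (j₀ + 1); rw [show j₀ + 2 = j₀ + 1 + 1 by ring]; omega)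
      obtain ⟨r, hr⟩ := S.primitive
      obtain ⟨x₁, hx₁, hy₁⟩ := S.exists_of_squareSteps r hy
      obtain ⟨q, hq⟩ := hy₁ 0 _ ((hr x₁ hx₁ 0).1 x' hx' (i₀, j₀) _ hst)
      have hw : (Word.window z (m + k.1, n + k.2) 2 2 two_pos two_pos).OccursAt y q := by
        simp only [squareAt, Prod.mk.injEq] at hq
        intro a b
        obtain ⟨q1, q2⟩ := q
        match a, b with
        | ⟨0, _⟩, ⟨0, _⟩ => simpa [Word.window] using hq.1
        | ⟨1, _⟩, ⟨0, _⟩ => simpa [Word.window] using hq.2.1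
        | ⟨0, _⟩, ⟨1, _⟩ => simpa [Word.window] using hq.2.2.1
        | ⟨1, _⟩, ⟨1, _⟩ => simpa [Word.window] using hq.2.2.2
      have hu2 : u.OccursAt z (m + k.1, n + k.2) := by
        intro a b
        rw [← hu a b]
        simp only [shift]
        congr 2 <;> ring
      exact ⟨_, occursAt_of_subword hu2 (Word.window_occursAt z (m + k.1, n + k.2) 2 2
        two_pos two_pos) hw le_rfl (by simp only [Word.window]; omega) le_rfl
        (by simp only [Word.window]; omega)⟩
    · obtain ⟨i₁, hi₁, hi₁'⟩ := exists_cell hz.W_lt (m + k.1 + u.width - 1)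
      obtain ⟨j₁, hj₁, hj₁'⟩ := exists_cell hz.H_lt (n + k.2 + u.height - 1)
      have hzm := S.image_mem hx' hz
      obtain ⟨i01, ri, ri'⟩ := intervalRank_le (b := Q₁ (shift k z (m, n)) (shift k z (m + 1, n)))
        (b' := Q₁ (x' (i₀, j₀)) (x' (i₀ + 1, j₀))) hz.W_lt u.width_pos hi₀ hi₀' hi₁ hi₁'
        (fun hb i hi => by
          have := (S.exists_W_eq_iff hx' hz (m + k.1 + 1) (n + k.2)).1 ⟨i, hi⟩
          apply this
          simp only [shift] at hb
          obtain ⟨k1, k2⟩ := k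
          simpa [add_right_comm] using hb)
        (fun hw => S.narrow _ _ (mem_nnShift_iff.1 hx' i₀ j₀).1 (by
          have := hz.W_succ (i₀ + 1) (t _) j₀ (t _); omega))
      obtain ⟨j01, rj, rj'⟩ := intervalRank_le (b := Q₂ (shift k z (m, n)) (shift k z (m, n + 1)))
        (b' := Q₂ (x' (i₀, j₀)) (x' (i₀, j₀ + 1))) hz.H_lt u.height_pos hj₀ hj₀' hj₁ hj₁'
        (fun hb i hi => by
          have := (S.exists_H_eq_iff hx' hz (m + k.1) (n + k.2 + 1)).1 ⟨i, hi⟩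
          apply this
          simp only [shift] at hb
          obtain ⟨k1, k2⟩ := k
          simpa [add_right_comm] using hb)
        (fun hw => S.low _ _ (mem_nnShift_iff.1 hx' i₀ j₀).2 (by
          have := hz.H_succ i₀ (t _) (j₀ + 1) (t _); omega))
      let u' := Word.window x' (i₀, j₀) (i₁ - i₀ + 1).toNat (j₁ - j₀ + 1).toNat
        (by omega) (by omega)
      have hu' : u'.OccursAt x' (i₀, j₀) := Word.window_occursAt _ _ _ _ _ _
      obtain ⟨y', hy', z', W', H', k', hz', rfl, -⟩ := S.exists_preimage hy
      obtain ⟨p, hp⟩ := ih x' hx' u' i₀ j₀ hu' (by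
        change intervalRank (i₁ - i₀ + 1).toNat _ + intervalRank (j₁ - j₀ + 1).toNat _ ≤ N
        rcases not_and_or.1 hsmall with h3 | h3
        · have := ri' (by omega); omega
        · have := rj' (by omega); omega) y' hy'
      obtain ⟨-, o, w, l⟩ := hz.isWordImage hx' hu'
      obtain ⟨-, o', -, -⟩ := hz'.isWordImage hy' hp
      have hu2 : u.OccursAt z (m + k.1, n + k.2) := by
        intro a b
        rw [← hu a b]
        simp only [shift]
        congr 2 <;> ring
      have w1 : (u'.width : ℤ) = i₁ - i₀ + 1 := by
        change ((i₁ - i₀ + 1).toNat : ℤ) = _; omega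
      have l1 : (u'.height : ℤ) = j₁ - j₀ + 1 := by
        change ((j₁ - j₀ + 1).toNat : ℤ) = _; omega
      rw [w1, show i₀ + (i₁ - i₀ + 1) = i₁ + 1 by ring] at w
      rw [l1, show j₀ + (j₁ - j₀ + 1) = j₁ + 1 by ring] at l
      simp only at w l o
      have hu3 := occursAt_of_subword hu2 o o' hi₀ (by simp only; omega) hj₀ (by simp only; omega)
      refine ⟨(W' p.1, H' p.2) + ((m + k.1, n + k.2) - (W i₀, H j₀)) - k', fun a b => ?_⟩
      rw [← hu3 a b]
      simp only [shift]
      congr 1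
      ext <;> simp <;> ring

end IsExpandingSubstitution

theorem Ico_subset_coveredBy {W : ℤ → ℤ} (hW : ∀ i, W i < W (i + 1)) (h0 : W 0 = 0) (N : ℤ) :
    Set.Ico 0 (W N) ⊆ coveredBy W (Set.Ico 0 N) := by
  rintro m ⟨hm, hm'⟩
  obtain ⟨i, hi, hi'⟩ := exists_cell hW m
  have hs := strictMono_int_of_lt_succ hW
  have h1 : 0 < i + 1 := hs.lt_iff_lt.1 (by omega)
  exact ⟨i, ⟨by omega, hs.lt_iff_lt.1 (by omega)⟩, hi, hi'⟩

theorem cut_period_lt {W : ℤ → ℤ} (hW : ∀ i, W i < W (i + 1)) {p q : ℤ}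
    (h : ∀ i, W i + p = W (i + q)) (h2 : ∃ i, W i + 2 ≤ W (i + 1)) (hp : p ≠ 0) :
    q.natAbs < p.natAbs := by
  have hs := strictMono_int_of_lt_succ hW
  have key : ∀ p q : ℤ, (∀ i, W i + p = W (i + q)) → 0 < p → 0 < q ∧ q < p := by
    intro p q h hp
    have hq : 0 < q := by
      have := h 0
      rw [zero_add] at this
      exact hs.lt_iff_lt.1 (show W 0 < W q by omega)
    obtain ⟨i, hi⟩ := h2
    have h1 := cut_add_le hW (show i + 1 ≤ i + q by omega)
    have := h i
    omega
  rcases hp.lt_or_gt with hp | hp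
  · have := key (-p) (-q) (fun i => by
      have := h (i + -q)
      rw [neg_add_cancel_right] at this
      omega) (by omega)
    omega
  · have := key p q h hp
    omega

theorem cut_period_eq_zero {W : ℤ → ℤ} {p : ℤ} (h : ∀ i, W i + p = W (i + 0)) : p = 0 := by
  have := h 0
  rw [add_zero] at this
  omega

namespace IsExpandingSubstitution

variable {A : Type} {h v Q₁ Q₂ : A → A → Prop} {τ : A → Word A}

/-- Two successive images double the size of every cell. -/
theorem two_step_growth (S : IsExpandingSubstitution h v Q₁ Q₂ τ) {I J I' J' : Set ℤ}
    {x z z' : Config A} {W H W' H' : ℤ → ℤ} (h₁ : IsBlockImageOn τ I J x z W H)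
    (h₂ : IsBlockImageOn τ I' J' z z' W' H') {i j : ℤ} (hi : i ∈ I) (hj : j ∈ J)
    (hi' : W i ∈ I') (hj' : H j ∈ J') :
    W' (W i) + 2 ≤ W' (W (i + 1)) ∧ H' (H j) + 2 ≤ H' (H (j + 1)) := by
  have e := h₁.apply hi hj le_rfl (h₁.W_lt i) le_rfl (h₁.H_lt j)
  rw [sub_self, sub_self, Int.toNat_zero] at e
  have w := h₂.W_succ _ hi' _ hj'
  have l := h₂.H_succ _ hi' _ hj'
  rw [e, S.wide_start _ _ (Word.height_pos _)] at w
  rw [e, S.tall_start _ _ (Word.width_pos _)] at l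
  have := (strictMono_int_of_lt_succ h₂.W_lt).monotone (Int.add_one_le_of_lt (h₁.W_lt i))
  have := (strictMono_int_of_lt_succ h₂.H_lt).monotone (Int.add_one_le_of_lt (h₁.H_lt j))
  omega

theorem exists_validOn [Nonempty A] (S : IsExpandingSubstitution h v Q₁ Q₂ τ) (k : ℕ) :
    ∃ x : Config A, ValidOn h v (Set.Ico 0 (2 ^ k)) (Set.Ico 0 (2 ^ k)) x := by
  induction k with
  | zero =>
    refine ⟨fun _ => Classical.arbitrary A, fun i hi j hj => ⟨fun hi' => ?_, fun hj' => ?_⟩⟩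
    · exact absurd hi'.2 (by have := hi.1; simp; omega)
    · exact absurd hj'.2 (by have := hj.1; simp; omega)
  | succ k ih =>
    obtain ⟨x, hx⟩ := ih
    have hk : (0 : ℤ) < 2 ^ k := by positivity
    set N : ℤ := 2 ^ k
    have h0 : (0 : ℤ) ∈ Set.Ico 0 N := ⟨le_rfl, hk⟩
    obtain ⟨z, W, H, hz⟩ := S.exists_image Set.ordConnected_Ico Set.ordConnected_Ico h0 h0 hx
    have hzv := (S.image_valid hx hz).mono (Ico_subset_coveredBy hz.W_lt hz.W_zero N)
      (Ico_subset_coveredBy hz.H_lt hz.H_zero N)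
    have hW := strictMono_int_of_lt_succ hz.W_lt
    have hH := strictMono_int_of_lt_succ hz.H_lt
    have hWN : 0 < W N := by have := hW hk; rwa [hz.W_zero] at this
    have hHN : 0 < H N := by have := hH hk; rwa [hz.H_zero] at this
    obtain ⟨z', W', H', hz'⟩ := S.exists_image Set.ordConnected_Ico Set.ordConnected_Ico
      ⟨le_rfl, hWN⟩ ⟨le_rfl, hHN⟩ hzv
    have hzv' := (S.image_valid hzv hz').mono (Ico_subset_coveredBy hz'.W_lt hz'.W_zero _)
      (Ico_subset_coveredBy hz'.H_lt hz'.H_zero _)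
    have grow : ∀ n : ℤ, 0 ≤ n → n ≤ N → 2 * n ≤ W' (W n) ∧ 2 * n ≤ H' (H n) := by
      intro n hn
      induction n, hn using Int.leInduction with
      | base => simp [hz.W_zero, hz.H_zero, hz'.W_zero, hz'.H_zero]
      | succ n hn ih =>
        intro hnN
        have hn' : n ∈ Set.Ico 0 N := ⟨hn, by omega⟩
        have e1 : W n ∈ Set.Ico 0 (W N) :=
          ⟨by have := hW.monotone hn; rwa [hz.W_zero] at this, hW hn'.2⟩
        have e2 : H n ∈ Set.Ico 0 (H N) :=
          ⟨by have := hH.monotone hn; rwa [hz.H_zero] at this, hH hn'.2⟩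
        have := S.two_step_growth hz hz' hn' hn' e1 e2
        have := ih (by omega)
        omega
    have := grow N hk.le le_rfl
    refine ⟨z', hzv'.mono (Set.Ico_subset_Ico_right ?_) (Set.Ico_subset_Ico_right ?_)⟩ <;>
      rw [pow_succ] <;> omega

theorem nonempty [Finite A] [Nonempty A] [TopologicalSpace A] [DiscreteTopology A]
    (S : IsExpandingSubstitution h v Q₁ Q₂ τ) : (nnShift h v).Nonempty :=
  nnShift_nonempty_of_boxes fun n => by
    obtain ⟨x, hx⟩ := S.exists_validOn n
    have : (n : ℤ) ≤ 2 ^ n := by exact_mod_cast n.lt_two_pow_self.le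
    exact ⟨x, hx.mono (Set.Ico_subset_Ico_right this) (Set.Ico_subset_Ico_right this)⟩

theorem mapsTo_language (S : IsExpandingSubstitution h v Q₁ Q₂ τ) :
    Set.MapsTo (wordMap (nnShift h v) τ) (language (nnShift h v)) (language (nnShift h v)) := by
  rintro u ⟨x, hx, p, hu⟩
  obtain ⟨z, hz, W, H, hzx⟩ := S.exists_image_mem hx
  exact ⟨z, hz, _, (hzx.isWordImage hx hu).2.1⟩

theorem two_mul_le_shape (S : IsExpandingSubstitution h v Q₁ Q₂ τ) {u : Word A}
    (hu : u ∈ language (nnShift h v)) :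
    2 * u.width ≤ (wordMap (nnShift h v) τ (wordMap (nnShift h v) τ u)).width ∧
    2 * u.height ≤ (wordMap (nnShift h v) τ (wordMap (nnShift h v) τ u)).height := by
  obtain ⟨x, hx, p, hu⟩ := hu
  obtain ⟨z, hz, W, H, hzx⟩ := S.exists_image_mem hx
  obtain ⟨z', -, W', H', hzz'⟩ := S.exists_image_mem hz
  obtain ⟨-, o, w, l⟩ := hzx.isWordImage hx hu
  obtain ⟨-, -, w', l'⟩ := hzz'.isWordImage hz o
  simp only at w' l'
  rw [w, add_sub_cancel] at w'
  rw [l, add_sub_cancel] at l'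
  have t : ∀ i : ℤ, i ∈ Set.univ := Set.mem_univ
  have grow : ∀ (i j : ℤ) (n : ℕ), W' (W i) + 2 * n ≤ W' (W (i + n)) ∧
      H' (H j) + 2 * n ≤ H' (H (j + n)) := by
    intro i j n
    induction n with
    | zero => simp
    | succ n ih =>
      have := S.two_step_growth hzx hzz' (t (i + n)) (t (j + n)) (t _) (t _)
      push_cast
      rw [← add_assoc, ← add_assoc]
      omega
  have := grow p.1 p.2 u.width
  have := grow p.1 p.2 u.height
  omega

theorem isExpansiveOn [Finite A] [TopologicalSpace A] [DiscreteTopology A]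
    (S : IsExpandingSubstitution h v Q₁ Q₂ τ) :
    IsExpansiveOn (language (nnShift h v)) (wordMap (nnShift h v) τ) := by
  refine ⟨S.mapsTo_language, fun a => ?_⟩
  have : Nonempty A := ⟨a⟩
  have ha : Word.single a ∈ language (nnShift h v) := by
    obtain ⟨y, hy⟩ := S.nonempty
    obtain ⟨r, hr⟩ := S.primitive
    obtain ⟨x, hx, hxy⟩ := S.exists_of_squareSteps r hy
    obtain ⟨P, rfl, hP⟩ := (hr x hx 0).2 a
    obtain ⟨q, rfl⟩ := hxy 0 P hP
    exact ⟨y, hy, q, Word.single_occursAt_iff.2 rfl⟩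
  refine ⟨ha, fun K => ⟨2 * K, ?_⟩⟩
  set ω := wordMap (nnShift h v) τ
  have key : ∀ K, ω^[2 * K] (Word.single a) ∈ language (nnShift h v) ∧
      2 ^ K ≤ (ω^[2 * K] (Word.single a)).width ∧ 2 ^ K ≤ (ω^[2 * K] (Word.single a)).height := by
    intro K
    induction K with
    | zero => exact ⟨ha, le_rfl, le_rfl⟩
    | succ K ih =>
      have : _ ≤ (ω (ω _)).width ∧ _ ≤ (ω (ω _)).height := S.two_mul_le_shape ih.1
      rw [show 2 * (K + 1) = 2 * K + 1 + 1 by ring, Function.iterate_succ_apply',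
        Function.iterate_succ_apply', pow_succ]
      exact ⟨S.mapsTo_language (S.mapsTo_language ih.1), by omega, by omega⟩
  have := key K
  have := K.lt_two_pow_self
  exact lt_min (by omega) (by omega)

theorem isSelfSimilar [Finite A] [TopologicalSpace A] [DiscreteTopology A]
    (S : IsExpandingSubstitution h v Q₁ Q₂ τ) : IsSelfSimilar (nnShift h v) :=
  ⟨isSubshift_nnShift, _, S.isMorphismBetween, S.isExpansiveOn, S.isOntoUpToShift⟩

theorem isMinimalSubshift [TopologicalSpace A] [DiscreteTopology A]
    (S : IsExpandingSubstitution h v Q₁ Q₂ τ) : IsMinimalSubshift (nnShift h v) :=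
  isMinimalSubshift_nnShift S.exists_occursAt

theorem exists_wide (S : IsExpandingSubstitution h v Q₁ Q₂ τ) {x : Config A}
    (hx : x ∈ nnShift h v) {z : Config A} {W H : ℤ → ℤ} (hz : IsBlockImage τ x z W H) :
    (∃ i, W i + 2 ≤ W (i + 1)) ∧ ∃ j, H j + 2 ≤ H (j + 1) := by
  have t : ∀ i : ℤ, i ∈ Set.univ := Set.mem_univ
  constructor
  · by_contra! hne
    have hQ : ∀ i, Q₁ (x (i, 0)) (x (i + 1, 0)) := fun i =>
      S.narrow _ _ (mem_nnShift_iff.1 hx i 0).1 (by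
        have := hz.W_succ (i + 1) (t _) 0 (t _)
        have := hne (i + 1)
        have := (τ (x (i + 1, 0))).width_pos
        omega)
    exact S.sep_h x hx 0 0 (hQ 0) (hQ (0 + 1))
  · by_contra! hne
    have hQ : ∀ i, Q₂ (x (0, i)) (x (0, i + 1)) := fun i =>
      S.low _ _ (mem_nnShift_iff.1 hx 0 i).2 (by
        have := hz.H_succ 0 (t _) (i + 1) (t _)
        have := hne (i + 1)
        have := (τ (x (0, i + 1))).height_pos
        omega)
    exact S.sep_v x hx 0 0 (hQ 0) (hQ (0 + 1))

theorem period_eq_zero (S : IsExpandingSubstitution h v Q₁ Q₂ τ) {x : Config A}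
    (hx : x ∈ nnShift h v) {p : ℤ × ℤ} (hp : shift p x = x) : p = 0 := by
  have desc : ∀ (x : Config A), x ∈ nnShift h v → ∀ p : ℤ × ℤ, shift p x = x →
      ∃ x' ∈ nnShift h v, ∃ q : ℤ × ℤ, shift q x' = x' ∧
        (p.1 ≠ 0 → q.1.natAbs < p.1.natAbs) ∧ (q.1 = 0 → p.1 = 0) ∧
        (p.2 ≠ 0 → q.2.natAbs < p.2.natAbs) ∧ (q.2 = 0 → p.2 = 0) := by
    intro x hx p hp
    obtain ⟨x', hx', z, W, H, k, hz, rfl, -⟩ := S.exists_preimage hx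
    have hpz : z = shift p z := by
      rw [shift_shift, add_comm, ← shift_shift] at hp
      have := congrArg (shift (-k)) hp
      rwa [shift_shift (-k) k, shift_shift (-k) k, neg_add_cancel, shift_zero, shift_zero, eq_comm] at this
    obtain ⟨q, e1, e2, e3⟩ := S.exists_shift_eq hx' hx' hz hz hpz
    obtain ⟨w, l⟩ := S.exists_wide hx' hz
    exact ⟨x', hx', q, e3.symm, cut_period_lt hz.W_lt e1 w,
      fun hq => cut_period_eq_zero (W := W) (by rwa [hq] at e1), cut_period_lt hz.H_lt e2 l,
      fun hq => cut_period_eq_zero (W := H) (by rwa [hq] at e2)⟩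
  have h1 : ∀ (N : ℕ) (x : Config A), x ∈ nnShift h v → ∀ p : ℤ × ℤ, shift p x = x →
      (p.1.natAbs ≤ N → p.1 = 0) ∧ (p.2.natAbs ≤ N → p.2 = 0) := by
    intro N
    induction N with
    | zero => exact fun x hx p hp => ⟨by omega, by omega⟩
    | succ N ih =>
      intro x hx p hp
      obtain ⟨x', hx', q, hq, a, b, c, d⟩ := desc x hx p hp
      have := ih x' hx' q hq
      refine ⟨fun hN => ?_, fun hN => ?_⟩
      · by_contra hne
        exact hne (b (this.1 (by have := a hne; omega)))
      · by_contra hne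
        exact hne (d (this.2 (by have := c hne; omega)))
  exact Prod.ext ((h1 _ x hx p hp).1 le_rfl) ((h1 _ x hx p hp).2 le_rfl)

theorem isAperiodic [Finite A] [Nonempty A] [TopologicalSpace A] [DiscreteTopology A]
    (S : IsExpandingSubstitution h v Q₁ Q₂ τ) : IsAperiodic (nnShift h v) :=
  ⟨S.nonempty, fun _ hx _ hp => S.period_eq_zero hx hp⟩

end IsExpandingSubstitution

/-! ## Neighbour tables -/

/-- Tables of right, left, upper and lower neighbours of letters coded by natural numbers. -/
structure Adjacency where
  rightTable : List (List ℕ)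
  leftTable : List (List ℕ)
  upTable : List (List ℕ)
  downTable : List (List ℕ)

namespace Adjacency

def right (D : Adjacency) (a : ℕ) : List ℕ := D.rightTable.getD a []
def left (D : Adjacency) (a : ℕ) : List ℕ := D.leftTable.getD a []
def up (D : Adjacency) (a : ℕ) : List ℕ := D.upTable.getD a []
def down (D : Adjacency) (a : ℕ) : List ℕ := D.downTable.getD a []

/-- All pairs of neighbours in the configuration `y` are listed in the tables. -/
def Admits (D : Adjacency) (y : Config ℕ) : Prop :=
  ∀ i j : ℤ, y (i + 1, j) ∈ D.right (y (i, j)) ∧ y (i, j) ∈ D.left (y (i + 1, j)) ∧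
    y (i, j + 1) ∈ D.up (y (i, j)) ∧ y (i, j) ∈ D.down (y (i, j + 1))

end Adjacency

def memB (a : ℕ) (l : List ℕ) : Bool := l.any (Nat.beq a)

@[simp]
theorem memB_iff {a : ℕ} {l : List ℕ} : memB a l = true ↔ a ∈ l := by
  simp [memB, Nat.beq_eq]

theorem lt_length_of_mem_getD {l : List (List ℕ)} {a b : ℕ} (h : b ∈ l.getD a []) :
    a < l.length := by
  by_contra hlt
  rw [List.getD_eq_default _ _ (not_lt.1 hlt)] at h
  simp at h

/-- The vertical triple `a, b, c` extends `k` letters in the direction of the neighbour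
function `N`. -/
def extends3 (N U : ℕ → List ℕ) : ℕ → ℕ → ℕ → ℕ → Bool
  | 0, _, _, _ => true
  | k + 1, a, b, c => (N a).any fun x => (N b).any fun y => memB y (U x) &&
      (N c).any fun z => memB z (U y) && extends3 N U k x y z

namespace Adjacency

variable (D : Adjacency)

/-- The horizontal pair `a, b` cannot be completed to a square above or below. -/
def dropsH (a b : ℕ) : Bool :=
  !((D.up a).any fun c => (D.up b).any fun d => memB d (D.right c)) ||
    !((D.down a).any fun c => (D.down b).any fun d => memB d (D.right c))

/-- The vertical pair `a, b` cannot be completed below or above to a triple which extends `k`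
letters to the right and to the left. -/
def dropsV (k a b : ℕ) : Bool :=
  (D.down a).all (fun d => !(extends3 D.right D.up k d a b && extends3 D.left D.up k d a b)) ||
    (D.up b).all (fun c => !(extends3 D.right D.up k a b c && extends3 D.left D.up k a b c))

/-- All pairs which are listed in the tables `D` and not in the tables `D'` cannot occur. -/
def refines (k : ℕ) (D' : Adjacency) : Bool :=
  (List.range D.rightTable.length).all (fun a => (D.right a).all fun b =>
    (memB b (D'.right a) && memB a (D'.left b)) || D.dropsH a b) &&
  (List.range D.upTable.length).all (fun a => (D.up a).all fun b =>
    (memB b (D'.up a) && memB a (D'.down b)) || D.dropsV k a b)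

variable {D}

theorem Admits.extends_right {y : Config ℕ} (hy : D.Admits y) (k : ℕ) (i j : ℤ) :
    extends3 D.right D.up k (y (i, j)) (y (i, j + 1)) (y (i, j + 1 + 1)) = true := by
  induction k generalizing i with
  | zero => rfl
  | succ k ih =>
    simp only [extends3, List.any_eq_true, Bool.and_eq_true, memB_iff]
    exact ⟨_, (hy i j).1, _, (hy i (j + 1)).1, (hy (i + 1) j).2.2.1, _, (hy i (j + 1 + 1)).1,
      (hy (i + 1) (j + 1)).2.2.1, ih (i + 1)⟩

theorem Admits.extends_left {y : Config ℕ} (hy : D.Admits y) (k : ℕ) (i j : ℤ) :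
    extends3 D.left D.up k (y (i, j)) (y (i, j + 1)) (y (i, j + 1 + 1)) = true := by
  induction k generalizing i with
  | zero => rfl
  | succ k ih =>
    have hl : ∀ j, y (i - 1, j) ∈ D.left (y (i, j)) := fun j => by
      have := (hy (i - 1) j).2.1
      rwa [sub_add_cancel] at this
    simp only [extends3, List.any_eq_true, Bool.and_eq_true, memB_iff]
    exact ⟨_, hl j, _, hl (j + 1), (hy (i - 1) j).2.2.1, _, hl (j + 1 + 1),
      (hy (i - 1) (j + 1)).2.2.1, ih (i - 1)⟩

theorem Admits.of_refines {k : ℕ} {D' : Adjacency} (h : D.refines k D' = true) {y : Config ℕ}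
    (hy : D.Admits y) : D'.Admits y := by
  intro i j
  simp only [refines, Bool.and_eq_true, List.all_eq_true, List.mem_range, Bool.or_eq_true,
    memB_iff] at h
  have hd : ∀ i, y (i, j - 1) ∈ D.down (y (i, j)) := fun i => by
    have := (hy i (j - 1)).2.2.2
    rwa [sub_add_cancel] at this
  have e : j - 1 + 1 = j := sub_add_cancel _ _
  have h1 : ¬ D.dropsH (y (i, j)) (y (i + 1, j)) = true := by
    simp only [dropsH, Bool.or_eq_true, Bool.not_eq_true', ← Bool.not_eq_true, List.any_eq_true,
      memB_iff, not_or, not_not]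
    exact ⟨⟨_, (hy i j).2.2.1, _, (hy (i + 1) j).2.2.1, (hy i (j + 1)).1⟩,
      ⟨_, hd i, _, hd (i + 1), (hy i (j - 1)).1⟩⟩
  have h2 : ¬ D.dropsV k (y (i, j)) (y (i, j + 1)) = true := by
    simp only [dropsV, Bool.or_eq_true, List.all_eq_true, Bool.not_eq_true', ← Bool.not_eq_true,
      Bool.and_eq_true, not_or, not_forall, not_not]
    refine ⟨⟨_, hd i, ?_⟩, ⟨_, (hy i (j + 1)).2.2.1, hy.extends_right k i j,
      hy.extends_left k i j⟩⟩
    have := hy.extends_right k i (j - 1)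
    have := hy.extends_left k i (j - 1)
    rw [e] at *
    exact ⟨by assumption, by assumption⟩
  have h3 := (h.1 _ (lt_length_of_mem_getD (hy i j).1) _ (hy i j).1).resolve_right h1
  have h4 := (h.2 _ (lt_length_of_mem_getD (hy i j).2.2.1) _ (hy i j).2.2.1).resolve_right h2
  exact ⟨h3.1, h3.2, h4.1, h4.2⟩

end Adjacency

/-- Each table refines the preceding one. -/
def refinesAll (k : ℕ) : Adjacency → List Adjacency → Adjacency → Bool
  | D, [], D' => D.refines k D'
  | D, E :: l, D' => D.refines k E && refinesAll k E l D'

theorem Adjacency.Admits.of_refinesAll {k : ℕ} {D D' : Adjacency} {l : List Adjacency}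
    (h : refinesAll k D l D' = true) {y : Config ℕ} (hy : D.Admits y) : D'.Admits y := by
  induction l generalizing D with
  | nil => exact hy.of_refines h
  | cons E l ih =>
    simp only [refinesAll, Bool.and_eq_true] at h
    exact ih h.2 (hy.of_refines h.1)

/-- The tables `D` list the neighbours for the relations `h` and `v` on an alphabet of `n`
letters. -/
structure IsCoding {A : Type} {n : ℕ} (e : A ≃ Fin n) (h v : A → A → Prop) (D : Adjacency) :
    Prop where
  right_iff : ∀ a b, h a b ↔ (e b : ℕ) ∈ D.right (e a)
  left_iff : ∀ a b, h a b ↔ (e a : ℕ) ∈ D.left (e b)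
  up_iff : ∀ a b, v a b ↔ (e b : ℕ) ∈ D.up (e a)
  down_iff : ∀ a b, v a b ↔ (e a : ℕ) ∈ D.down (e b)

/-- The configuration of codes of letters. -/
def coded {A : Type} {n : ℕ} (e : A ≃ Fin n) (y : Config A) : Config ℕ := fun p => e (y p)

theorem IsCoding.admits {A : Type} {n : ℕ} {e : A ≃ Fin n} {h v : A → A → Prop} {D : Adjacency}
    (c : IsCoding e h v D) {y : Config A} (hy : y ∈ nnShift h v) : D.Admits (coded e y) :=
  fun i j => by
    have := mem_nnShift_iff.1 hy i j
    exact ⟨(c.right_iff _ _).1 this.1, (c.left_iff _ _).1 this.1, (c.up_iff _ _).1 this.2,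
      (c.down_iff _ _).1 this.2⟩

/-! ## Coded blocks -/

/-- A block of codes, given by its columns. -/
abbrev Block : Type := List (List ℕ)

namespace Block

def width (b : Block) : ℕ := b.length

def height (b : Block) : ℕ := (b.headD []).length

def entry (b : Block) (p q : ℕ) : ℕ :=
  (b.getD (min p (b.width - 1)) []).getD (min q (b.height - 1)) 0

/-- The shape of the block is between `(1, 1)` and `(2, 2)` and its entries are less than `n`. -/
def wellFormed (n : ℕ) (b : Block) : Bool :=
  Nat.blt 0 b.width && Nat.ble b.width 2 && Nat.blt 0 b.height && Nat.ble b.height 2 &&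
    (List.range b.width).all fun p => (List.range b.height).all fun q => Nat.blt (b.entry p q) n

/-- The word which is coded by a block. -/
def toWord {B : Type} {n : ℕ} [NeZero n] (e : B ≃ Fin n) (b : Block) : Word B where
  width := max 1 b.width
  height := max 1 b.height
  width_pos := by omega
  height_pos := by omega
  letter p q := e.symm (Fin.ofNat n (b.entry p q))

theorem wellFormed_iff {n : ℕ} {b : Block} : b.wellFormed n = true ↔ (0 < b.width ∧ b.width ≤ 2 ∧ 0 < b.height ∧
    b.height ≤ 2) ∧ ∀ p < b.width, ∀ q < b.height, b.entry p q < n := by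
  simp [wellFormed, Nat.blt, and_assoc, Nat.succ_le_iff]

variable {B : Type} {n : ℕ} [NeZero n] {e : B ≃ Fin n} {b : Block}

theorem toWord_width (hb : b.wellFormed n = true) : (b.toWord e).width = b.width := by
  have := (wellFormed_iff.1 hb).1
  simp only [toWord]
  omega

theorem toWord_height (hb : b.wellFormed n = true) : (b.toWord e).height = b.height := by
  have := (wellFormed_iff.1 hb).1
  simp only [toWord]
  omega

theorem toWord_entry (hb : b.wellFormed n = true) (p q : ℕ) :
    (e ((b.toWord e).entry p q) : ℕ) = b.entry p q := by
  obtain ⟨h1, h2⟩ := wellFormed_iff.1 hb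
  have := h2 (min p (b.width - 1)) (by omega) (min q (b.height - 1)) (by omega)
  have hm : b.entry (min p (b.width - 1)) (min q (b.height - 1)) = b.entry p q := by
    simp [entry]
  simp only [Word.entry, toWord, Equiv.apply_symm_apply, Fin.val_ofNat]
  rw [show max 1 b.width = b.width by omega, show max 1 b.height = b.height by omega, hm,
    Nat.mod_eq_of_lt (hm ▸ this)]

end Block

theorem beq_bool_iff {a b : Bool} : (a == b) = true ↔ (a = true ↔ b = true) := by
  cases a <;> cases b <;> simp

/-! ## Checking block substitutions on codes -/

/-- The data of a block substitution on codes: the neighbour tables `source` of its domain, the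
neighbour tables `target` of its range, tables `refined` which are satisfied by all configurations
of the range, the blocks, and the tests whether a column (a row) is in the interior of a block. -/
structure CodedSubstitution where
  source : Adjacency
  target : Adjacency
  refined : Adjacency
  blocks : List Block
  colTest : ℕ → ℕ → Bool
  rowTest : ℕ → ℕ → Bool

namespace CodedSubstitution

variable (C : CodedSubstitution)

def block (i : ℕ) : Block := C.blocks.getD i []

/-- Blocks are well-formed and have valid interiors, compatible with the tests. -/
def checkInner (m n : ℕ) : Bool :=
  (List.range m).all fun i => (C.block i).wellFormed n &&
    ((List.range ((C.block i).width - 1)).all fun p => (List.range (C.block i).height).all fun q =>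
      memB ((C.block i).entry (p + 1) q) (C.target.right ((C.block i).entry p q)) &&
        C.colTest ((C.block i).entry p q) ((C.block i).entry (p + 1) q)) &&
    ((List.range (C.block i).width).all fun p => (List.range ((C.block i).height - 1)).all fun q =>
      memB ((C.block i).entry p (q + 1)) (C.target.up ((C.block i).entry p q)) &&
        C.rowTest ((C.block i).entry p q) ((C.block i).entry p (q + 1)))

/-- Blocks are neighbours exactly if the letters are, and then the tests fail at the border. -/
def checkOuter (m : ℕ) : Bool :=
  (List.range m).all fun i => (List.range m).all fun j =>
    (memB j (C.source.right i) == (Nat.beq (C.block i).height (C.block j).height &&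
      (List.range (C.block i).height).all fun q => memB ((C.block j).entry 0 q)
        (C.target.right ((C.block i).entry ((C.block i).width - 1) q)))) &&
    (memB j (C.source.up i) == (Nat.beq (C.block i).width (C.block j).width &&
      (List.range (C.block i).width).all fun p => memB ((C.block j).entry p 0)
        (C.target.up ((C.block i).entry p ((C.block i).height - 1))))) &&
    (!memB j (C.source.right i) || (List.range (C.block i).height).all fun q =>
      !C.colTest ((C.block i).entry ((C.block i).width - 1) q) ((C.block j).entry 0 q)) &&
    (!memB j (C.source.up i) || (List.range (C.block i).width).all fun p =>
      !C.rowTest ((C.block i).entry p ((C.block i).height - 1)) ((C.block j).entry p 0))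

/-- Different letters have different blocks. -/
def checkInjective (m : ℕ) : Bool :=
  (List.range m).all fun i => (List.range m).all fun j => Nat.beq i j ||
    !(Nat.beq (C.block i).width (C.block j).width && Nat.beq (C.block i).height (C.block j).height &&
      (List.range (C.block i).width).all fun p => (List.range (C.block i).height).all fun q =>
        Nat.beq ((C.block i).entry p q) ((C.block j).entry p q))

/-- The tests have the same value along columns and rows, and do not succeed twice in a row. -/
def checkTests : Bool :=
  ((List.range C.refined.rightTable.length).all fun a => (C.refined.right a).all fun b =>
    ((C.refined.up a).all fun c => (C.refined.right c).all fun d => !memB d (C.refined.up b) ||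
      ((C.colTest a b == C.colTest c d) && (C.rowTest a c == C.rowTest b d))) &&
    (!C.colTest a b || (C.refined.right b).all fun c => !C.colTest b c)) &&
  (List.range C.refined.upTable.length).all fun a => (C.refined.up a).all fun b =>
    !C.rowTest a b || (C.refined.up b).all fun c => !C.rowTest b c

/-- The letter with coordinates `(p, q)` in the square with letters `a b c d`. -/
def corner (a b c d : ℕ) : ℕ → ℕ → ℕ
  | 0, 0 => a
  | _ + 1, 0 => b
  | 0, _ + 1 => c
  | _ + 1, _ + 1 => d

/-- Every cell which is cut out by the tests is one of the blocks. -/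
def checkCover (m : ℕ) : Bool :=
  (List.range C.refined.rightTable.length).all fun a =>
    (C.refined.left a).all (fun l => C.colTest l a) ||
    (C.refined.down a).all (fun l => C.rowTest l a) ||
    (C.refined.right a).all fun b => (C.refined.up a).all fun c => (C.refined.right c).all fun d =>
      !memB d (C.refined.up b) || (List.range m).any fun i =>
        Nat.beq (C.block i).width (bif C.colTest a b then 2 else 1) &&
        Nat.beq (C.block i).height (bif C.rowTest a c then 2 else 1) &&
        (List.range (C.block i).width).all fun p => (List.range (C.block i).height).all fun q =>
          Nat.beq ((C.block i).entry p q) (corner a b c d p q)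

def check (m n : ℕ) : Bool :=
  C.checkInner m n && C.checkOuter m && C.checkInjective m && C.checkTests && C.checkCover m

variable {C} {A B : Type} {m n : ℕ} [NeZero n] {eA : A ≃ Fin m} {eB : B ≃ Fin n}
  {hA vA : A → A → Prop} {hB vB : B → B → Prop}

/-- The substitution on letters. -/
def subst (C : CodedSubstitution) (eA : A ≃ Fin m) (eB : B ≃ Fin n) (a : A) : Word B :=
  (C.block (eA a)).toWord eB

theorem corner_eq {y : Config ℕ} {i j : ℤ} {p q : ℕ} (hp : p < 2) (hq : q < 2) :
    corner (y (i, j)) (y (i + 1, j)) (y (i, j + 1)) (y (i + 1, j + 1)) p q = y (i + p, j + q) := by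
  interval_cases p <;> interval_cases q <;> simp [corner]

theorem isBlockSubstitution (cA : IsCoding eA hA vA C.source) (cB : IsCoding eB hB vB C.target)
    (hr : ∀ y, C.target.Admits y → C.refined.Admits y) (hC : C.check m n = true) :
    IsBlockSubstitution hA vA hB vB (fun a b => C.colTest (eB a) (eB b) = true)
      (fun a b => C.rowTest (eB a) (eB b) = true) (C.subst eA eB) := by
  simp only [check, Bool.and_eq_true] at hC
  obtain ⟨⟨⟨⟨h1, h2⟩, h3⟩, h4⟩, h5⟩ := hC
  simp only [checkInner, List.all_eq_true, List.mem_range, Bool.and_eq_true, memB_iff] at h1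
  simp only [checkOuter, List.all_eq_true, List.mem_range, Bool.and_eq_true, Bool.or_eq_true,
    beq_bool_iff, memB_iff, Bool.not_eq_true', ← Bool.not_eq_true,
    Nat.beq_eq] at h2
  simp only [checkInjective, List.all_eq_true, List.mem_range, Bool.and_eq_true, Bool.or_eq_true,
    Bool.not_eq_true', ← Bool.not_eq_true, Nat.beq_eq] at h3
  simp only [checkTests, List.all_eq_true, List.mem_range, Bool.and_eq_true, Bool.or_eq_true,
    beq_bool_iff, memB_iff, Bool.not_eq_true', ← Bool.not_eq_true] at h4
  simp only [checkCover, List.all_eq_true, List.any_eq_true, List.mem_range, Bool.and_eq_true,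
    Bool.or_eq_true, memB_iff, Bool.not_eq_true', ← Bool.not_eq_true, Nat.beq_eq] at h5
  have lt : ∀ a, (eA a : ℕ) < m := fun a => (eA a).2
  have wf : ∀ a, (C.block (eA a)).wellFormed n = true := fun a => (h1 _ (lt a)).1.1
  have w : ∀ a, (C.subst eA eB a).width = (C.block (eA a)).width := fun a =>
    Block.toWord_width (wf a)
  have l : ∀ a, (C.subst eA eB a).height = (C.block (eA a)).height := fun a =>
    Block.toWord_height (wf a)
  have en : ∀ a p q, (eB ((C.subst eA eB a).entry p q) : ℕ) = (C.block (eA a)).entry p q :=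
    fun a => Block.toWord_entry (wf a)
  have ad : ∀ y ∈ nnShift hB vB, C.refined.Admits (coded eB y) := fun y hy => hr _ (cB.admits hy)
  constructor
  case width_le => exact fun a => by rw [w]; exact (Block.wellFormed_iff.1 (wf a)).1.2.1
  case height_le => exact fun a => by rw [l]; exact (Block.wellFormed_iff.1 (wf a)).1.2.2.2
  case inner_h =>
    intro a p q hp hq
    rw [cB.right_iff, en, en]
    rw [w] at hp
    rw [l] at hq
    exact ((h1 _ (lt a)).1.2 p (by omega) q hq).1
  case inner_v =>
    intro a p q hp hq
    rw [cB.up_iff, en, en]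
    rw [w] at hp
    rw [l] at hq
    exact ((h1 _ (lt a)).2 p hp q (by omega)).1
  case cont_h =>
    intro a p q hp hq
    rw [en, en]
    rw [w] at hp
    rw [l] at hq
    exact ((h1 _ (lt a)).1.2 p (by omega) q hq).2
  case cont_v =>
    intro a p q hp hq
    rw [en, en]
    rw [w] at hp
    rw [l] at hq
    exact ((h1 _ (lt a)).2 p hp q (by omega)).2
  case h_iff =>
    intro a b
    rw [cA.right_iff, (h2 _ (lt a) _ (lt b)).1.1.1]
    simp only [cB.right_iff, en, w, l]
  case v_iff =>
    intro a b
    rw [cA.up_iff, (h2 _ (lt a) _ (lt b)).1.1.2]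
    simp only [cB.up_iff, en, w, l]
  case start_h =>
    intro a b hab q hq
    rw [en, en, w]
    rw [l] at hq
    exact (h2 _ (lt a) _ (lt b)).1.2.resolve_left (not_not.2 ((cA.right_iff _ _).1 hab)) q hq
  case start_v =>
    intro a b hab q hq
    rw [en, en, l]
    rw [w] at hq
    exact (h2 _ (lt a) _ (lt b)).2.resolve_left (not_not.2 ((cA.up_iff _ _).1 hab)) q hq
  case inj =>
    intro a b hab
    refine eA.injective (Fin.ext ((h3 _ (lt a) _ (lt b)).resolve_right (not_not.2 ⟨⟨?_, ?_⟩, ?_⟩)))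
    · rw [← w, hab, w]
    · rw [← l, hab, l]
    · intro p _ q _
      rw [← en, hab, en]
  case col =>
    intro y hy i j
    have a1 := ad y hy i j
    exact ((((h4.1 _ (lt_length_of_mem_getD a1.1) _ a1.1).1 _ a1.2.2.1 _
      (ad y hy i (j + 1)).1).resolve_left (not_not.2 (ad y hy (i + 1) j).2.2.1)).1)
  case row =>
    intro y hy i j
    have a1 := ad y hy i j
    exact ((((h4.1 _ (lt_length_of_mem_getD a1.1) _ a1.1).1 _ a1.2.2.1 _
      (ad y hy i (j + 1)).1).resolve_left (not_not.2 (ad y hy (i + 1) j).2.2.1)).2)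
  case sep_h =>
    intro y hy i j hq
    have a1 := (ad y hy i j).1
    exact ((h4.1 _ (lt_length_of_mem_getD a1) _ a1).2.resolve_left (not_not.2 hq)) _
      (ad y hy (i + 1) j).1
  case sep_v =>
    intro y hy i j hq
    have a1 := (ad y hy i j).2.2.1
    exact ((h4.2 _ (lt_length_of_mem_getD a1) _ a1).resolve_left (not_not.2 hq)) _
      (ad y hy i (j + 1)).2.2.1
  case cover =>
    intro y hy i j hi hj
    have a1 := ad y hy i j
    have a2 := (ad y hy (i - 1) j).2.1
    have a3 := (ad y hy i (j - 1)).2.2.2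
    rw [sub_add_cancel] at a2 a3
    have h6 := (h5 _ (lt_length_of_mem_getD a1.1)).resolve_left
      (not_or.2 ⟨fun h => hi (h _ a2), fun h => hj (h _ a3)⟩)
    obtain ⟨t, ht, ⟨hw, hl⟩, h7⟩ := (h6 _ a1.1 _ a1.2.2.1 _ (ad y hy i (j + 1)).1).resolve_left
      (not_not.2 (ad y hy (i + 1) j).2.2.1)
    obtain ⟨a, ha⟩ := eA.surjective ⟨t, ht⟩
    have ha' : (eA a : ℕ) = t := by rw [ha]
    have hwf := (Block.wellFormed_iff.1 (wf a)).1
    rw [ha'] at hwf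
    refine ⟨a, Word.occursAt_iff.2 fun p q hp hq => ?_, ?_, ?_⟩
    · rw [w, ha'] at hp
      rw [l, ha'] at hq
      refine eB.injective (Fin.ext ?_)
      rw [en, ha', h7 p hp q hq, corner_eq (y := coded eB y) (by omega) (by omega)]
      rfl
    · rw [w, ha', hw]
      change (bif C.colTest (eB (y (i, j))) (eB (y (i + 1, j))) then 2 else 1) = 2 ↔ _
      cases C.colTest (eB (y (i, j))) (eB (y (i + 1, j))) <;> simp
    · rw [l, ha', hl]
      change (bif C.rowTest (eB (y (i, j))) (eB (y (i, j + 1))) then 2 else 1) = 2 ↔ _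
      cases C.rowTest (eB (y (i, j))) (eB (y (i, j + 1))) <;> simp

end CodedSubstitution

/-! ## Checking expanding substitutions on codes -/

namespace CodedSubstitution

/-- Equality of quadruples. -/
def sameSquare (P R : ℕ × ℕ × ℕ × ℕ) : Bool :=
  Nat.beq P.1 R.1 && Nat.beq P.2.1 R.2.1 && Nat.beq P.2.2.1 R.2.2.1 && Nat.beq P.2.2.2 R.2.2.2

theorem sameSquare_iff {P R : ℕ × ℕ × ℕ × ℕ} : sameSquare P R = true ↔ P = R := by
  simp [sameSquare, Nat.beq_eq, Prod.ext_iff, and_assoc]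

variable (C : CodedSubstitution)

/-- The letter with coordinates `(p, q)` in the image of a square of codes. -/
def imageEntry (P : ℕ × ℕ × ℕ × ℕ) (p q : ℕ) : ℕ :=
  if p < (C.block P.1).width then
    if q < (C.block P.1).height then (C.block P.1).entry p q
    else (C.block P.2.2.1).entry p (q - (C.block P.1).height)
  else
    if q < (C.block P.1).height then (C.block P.2.1).entry (p - (C.block P.1).width) q
    else (C.block P.2.2.2).entry (p - (C.block P.1).width) (q - (C.block P.1).height)

/-- The square with lower left corner `(p, q)` in the image of a square of codes. -/
def imageSquare (P : ℕ × ℕ × ℕ × ℕ) (p q : ℕ) : ℕ × ℕ × ℕ × ℕ :=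
  (C.imageEntry P p q, C.imageEntry P (p + 1) q, C.imageEntry P p (q + 1),
    C.imageEntry P (p + 1) (q + 1))

/-- The horizontal and vertical number of squares in the image of a square. -/
def imageShape (P : ℕ × ℕ × ℕ × ℕ) : ℕ × ℕ :=
  ((C.block P.1).width + (C.block P.2.1).width - 1,
    (C.block P.1).height + (C.block P.2.2.1).height - 1)

/-- Narrow and low blocks come from interior columns and rows, and blocks start with letters which
have wide and tall blocks. -/
def checkSizes (m : ℕ) : Bool :=
  (List.range m).all fun i =>
    ((C.source.right i).all fun j => !Nat.beq (C.block j).width 1 || C.colTest i j) &&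
    ((C.source.up i).all fun j => !Nat.beq (C.block j).height 1 || C.rowTest i j) &&
    ((List.range (C.block i).height).all fun q =>
      Nat.beq (C.block ((C.block i).entry 0 q)).width 2) &&
    ((List.range (C.block i).width).all fun p =>
      Nat.beq (C.block ((C.block i).entry p 0)).height 2)

/-- The list `Q` contains all squares which are admitted by the refined tables. -/
def checkSquares (Q : List (ℕ × ℕ × ℕ × ℕ)) : Bool :=
  (List.range C.refined.rightTable.length).all fun a => (C.refined.right a).all fun b =>
    (C.refined.up a).all fun c => (C.refined.right c).all fun d => !memB d (C.refined.up b) ||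
      Q.any (sameSquare (a, b, c, d))

/-- The squares in the image of the `i`-th square are those with index in the `i`-th list of
`children`. -/
def checkChildren (Q : List (ℕ × ℕ × ℕ × ℕ)) (children : List (List ℕ)) : Bool :=
  (List.range Q.length).all fun i =>
    ((List.range (C.imageShape (Q.getD i 0)).1).all fun p =>
      (List.range (C.imageShape (Q.getD i 0)).2).all fun q => (children.getD i []).any fun j =>
        sameSquare (Q.getD j 0) (C.imageSquare (Q.getD i 0) p q)) &&
    (children.getD i []).all fun j => Nat.blt j Q.length &&
      (List.range (C.imageShape (Q.getD i 0)).1).any fun p =>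
        (List.range (C.imageShape (Q.getD i 0)).2).any fun q =>
          sameSquare (Q.getD j 0) (C.imageSquare (Q.getD i 0) p q)

/-- The `i`-th number in the `k`-th list of `levels` is the bit mask of the squares which are
obtained in `k` steps from the `i`-th square, for `k ≤ r`. -/
def checkLevels (s r : ℕ) (children levels : List (List ℕ)) : Bool :=
  (List.range s).all fun i => Nat.beq ((levels.getD 0 []).getD i 0) (2 ^ i) &&
    (List.range r).all fun k => Nat.beq ((levels.getD (k + 1) []).getD i 0)
      ((children.getD i []).foldl (fun b j => b ||| (levels.getD k []).getD j 0) 0)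

/-- In `r` steps one obtains all squares in images and all letters. -/
def checkPrimitive (m r : ℕ) (Q : List (ℕ × ℕ × ℕ × ℕ)) (children levels : List (List ℕ)) : Bool :=
  (List.range Q.length).all fun i =>
    ((List.range Q.length).all fun i' => (children.getD i' []).all fun j =>
      Nat.testBit ((levels.getD r []).getD i 0) j) &&
    (List.range m).all fun a => (List.range Q.length).any fun j =>
      Nat.testBit ((levels.getD r []).getD i 0) j && Nat.beq (Q.getD j 0).1 a

theorem testBit_foldl_or {f : ℕ → ℕ} {l : List ℕ} {b t : ℕ} :
    Nat.testBit (l.foldl (fun b j => b ||| f j) b) t = true ↔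
      Nat.testBit b t = true ∨ ∃ j ∈ l, Nat.testBit (f j) t = true := by
  induction l generalizing b with
  | nil => simp
  | cons j l ih => simp [ih, or_assoc]

/-- The codes of the letters of a square. -/
def codeSquare {A : Type} {n : ℕ} (e : A ≃ Fin n) (P : A × A × A × A) : ℕ × ℕ × ℕ × ℕ :=
  (e P.1, e P.2.1, e P.2.2.1, e P.2.2.2)

theorem codeSquare_injective {A : Type} {n : ℕ} {e : A ≃ Fin n} :
    Function.Injective (codeSquare e) := by
  rintro ⟨a, b, c, d⟩ ⟨a', b', c', d'⟩ hP
  simpa [codeSquare, Fin.val_inj] using hP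

variable {C} {A : Type} {n : ℕ} [NeZero n] {e : A ≃ Fin n} {h v : A → A → Prop}

theorem subst_shape (hC : C.checkInner n n = true) (a : A) :
    (C.subst e e a).width = (C.block (e a)).width ∧
      (C.subst e e a).height = (C.block (e a)).height ∧
      ∀ p q, (e ((C.subst e e a).entry p q) : ℕ) = (C.block (e a)).entry p q := by
  simp only [checkInner, List.all_eq_true, List.mem_range, Bool.and_eq_true] at hC
  have wf := (hC _ (e a).2).1.1
  exact ⟨Block.toWord_width wf, Block.toWord_height wf, Block.toWord_entry wf⟩

theorem codeSquare_image (hC : C.checkInner n n = true) (P : A × A × A × A) (p q : ℕ) :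
    codeSquare e (squareEntry (C.subst e e) P p q,
      squareEntry (C.subst e e) P (p + 1) q, squareEntry (C.subst e e) P p (q + 1),
      squareEntry (C.subst e e) P (p + 1) (q + 1)) = C.imageSquare (codeSquare e P) p q := by
  have es : ∀ p q, (e (squareEntry (C.subst e e) P p q) : ℕ) =
      C.imageEntry (codeSquare e P) p q := fun p q => by
    by_cases h1 : p < (C.block (e P.1)).width <;> by_cases h2 : q < (C.block (e P.1)).height <;>
      simp only [squareEntry, imageEntry, codeSquare, subst_shape hC, h1, h2, if_true, if_false]
  simp only [imageSquare, ← es]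
  rfl

theorem squareStep_iff (hC : C.checkInner n n = true) {P R : A × A × A × A} :
    SquareStep (C.subst e e) P R ↔ ∃ p < (C.imageShape (codeSquare e P)).1,
      ∃ q < (C.imageShape (codeSquare e P)).2,
        codeSquare e R = C.imageSquare (codeSquare e P) p q := by
  simp only [SquareStep, imageShape, codeSquare, (subst_shape hC _).1, (subst_shape hC _).2.1]
  constructor
  · rintro ⟨p, q, hp, hq, rfl⟩
    exact ⟨p, by omega, q, by omega, codeSquare_image hC P p q⟩
  · rintro ⟨p, hp, q, hq, hR⟩
    exact ⟨p, q, by omega, by omega,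
      codeSquare_injective (hR.trans (codeSquare_image hC P p q).symm)⟩

theorem squareSteps_of_testBit (hC : C.checkInner n n = true) {r : ℕ}
    {Q : List (ℕ × ℕ × ℕ × ℕ)} {children levels : List (List ℕ)}
    (hc : C.checkChildren Q children = true) (hl : checkLevels Q.length r children levels = true)
    {k : ℕ} (hk : k ≤ r) {i t : ℕ} (hi : i < Q.length)
    (ht : Nat.testBit ((levels.getD k []).getD i 0) t = true) {P : A × A × A × A}
    (hP : codeSquare e P = Q.getD i 0) :
    ∃ R, codeSquare e R = Q.getD t 0 ∧ SquareSteps (C.subst e e) k P R := by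
  simp only [checkLevels, List.all_eq_true, List.mem_range, Bool.and_eq_true, Nat.beq_eq] at hl
  simp only [checkChildren, List.all_eq_true, List.any_eq_true, List.mem_range, Bool.and_eq_true,
    sameSquare_iff, Nat.blt_eq] at hc
  induction k generalizing i P with
  | zero =>
    rw [(hl i hi).1, Nat.testBit_two_pow, decide_eq_true_iff] at ht
    subst ht
    exact ⟨P, hP, rfl⟩
  | succ k ih =>
    rw [(hl i hi).2 k (by omega), testBit_foldl_or] at ht
    obtain ⟨j, hj, ht⟩ := ht.resolve_left (by simp)
    obtain ⟨hjlt, p, hp, q, hq, hjQ⟩ := (hc i hi).2 j hj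
    rw [← hP] at hp hq hjQ
    have hP' := (codeSquare_image hC P p q).trans hjQ.symm
    obtain ⟨R, hR, hs⟩ := ih (by omega) hjlt ht hP'
    exact ⟨R, hR, _, (squareStep_iff hC).2 ⟨p, hp, q, hq, hP'.trans hjQ⟩, hs⟩

theorem isExpandingSubstitution (c : IsCoding e h v C.source) (hst : C.target = C.source)
    (hr : ∀ y, C.source.Admits y → C.refined.Admits y) (hC : C.check n n = true)
    (hs : C.checkSizes n = true) {r : ℕ} {Q : List (ℕ × ℕ × ℕ × ℕ)}
    {children levels : List (List ℕ)} (hQ : C.checkSquares Q = true)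
    (hc : C.checkChildren Q children = true) (hl : checkLevels Q.length r children levels = true)
    (hp : checkPrimitive n r Q children levels = true) :
    IsExpandingSubstitution h v (fun a b => C.colTest (e a) (e b) = true)
      (fun a b => C.rowTest (e a) (e b) = true) (C.subst e e) := by
  have hin : C.checkInner n n = true := by
    simp only [check, Bool.and_eq_true] at hC
    exact hC.1.1.1.1
  have w := fun a => (subst_shape (e := e) hin a).1
  have l := fun a => (subst_shape (e := e) hin a).2.1
  have en := fun a => (subst_shape (e := e) hin a).2.2
  simp only [checkSizes, List.all_eq_true, List.mem_range, Bool.and_eq_true, Bool.or_eq_true,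
    Bool.not_eq_true', ← Bool.not_eq_true, Nat.beq_eq] at hs
  simp only [checkSquares, List.all_eq_true, List.any_eq_true, List.mem_range, Bool.or_eq_true,
    Bool.not_eq_true', ← Bool.not_eq_true, sameSquare_iff, memB_iff] at hQ
  have hc' := hc
  simp only [checkChildren, List.all_eq_true, List.any_eq_true, List.mem_range, Bool.and_eq_true,
    sameSquare_iff, Nat.blt_eq] at hc'
  simp only [checkPrimitive, List.all_eq_true, List.any_eq_true, List.mem_range, Bool.and_eq_true,
    Nat.beq_eq] at hp
  have hsq : ∀ y ∈ nnShift h v, ∀ q, ∃ i < Q.length, codeSquare e (squareAt y q) = Q.getD i 0 := by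
    rintro y hy ⟨i, j⟩
    have ad := hr _ (c.admits hy)
    have a1 := ad i j
    obtain ⟨P, hP, e1⟩ := (hQ _ (lt_length_of_mem_getD a1.1) _ a1.1 _ a1.2.2.1 _
      (ad i (j + 1)).1).resolve_left (not_not.2 (ad (i + 1) j).2.2.1)
    obtain ⟨t, ht, rfl⟩ := List.mem_iff_getElem.1 hP
    refine ⟨t, ht, ?_⟩
    rw [List.getD_eq_getElem _ _ ht, ← e1]
    simp [codeSquare, squareAt, coded]
  exact
    { C.isBlockSubstitution c (hst ▸ c) (hst ▸ hr) hC with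
      narrow := fun a b hab hb => ((hs _ (e a).2).1.1.1 _ ((c.right_iff _ _).1 hab)).resolve_left
        (not_not.2 (by rw [← w, hb]))
      low := fun a b hab hb => ((hs _ (e a).2).1.1.2 _ ((c.up_iff _ _).1 hab)).resolve_left
        (not_not.2 (by rw [← l, hb]))
      wide_start := fun a q hq => by
        rw [w, en]
        exact (hs _ (e a).2).1.2 q (by rwa [l] at hq)
      tall_start := fun a p hp => by
        rw [l, en]
        exact (hs _ (e a).2).2 p (by rwa [w] at hp)
      primitive := by
        refine ⟨r, fun y hy q => ?_⟩
        obtain ⟨i, hi, hi'⟩ := hsq y hy q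
        refine ⟨fun x hx p P hP => ?_, fun a => ?_⟩
        · obtain ⟨i', hi0, hi1⟩ := hsq x hx p
          obtain ⟨p, hp', q, hq, hPe⟩ := (squareStep_iff hin).1 hP
          rw [hi1] at hp' hq hPe
          obtain ⟨t, ht, hte⟩ := (hc' i' hi0).1 p hp' q hq
          obtain ⟨R, hR, hs⟩ := squareSteps_of_testBit hin hc hl le_rfl hi
            ((hp i hi).1 i' hi0 t ht) hi'
          rwa [codeSquare_injective (hPe.trans (hte.symm.trans hR.symm))]
        · obtain ⟨t, ht, htb, hta⟩ := (hp i hi).2 _ (e a).2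
          obtain ⟨R, hR, hs⟩ := squareSteps_of_testBit hin hc hl le_rfl hi htb hi'
          refine ⟨R, e.injective (Fin.ext ?_), hs⟩
          rw [← hta, ← hR]
          rfl }

end CodedSubstitution

/-! ## Wang shifts of coded sets of tiles -/

namespace WangTileSet

/-- `b` may be placed to the right of `a`. -/
def horizontal (T : WangTileSet) (a b : T.Alphabet) : Prop := a.1.right = b.1.left

/-- `b` may be placed on top of `a`. -/
def vertical (T : WangTileSet) (a b : T.Alphabet) : Prop := a.1.top = b.1.bottom

theorem isSubshift (T : WangTileSet) : IsSubshift T.wangShift :=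
  isSubshift_nnShift (h := T.horizontal) (v := T.vertical)

theorem continuous_letter {B : Type} [TopologicalSpace B] (T : WangTileSet) (φ : T.Alphabet → B)
    (p : ℤ × ℤ) : Continuous fun x : T.wangShift => φ (x.1 p) :=
  (continuous_of_discreteTopology (f := φ)).comp
    ((continuous_apply p).comp (continuous_subtype_val (p := (· ∈ T.wangShift))))

/-- The tiles can be numbered by `Fin n` such that the tables `D` list the neighbours. -/
def CodedBy (T : WangTileSet) (n : ℕ) (D : Adjacency) : Prop :=
  ∃ e : T.Alphabet ≃ Fin n, IsCoding e T.horizontal T.vertical D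

end WangTileSet

/-- The tables `D` list the neighbours in the list of tiles `l`. -/
def checkTables {I J : Type} [DecidableEq I] [DecidableEq J] (l : List (WangTile I J))
    (D : Adjacency) : Bool :=
  l.zipIdx.all fun s => l.zipIdx.all fun t =>
    (decide (s.1.right = t.1.left) == memB t.2 (D.right s.2)) &&
    (decide (s.1.right = t.1.left) == memB s.2 (D.left t.2)) &&
    (decide (s.1.top = t.1.bottom) == memB t.2 (D.up s.2)) &&
    (decide (s.1.top = t.1.bottom) == memB s.2 (D.down t.2))

theorem WangTileSet.codedBy {I J : Type} [DecidableEq I] [DecidableEq J] {fI : Finite I}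
    {fJ : Finite J} {S : Finset (WangTile I J)} (l : List (WangTile I J)) {n : ℕ} {D : Adjacency}
    (hS : ∀ t, t ∈ S ↔ t ∈ l) (hl : l.Nodup) (hn : l.length = n) (hD : checkTables l D = true) :
    (WangTileSet.mk I J fI fJ S).CodedBy n D := by
  let e : {t // t ∈ S} ≃ Fin n := (Equiv.subtypeEquivRight hS).trans
    ((List.Nodup.getEquiv l hl).symm.trans (finCongr hn))
  have he : ∀ a : {t // t ∈ S}, (a.1, (e a : ℕ)) ∈ l.zipIdx := fun a => by
    rw [List.mem_zipIdx_iff_getElem?]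
    have h1 := (List.Nodup.getEquiv l hl).apply_symm_apply (Equiv.subtypeEquivRight hS a)
    have h2 := congrArg Subtype.val h1
    simp only [List.Nodup.getEquiv_apply_coe, List.get_eq_getElem] at h2
    exact List.getElem?_eq_some_iff.2 ⟨_, h2⟩
  simp only [checkTables, List.all_eq_true, Bool.and_eq_true, beq_bool_iff, decide_eq_true_iff,
    memB_iff] at hD
  exact ⟨e, fun a b => (hD _ (he a) _ (he b)).1.1.1, fun a b => (hD _ (he a) _ (he b)).1.1.2,
    fun a b => (hD _ (he a) _ (he b)).1.2, fun a b => (hD _ (he a) _ (he b)).2⟩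

theorem WangTileSet.exists_morphism {T S : WangTileSet} {m n : ℕ} [NeZero n]
    (C : CodedSubstitution) (hT : T.CodedBy m C.source) (hS : S.CodedBy n C.target) {k : ℕ}
    {l : List Adjacency} (hr : refinesAll k C.target l C.refined = true)
    (hC : C.check m n = true) :
    ∃ ω : Word T.Alphabet → Word S.Alphabet, IsMorphismBetween T.wangShift S.wangShift ω ∧
      IsRecognizable T.wangShift ω ∧ IsOntoUpToShift T.wangShift S.wangShift ω := by
  obtain ⟨eT, cT⟩ := hT
  obtain ⟨eS, cS⟩ := hS
  have H := C.isBlockSubstitution cT cS (fun _ hy => hy.of_refinesAll hr) hC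
  exact ⟨_, H.isMorphismBetween, H.isRecognizable, H.isOntoUpToShift⟩

theorem isShiftInvariant_imageSet {A B : Type} [TopologicalSpace A] [TopologicalSpace B]
    {X : Set (Config A)} {Y : Set (Config B)} {θ : X → Y} (hX : IsShiftInvariant X)
    (hθ : IsHomomorphism θ) : IsShiftInvariant (imageSet θ) := by
  have sub : ∀ n, shift n '' imageSet θ ⊆ imageSet θ := by
    rintro n _ ⟨_, ⟨x, rfl⟩, rfl⟩
    have hx : shift n x.1 ∈ X := (hX n).subset ⟨x.1, x.2, rfl⟩
    exact ⟨⟨_, hx⟩, hθ.2 n x ⟨_, hx⟩ rfl⟩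
  exact fun n => (sub n).antisymm fun y hy => ⟨shift (-n) y, sub (-n) ⟨y, hy, rfl⟩, by
    rw [shift_shift, add_neg_cancel, shift_zero]⟩

theorem IsShiftEmbedding.isConjugacyOntoImage {A B : Type} [Finite A] [TopologicalSpace A]
    [DiscreteTopology A] [TopologicalSpace B] [DiscreteTopology B] {X : Set (Config A)}
    {Y : Set (Config B)} {θ : X → Y} (hX : IsSubshift X) (hθ : IsShiftEmbedding θ) :
    IsConjugacyOntoImage θ := by
  have : CompactSpace X := isCompact_iff_compactSpace.1 hX.1.isCompact
  have hc : Continuous fun x => (θ x).1 := continuous_subtype_val.comp hθ.1.1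
  have hc' : Continuous (toImage θ) := hc.subtype_mk _
  refine ⟨⟨(isCompact_range hc).isClosed, isShiftInvariant_imageSet hX.2 hθ.1⟩,
    ⟨hc', hθ.1.2⟩, isHomeomorph_iff_continuous_bijective.2 ⟨hc', fun x y hxy => ?_, ?_⟩⟩
  · exact hθ.2 (Subtype.ext (congrArg (fun z : imageSet θ => z.1) hxy))
  · rintro ⟨_, x, rfl⟩
    exact ⟨x, rfl⟩

/-- The injective map `i ↦ f[i]` preserves the neighbours of `D`. -/
def checkEmbedding (m n : ℕ) (D E : Adjacency) (f : List ℕ) : Bool :=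
  (List.range m).all fun i => Nat.blt (f.getD i 0) n &&
    (List.range m).all (fun j => Nat.beq i j || !Nat.beq (f.getD i 0) (f.getD j 0)) &&
    (D.right i).all (fun j => memB (f.getD j 0) (E.right (f.getD i 0))) &&
    (D.up i).all (fun j => memB (f.getD j 0) (E.up (f.getD i 0)))

theorem WangTileSet.exists_embedding {T S : WangTileSet} {m n : ℕ} [NeZero n] {D E : Adjacency}
    (hT : T.CodedBy m D) (hS : S.CodedBy n E) (f : List ℕ)
    (hf : checkEmbedding m n D E f = true) :
    ∃ j : T.wangShift → S.wangShift, IsShiftEmbedding j ∧ IsConjugacyOntoImage j := by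
  obtain ⟨eT, cT⟩ := hT
  obtain ⟨eS, cS⟩ := hS
  simp only [checkEmbedding, List.all_eq_true, List.mem_range, Bool.and_eq_true, Bool.or_eq_true,
    Bool.not_eq_true', ← Bool.not_eq_true, Nat.beq_eq, memB_iff, Nat.blt_eq] at hf
  let φ : T.Alphabet → S.Alphabet := fun a => eS.symm (Fin.ofNat n (f.getD (eT a) 0))
  have hφ : ∀ a, (eS (φ a) : ℕ) = f.getD (eT a) 0 := fun a => by
    simp only [φ, Equiv.apply_symm_apply, Fin.val_ofNat]
    exact Nat.mod_eq_of_lt (hf _ (eT a).2).1.1.1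
  have inj : Function.Injective φ := fun a b hab =>
    eT.injective (Fin.ext (((hf _ (eT a).2).1.1.2 _ (eT b).2).resolve_right
      (not_not.2 (by rw [← hφ, ← hφ, hab]))))
  let j : T.wangShift → S.wangShift := fun x => ⟨fun p => φ (x.1 p), fun p =>
    ⟨(cS.right_iff _ _).2 (by
      rw [hφ, hφ]; exact (hf _ (eT _).2).1.2 _ ((cT.right_iff _ _).1 (x.2 p).1)),
    (cS.up_iff _ _).2 (by
      rw [hφ, hφ]; exact (hf _ (eT _).2).2 _ ((cT.up_iff _ _).1 (x.2 p).2))⟩⟩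
  have hj : IsShiftEmbedding j := by
    refine ⟨⟨?_, fun k x x' hx => ?_⟩, fun x y hxy => ?_⟩
    · exact (continuous_pi fun p => T.continuous_letter φ p).subtype_mk _
    · funext p
      simp only [j, hx, shift]
    · refine Subtype.ext (funext fun p => inj ?_)
      exact congrFun (congrArg Subtype.val hxy) p
  exact ⟨j, hj, hj.isConjugacyOntoImage T.isSubshift⟩

/-- The map `i ↦ f[i]` shears the configurations for the tables `D` to configurations for the
tables `E`, with inverse given by the map `g` on horizontal pairs; the tables `F` list the pairs
which occur. -/
def checkShear (m n : ℕ) (D E F : Adjacency) (f : List ℕ) (g : ℕ → ℕ → ℕ) : Bool :=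
  (List.range m).all (fun i => Nat.blt (f.getD i 0) n && (D.right i).all fun j =>
    memB (f.getD j 0) (E.right (f.getD i 0)) &&
    (D.up i).all (fun k => memB (f.getD k 0) (E.up (f.getD j 0))) &&
    (List.range m).all fun i' => !Nat.beq (f.getD i 0) (f.getD i' 0) || Nat.beq i i' ||
      (D.right i').all fun j' => !Nat.beq (f.getD j 0) (f.getD j' 0)) &&
  (List.range n).all fun a => (F.right a).all fun b => Nat.blt (g a b) m &&
    Nat.beq (f.getD (g a b) 0) a && (F.right b).all (fun c => memB (g b c) (D.right (g a b))) &&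
    (F.up b).all fun c => (F.right c).all fun d => memB (g c d) (D.up (g a b))

theorem WangTileSet.exists_shear {T S : WangTileSet} {m n : ℕ} [NeZero m] [NeZero n]
    {D E F : Adjacency} (hT : T.CodedBy m D) (hS : S.CodedBy n E) {k : ℕ} {l : List Adjacency}
    (hr : refinesAll k E l F = true) (f : List ℕ) (g : ℕ → ℕ → ℕ)
    (hf : checkShear m n D E F f g = true) :
    ∃ η : T.wangShift → S.wangShift, IsGLConjugacy shearMatrix η ∧
      ∃ f : T.Alphabet → S.Alphabet, ∀ (y : T.wangShift) (p : ℤ × ℤ),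
        (η y).1 (matAct shearMatrix.1 p) = f (y.1 p) := by
  obtain ⟨eT, cT⟩ := hT
  obtain ⟨eS, cS⟩ := hS
  simp only [checkShear, List.all_eq_true, List.mem_range, Bool.and_eq_true, Bool.or_eq_true,
    Bool.not_eq_true', ← Bool.not_eq_true, Nat.beq_eq, memB_iff, Nat.blt_eq] at hf
  obtain ⟨hf, hg⟩ := hf
  let φ : T.Alphabet → S.Alphabet := fun a => eS.symm (Fin.ofNat n (f.getD (eT a) 0))
  have hφ : ∀ a, (eS (φ a) : ℕ) = f.getD (eT a) 0 := fun a => by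
    simp only [φ, Equiv.apply_symm_apply, Fin.val_ofNat]
    exact Nat.mod_eq_of_lt (hf _ (eT a).2).1
  let ψ : S.Alphabet → S.Alphabet → T.Alphabet := fun a b =>
    eT.symm (Fin.ofNat m (g (eS a) (eS b)))
  have hψ : ∀ a b, (eS b : ℕ) ∈ F.right (eS a) → (eT (ψ a b) : ℕ) = g (eS a) (eS b) :=
    fun a b hab => by
      simp only [ψ, Equiv.apply_symm_apply, Fin.val_ofNat]
      exact Nat.mod_eq_of_lt (hg _ (eS a).2 _ hab).1.1.1
  have hφψ : ∀ a b, (eS b : ℕ) ∈ F.right (eS a) → φ (ψ a b) = a := fun a b hab =>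
    eS.injective (Fin.ext (by rw [hφ, hψ a b hab]; exact (hg _ (eS a).2 _ hab).1.1.2))
  have hT : ∀ y : T.wangShift, ∀ i j : ℤ, (eT (y.1 (i + 1, j)) : ℕ) ∈ D.right (eT (y.1 (i, j))) ∧
      (eT (y.1 (i, j + 1)) : ℕ) ∈ D.up (eT (y.1 (i, j))) := fun y i j =>
    ⟨(cT.admits y.2 i j).1, (cT.admits y.2 i j).2.2.1⟩
  let η : T.wangShift → S.wangShift := fun y => ⟨fun q => φ (y.1 (q.1 - q.2, q.2)), by
    refine mem_nnShift_iff.2 fun i j => ⟨(cS.right_iff _ _).2 ?_, (cS.up_iff _ _).2 ?_⟩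
    · have := ((hf _ (eT _).2).2 _ (hT y (i - j) j).1).1.1
      simpa only [hφ, sub_add_eq_add_sub] using this
    · have h1 := hT y (i - (j + 1)) j
      have := ((hf _ (eT _).2).2 _ h1.1).1.2 _ h1.2
      simpa only [hφ, show i - (j + 1) + 1 = i - j by ring] using this⟩
  have hcont : Continuous η := 
    (continuous_pi fun q : ℤ × ℤ => T.continuous_letter φ (q.1 - q.2, q.2)).subtype_mk _
  have hinj : Function.Injective η := by
    intro y y' hy
    have e : ∀ i j : ℤ, f.getD (eT (y.1 (i, j))) 0 = f.getD (eT (y'.1 (i, j))) 0 := fun i j => by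
      have := congrFun (congrArg Subtype.val hy) (i + j, j)
      simp only [η, add_sub_cancel_right] at this
      rw [← hφ, ← hφ, this]
    refine Subtype.ext (funext fun ⟨i, j⟩ => eT.injective (Fin.ext ?_))
    have := ((hf _ (eT _).2).2 _ (hT y i j).1).2 _ (eT (y'.1 (i, j))).2
    exact (this.resolve_right fun h => h _ (hT y' i j).1 (e _ _)).resolve_left
      (not_not.2 (e i j))
  have hsurj : Function.Surjective η := by
    intro x
    have ad : F.Admits (coded eS x.1) := (cS.admits x.2).of_refinesAll hr
    have hR : ∀ i j : ℤ, (eS (x.1 (i + 1, j)) : ℕ) ∈ F.right (eS (x.1 (i, j))) :=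
      fun i j => (ad i j).1
    have hU : ∀ i j : ℤ, (eS (x.1 (i, j + 1)) : ℕ) ∈ F.up (eS (x.1 (i, j))) :=
      fun i j => (ad i j).2.2.1
    refine ⟨⟨fun p => ψ (x.1 (p.1 + p.2, p.2)) (x.1 (p.1 + p.2 + 1, p.2)), ?_⟩, ?_⟩
    · refine mem_nnShift_iff.2 fun i j => ⟨(cT.right_iff _ _).2 ?_, (cT.up_iff _ _).2 ?_⟩
      · simp only
        rw [hψ _ _ (hR _ _), hψ _ _ (hR _ _), add_right_comm i 1 j]
        exact (hg _ (eS _).2 _ (hR _ _)).1.2 _ (hR _ _)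
      · simp only
        rw [hψ _ _ (hR _ _), hψ _ _ (hR _ _), ← add_assoc]
        exact (hg _ (eS _).2 _ (hR _ _)).2 _ (hU _ _) _ (hR _ _)
    · refine Subtype.ext (funext fun ⟨i, j⟩ => ?_)
      simp only [η, sub_add_cancel]
      exact hφψ _ _ (hR _ _)
  have : CompactSpace T.wangShift :=
    isCompact_iff_compactSpace.1 T.isSubshift.1.isCompact
  refine ⟨η, ⟨isHomeomorph_iff_continuous_bijective.2 ⟨hcont, hinj, hsurj⟩,
    fun k x x' hx => funext fun q => ?_⟩, φ, fun y p => ?_⟩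
  · simp only [η, hx, shift, matAct, shearMatrix]
    refine congrArg φ (congrArg x.1 (Prod.ext ?_ ?_)) <;> simp
    ring
  · simp [η, matAct, shearMatrix]

/-! ## The sets of tiles -/

def tileList0 : List (WangTile (Fin 4) (Fin 5)) := [
  ⟨2, 4, 2, 1⟩, ⟨2, 2, 2, 0⟩, ⟨1, 1, 3, 1⟩, ⟨1, 2, 3, 2⟩, ⟨3, 1, 3, 3⟩, ⟨0, 1, 3, 1⟩,
  ⟨0, 0, 0, 1⟩, ⟨3, 1, 0, 2⟩, ⟨0, 2, 1, 2⟩, ⟨1, 2, 1, 4⟩, ⟨3, 3, 1, 2⟩]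

def tileList1 : List (WangTile (Fin 6) (Fin 4)) := [
  ⟨1, 1, 2, 1⟩, ⟨1, 2, 2, 2⟩, ⟨2, 1, 2, 3⟩, ⟨0, 1, 2, 1⟩, ⟨0, 0, 0, 1⟩, ⟨2, 1, 0, 2⟩,
  ⟨0, 2, 1, 2⟩, ⟨2, 3, 1, 2⟩, ⟨4, 2, 4, 1⟩, ⟨4, 2, 5, 0⟩, ⟨5, 1, 3, 0⟩, ⟨3, 2, 4, 0⟩, ⟨5, 3, 4, 0⟩]

def tiles1 : WangTileSet where
  I := Fin 6
  J := Fin 4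
  finite_I := inferInstance
  finite_J := inferInstance
  tiles := tileList1.toFinset

def tileList2 : List (WangTile (Fin 10) (Fin 4)) := [
  ⟨1, 1, 2, 1⟩, ⟨1, 2, 2, 2⟩, ⟨2, 1, 2, 3⟩, ⟨0, 1, 2, 1⟩, ⟨0, 0, 0, 1⟩, ⟨2, 1, 0, 2⟩,
  ⟨0, 2, 1, 2⟩, ⟨2, 3, 1, 2⟩, ⟨5, 2, 6, 1⟩, ⟨6, 1, 4, 1⟩, ⟨4, 2, 5, 1⟩, ⟨6, 3, 5, 1⟩,
  ⟨5, 2, 9, 0⟩, ⟨6, 1, 7, 0⟩, ⟨4, 2, 8, 0⟩, ⟨8, 1, 3, 0⟩, ⟨7, 1, 3, 0⟩, ⟨3, 1, 4, 0⟩,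
  ⟨3, 3, 5, 0⟩, ⟨9, 1, 6, 0⟩]

def tiles2 : WangTileSet where
  I := Fin 10
  J := Fin 4
  finite_I := inferInstance
  finite_J := inferInstance
  tiles := tileList2.toFinset

def tileList3 : List (WangTile (Fin 15) (Fin 4)) := [
  ⟨1, 1, 1, 3⟩, ⟨0, 1, 1, 1⟩, ⟨0, 0, 0, 1⟩, ⟨1, 1, 0, 2⟩, ⟨6, 2, 10, 1⟩, ⟨7, 1, 8, 1⟩,
  ⟨5, 2, 9, 1⟩, ⟨9, 1, 4, 1⟩, ⟨8, 1, 4, 1⟩, ⟨4, 1, 5, 1⟩, ⟨4, 3, 6, 1⟩, ⟨10, 1, 7, 1⟩,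
  ⟨7, 1, 13, 0⟩, ⟨5, 2, 14, 0⟩, ⟨8, 0, 11, 0⟩, ⟨4, 1, 12, 0⟩, ⟨12, 1, 3, 0⟩, ⟨11, 1, 3, 0⟩,
  ⟨11, 0, 2, 0⟩, ⟨2, 1, 4, 0⟩, ⟨3, 1, 7, 0⟩, ⟨14, 1, 10, 0⟩, ⟨13, 1, 10, 0⟩, ⟨13, 0, 8, 0⟩]

def tiles3 : WangTileSet where
  I := Fin 15
  J := Fin 4
  finite_I := inferInstance
  finite_J := inferInstance
  tiles := tileList3.toFinset

def tileList4 : List (WangTile (Fin 21) (Fin 2)) := [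
  ⟨3, 1, 4, 1⟩, ⟨4, 1, 2, 1⟩, ⟨5, 1, 3, 1⟩, ⟨3, 1, 8, 0⟩, ⟨4, 0, 6, 0⟩, ⟨2, 1, 7, 0⟩,
  ⟨7, 1, 1, 0⟩, ⟨6, 1, 1, 0⟩, ⟨6, 0, 0, 0⟩, ⟨0, 1, 2, 0⟩, ⟨1, 1, 3, 0⟩, ⟨8, 1, 5, 0⟩,
  ⟨8, 0, 4, 0⟩, ⟨13, 1, 17, 1⟩, ⟨14, 0, 15, 1⟩, ⟨12, 1, 16, 1⟩, ⟨16, 1, 11, 1⟩, ⟨16, 0, 10, 1⟩,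
  ⟨15, 1, 11, 1⟩, ⟨15, 0, 10, 1⟩, ⟨10, 1, 12, 1⟩, ⟨11, 1, 13, 1⟩, ⟨17, 0, 14, 1⟩, ⟨14, 0, 19, 0⟩,
  ⟨12, 1, 20, 0⟩, ⟨10, 0, 18, 0⟩, ⟨18, 0, 9, 0⟩, ⟨9, 0, 14, 0⟩, ⟨20, 0, 17, 0⟩, ⟨19, 0, 17, 0⟩]

def tiles4 : WangTileSet where
  I := Fin 21
  J := Fin 2
  finite_I := inferInstance
  finite_J := inferInstance
  tiles := tileList4.toFinset

def tileList5 : List (WangTile (Fin 20) (Fin 4)) := [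
  ⟨3, 3, 4, 2⟩, ⟨4, 2, 2, 3⟩, ⟨5, 2, 3, 3⟩, ⟨3, 3, 8, 1⟩, ⟨4, 0, 6, 1⟩, ⟨2, 3, 7, 1⟩,
  ⟨7, 3, 1, 0⟩, ⟨6, 3, 1, 0⟩, ⟨6, 1, 0, 0⟩, ⟨0, 2, 2, 1⟩, ⟨1, 2, 3, 1⟩, ⟨8, 3, 5, 0⟩,
  ⟨8, 1, 4, 0⟩, ⟨13, 3, 17, 2⟩, ⟨14, 0, 15, 2⟩, ⟨12, 3, 16, 2⟩, ⟨16, 3, 11, 3⟩, ⟨16, 1, 10, 3⟩,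
  ⟨15, 3, 11, 3⟩, ⟨15, 1, 10, 3⟩, ⟨10, 2, 12, 3⟩, ⟨11, 2, 13, 3⟩, ⟨17, 1, 14, 3⟩, ⟨14, 0, 19, 1⟩,
  ⟨10, 0, 18, 1⟩, ⟨18, 1, 9, 0⟩, ⟨9, 1, 14, 1⟩, ⟨19, 1, 17, 0⟩]

def tiles5 : WangTileSet where
  I := Fin 20
  J := Fin 4
  finite_I := inferInstance
  finite_J := inferInstance
  tiles := tileList5.toFinset

def tileList6 : List (WangTile (Fin 22) (Fin 4)) := [
  ⟨3, 2, 5, 2⟩, ⟨5, 3, 2, 3⟩, ⟨6, 3, 3, 3⟩, ⟨3, 2, 9, 1⟩, ⟨4, 1, 7, 1⟩, ⟨2, 2, 8, 1⟩,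
  ⟨8, 3, 1, 0⟩, ⟨7, 0, 1, 0⟩, ⟨7, 0, 0, 0⟩, ⟨0, 1, 2, 1⟩, ⟨1, 3, 3, 1⟩, ⟨9, 3, 6, 0⟩,
  ⟨9, 3, 4, 0⟩, ⟨14, 2, 19, 2⟩, ⟨15, 1, 16, 2⟩, ⟨13, 2, 17, 2⟩, ⟨17, 3, 12, 3⟩, ⟨17, 3, 11, 3⟩,
  ⟨16, 0, 12, 3⟩, ⟨16, 0, 11, 3⟩, ⟨11, 1, 13, 3⟩, ⟨12, 3, 14, 3⟩, ⟨18, 1, 15, 3⟩, ⟨19, 3, 15, 3⟩,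
  ⟨15, 1, 21, 1⟩, ⟨11, 1, 20, 1⟩, ⟨20, 0, 10, 0⟩, ⟨10, 1, 15, 1⟩, ⟨21, 0, 18, 0⟩]

def tiles6 : WangTileSet where
  I := Fin 22
  J := Fin 4
  finite_I := inferInstance
  finite_J := inferInstance
  tiles := tileList6.toFinset

def tileList7 : List (WangTile (Fin 13) (Fin 4)) := [
  ⟨5, 1, 3, 1⟩, ⟨0, 0, 2, 0⟩, ⟨1, 1, 3, 0⟩, ⟨7, 0, 9, 1⟩, ⟨8, 1, 10, 1⟩, ⟨12, 0, 11, 1⟩,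
  ⟨6, 0, 11, 0⟩, ⟨3, 3, 2, 3⟩, ⟨2, 3, 1, 2⟩, ⟨4, 2, 1, 2⟩, ⟨4, 2, 0, 2⟩, ⟨3, 3, 5, 2⟩,
  ⟨3, 3, 4, 2⟩, ⟨9, 3, 8, 3⟩, ⟨9, 3, 7, 3⟩, ⟨11, 2, 8, 3⟩, ⟨11, 2, 7, 3⟩, ⟨10, 3, 11, 3⟩,
  ⟨7, 2, 6, 2⟩, ⟨11, 2, 12, 2⟩]

def tiles7 : WangTileSet where
  I := Fin 13
  J := Fin 4
  finite_I := inferInstance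
  finite_J := inferInstance
  tiles := tileList7.toFinset

def tileList8 : List (WangTile (Fin 10) (Fin 5)) := [
  ⟨2, 1, 1, 0⟩, ⟨3, 0, 1, 0⟩, ⟨3, 0, 0, 0⟩, ⟨8, 0, 7, 1⟩, ⟨8, 0, 6, 1⟩, ⟨6, 0, 5, 0⟩,
  ⟨8, 0, 9, 0⟩, ⟨4, 4, 2, 4⟩, ⟨1, 4, 2, 3⟩, ⟨0, 3, 1, 2⟩, ⟨1, 4, 4, 2⟩, ⟨1, 4, 3, 2⟩,
  ⟨6, 3, 7, 4⟩, ⟨6, 3, 6, 4⟩, ⟨9, 2, 7, 4⟩, ⟨5, 2, 7, 3⟩, ⟨9, 2, 6, 4⟩, ⟨5, 2, 6, 3⟩,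
  ⟨7, 4, 8, 4⟩, ⟨5, 2, 9, 2⟩]

def tiles8 : WangTileSet where
  I := Fin 10
  J := Fin 5
  finite_I := inferInstance
  finite_J := inferInstance
  tiles := tileList8.toFinset

def tileList9 : List (WangTile (Fin 8) (Fin 7)) := [
  ⟨3, 2, 1, 2⟩, ⟨0, 2, 1, 1⟩, ⟨0, 2, 2, 0⟩, ⟨4, 1, 4, 2⟩, ⟨7, 0, 4, 2⟩, ⟨5, 2, 6, 2⟩,
  ⟨1, 6, 1, 4⟩, ⟨2, 4, 0, 3⟩, ⟨1, 6, 3, 3⟩, ⟨2, 5, 3, 3⟩, ⟨1, 6, 2, 3⟩, ⟨2, 5, 2, 3⟩,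
  ⟨6, 4, 5, 6⟩, ⟨6, 4, 4, 6⟩, ⟨6, 3, 5, 5⟩, ⟨4, 3, 5, 4⟩, ⟨6, 3, 4, 5⟩, ⟨4, 3, 4, 4⟩,
  ⟨6, 5, 6, 6⟩, ⟨4, 3, 7, 3⟩]

def tiles9 : WangTileSet where
  I := Fin 8
  J := Fin 7
  finite_I := inferInstance
  finite_J := inferInstance
  tiles := tileList9.toFinset

def tileList10 : List (WangTile (Fin 9) (Fin 5)) := [
  ⟨1, 0, 2, 0⟩, ⟨2, 2, 1, 4⟩, ⟨2, 2, 0, 4⟩, ⟨2, 1, 1, 3⟩, ⟨0, 1, 1, 2⟩, ⟨2, 3, 2, 4⟩,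
  ⟨3, 0, 4, 0⟩, ⟨8, 0, 5, 0⟩, ⟨6, 0, 7, 0⟩, ⟨7, 4, 4, 4⟩, ⟨7, 4, 6, 3⟩, ⟨4, 4, 6, 2⟩,
  ⟨5, 3, 6, 2⟩, ⟨7, 4, 5, 3⟩, ⟨5, 2, 3, 2⟩, ⟨4, 4, 5, 2⟩, ⟨5, 3, 5, 2⟩, ⟨5, 2, 8, 1⟩]

def tiles10 : WangTileSet where
  I := Fin 9
  J := Fin 5
  finite_I := inferInstance
  finite_J := inferInstance
  tiles := tileList10.toFinset

def tileList11 : List (WangTile (Fin 13) (Fin 5)) := [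
  ⟨0, 0, 1, 0⟩, ⟨5, 0, 2, 0⟩, ⟨3, 0, 4, 0⟩, ⟨2, 3, 3, 2⟩, ⟨4, 4, 2, 3⟩, ⟨2, 2, 0, 2⟩,
  ⟨1, 4, 2, 2⟩, ⟨2, 3, 2, 2⟩, ⟨2, 2, 5, 1⟩, ⟨6, 0, 7, 0⟩, ⟨12, 0, 9, 0⟩, ⟨10, 0, 11, 0⟩,
  ⟨11, 3, 7, 4⟩, ⟨11, 2, 10, 3⟩, ⟨7, 2, 10, 2⟩, ⟨9, 1, 10, 2⟩, ⟨11, 2, 8, 3⟩, ⟨11, 3, 9, 3⟩,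
  ⟨8, 1, 6, 2⟩, ⟨7, 2, 8, 2⟩, ⟨8, 1, 12, 1⟩]

def tiles11 : WangTileSet where
  I := Fin 13
  J := Fin 5
  finite_I := inferInstance
  finite_J := inferInstance
  tiles := tileList11.toFinset

def tileList12 : List (WangTile UVertical UHorizontal) := [
  ⟨.F, .O, .J, .O⟩, ⟨.F, .O, .H, .L⟩, ⟨.J, .M, .F, .P⟩, ⟨.D, .M, .F, .K⟩, ⟨.H, .P, .J, .P⟩,
  ⟨.H, .P, .H, .N⟩, ⟨.H, .K, .F, .P⟩, ⟨.H, .K, .D, .P⟩, ⟨.B, .O, .I, .O⟩, ⟨.G, .L, .E, .O⟩,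
  ⟨.G, .L, .C, .L⟩, ⟨.A, .L, .I, .O⟩, ⟨.E, .P, .G, .P⟩, ⟨.E, .P, .I, .P⟩, ⟨.I, .P, .G, .K⟩,
  ⟨.I, .P, .I, .K⟩, ⟨.I, .K, .B, .M⟩, ⟨.I, .K, .A, .K⟩, ⟨.C, .N, .I, .P⟩]

/-! ## Neighbour tables -/

/-- The neighbours in `jeandelRaoTiles`. -/
def adjacency0 : Adjacency where
  rightTable := [
    [0, 1], [0, 1], [8, 9, 10], [8, 9, 10], [2, 3, 4, 5], [6, 7], [6, 7], [2, 3, 4, 5], [6, 7],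
    [8, 9, 10], [2, 3, 4, 5]]
  leftTable := [
    [0, 1], [0, 1], [4, 7, 10], [4, 7, 10], [4, 7, 10], [4, 7, 10], [5, 6, 8], [5, 6, 8],
    [2, 3, 9], [2, 3, 9], [2, 3, 9]]
  upTable := [
    [9], [3, 7, 8, 10], [0, 2, 5, 6], [3, 7, 8, 10], [0, 2, 5, 6], [0, 2, 5, 6], [1],
    [0, 2, 5, 6], [3, 7, 8, 10], [3, 7, 8, 10], [4]]
  downTable := [
    [2, 4, 5, 7], [6], [2, 4, 5, 7], [1, 3, 8, 9], [10], [2, 4, 5, 7], [2, 4, 5, 7], [1, 3, 8, 9],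
    [1, 3, 8, 9], [0], [1, 3, 8, 9]]

/-- The neighbours in `tiles1`. -/
def adjacency1 : Adjacency where
  rightTable := [
    [6, 7], [6, 7], [0, 1, 2, 3], [4, 5], [4, 5], [0, 1, 2, 3], [4, 5], [0, 1, 2, 3], [8, 11, 12],
    [8, 11, 12], [9], [10], [9]]
  leftTable := [
    [2, 5, 7], [2, 5, 7], [2, 5, 7], [2, 5, 7], [3, 4, 6], [3, 4, 6], [0, 1], [0, 1], [8, 9],
    [10, 12], [11], [8, 9], [8, 9]]
  upTable := [
    [0, 3, 4, 8], [1, 5, 6, 7], [0, 3, 4, 8], [0, 3, 4, 8], [9, 10, 11, 12], [0, 3, 4, 8],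
    [1, 5, 6, 7], [2], [1, 5, 6, 7], [1, 5, 6, 7], [0, 3, 4, 8], [1, 5, 6, 7], [2]]
  downTable := [
    [0, 2, 3, 5, 10], [1, 6, 8, 9, 11], [7, 12], [0, 2, 3, 5, 10], [0, 2, 3, 5, 10],
    [1, 6, 8, 9, 11], [1, 6, 8, 9, 11], [1, 6, 8, 9, 11], [0, 2, 3, 5, 10], [4], [4], [4], [4]]

/-- Neighbours in configurations of `tiles1`, refined 1 time. -/
def adjacency1_1 : Adjacency where
  rightTable := [
    [6], [6, 7], [0, 1, 3], [4, 5], [4, 5], [0, 1, 2, 3], [5], [0, 1, 2, 3], [8, 11, 12],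
    [8, 11, 12], [9], [10], [9]]
  leftTable := [
    [2, 5, 7], [2, 5, 7], [5, 7], [2, 5, 7], [3, 4], [3, 4, 6], [0, 1], [1], [8, 9], [10, 12],
    [11], [8, 9], [8, 9]]
  upTable := [
    [0, 3, 4], [1, 5, 6], [0, 3, 4, 8], [3, 4, 8], [9, 10, 11, 12], [0, 3, 4, 8], [5, 7], [2],
    [1, 5, 6, 7], [1, 5, 6], [0, 3], [5, 7], [2]]
  downTable := [
    [0, 2, 5, 10], [1, 8, 9], [7, 12], [0, 2, 3, 5, 10], [0, 2, 3, 5], [1, 6, 8, 9, 11],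
    [1, 8, 9], [6, 8, 11], [2, 3, 5], [4], [4], [4], [4]]

/-- The neighbours in `tiles2`. -/
def adjacency2 : Adjacency where
  rightTable := [
    [6, 7], [6, 7], [0, 1, 2, 3], [4, 5], [4, 5], [0, 1, 2, 3], [4, 5], [0, 1, 2, 3],
    [10, 11, 18], [8, 19], [9, 17], [8, 19], [10, 11, 18], [8, 19], [9, 17], [14], [13], [15, 16],
    [15, 16], [12]]
  leftTable := [
    [2, 5, 7], [2, 5, 7], [2, 5, 7], [2, 5, 7], [3, 4, 6], [3, 4, 6], [0, 1], [0, 1], [9, 11, 13],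
    [10, 14], [8, 12], [8, 12], [19], [16], [15], [17, 18], [17, 18], [10, 14], [8, 12],
    [9, 11, 13]]
  upTable := [
    [0, 3, 4, 8, 9, 10, 11], [1, 5, 6, 7], [0, 3, 4, 8, 9, 10, 11], [0, 3, 4, 8, 9, 10, 11],
    [12, 13, 14, 15, 16, 17, 18, 19], [0, 3, 4, 8, 9, 10, 11], [1, 5, 6, 7], [2], [1, 5, 6, 7],
    [0, 3, 4, 8, 9, 10, 11], [1, 5, 6, 7], [2], [1, 5, 6, 7], [0, 3, 4, 8, 9, 10, 11],
    [1, 5, 6, 7], [0, 3, 4, 8, 9, 10, 11], [0, 3, 4, 8, 9, 10, 11], [0, 3, 4, 8, 9, 10, 11], [2],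
    [0, 3, 4, 8, 9, 10, 11]]
  downTable := [
    [0, 2, 3, 5, 9, 13, 15, 16, 17, 19], [1, 6, 8, 10, 12, 14], [7, 11, 18],
    [0, 2, 3, 5, 9, 13, 15, 16, 17, 19], [0, 2, 3, 5, 9, 13, 15, 16, 17, 19],
    [1, 6, 8, 10, 12, 14], [1, 6, 8, 10, 12, 14], [1, 6, 8, 10, 12, 14],
    [0, 2, 3, 5, 9, 13, 15, 16, 17, 19], [0, 2, 3, 5, 9, 13, 15, 16, 17, 19],
    [0, 2, 3, 5, 9, 13, 15, 16, 17, 19], [0, 2, 3, 5, 9, 13, 15, 16, 17, 19], [4], [4], [4], [4],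
    [4], [4], [4], [4]]

/-- Neighbours in configurations of `tiles2`, refined 1 time. -/
def adjacency2_1 : Adjacency where
  rightTable := [
    [6], [6, 7], [0, 1, 3], [4, 5], [4, 5], [0, 1, 2, 3], [5], [0, 1, 2, 3], [10, 11, 18],
    [8, 19], [9, 17], [8, 19], [10, 11, 18], [8, 19], [9, 17], [14], [13], [15, 16], [15, 16],
    [12]]
  leftTable := [
    [2, 5, 7], [2, 5, 7], [5, 7], [2, 5, 7], [3, 4], [3, 4, 6], [0, 1], [1], [9, 11, 13],
    [10, 14], [8, 12], [8, 12], [19], [16], [15], [17, 18], [17, 18], [10, 14], [8, 12],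
    [9, 11, 13]]
  upTable := [
    [0, 3, 4], [5, 6], [0, 3, 4, 8, 9, 10, 11], [3, 4, 8, 9, 10, 11],
    [12, 13, 14, 15, 16, 17, 18, 19], [3, 4, 8, 9, 10, 11], [5, 7], [2], [1, 5, 6], [0, 3],
    [5, 7], [2], [5, 6], [4, 8, 9, 10, 11], [5], [0, 3, 4], [3, 4, 8, 9, 10, 11], [3], [2],
    [0, 3, 4]]
  downTable := [
    [0, 2, 9, 15, 19], [8], [7, 11, 18], [0, 2, 3, 5, 9, 15, 16, 17, 19],
    [0, 2, 3, 5, 13, 15, 16, 19], [1, 6, 8, 10, 12, 14], [1, 8, 12], [6, 10], [2, 3, 5, 13, 16],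
    [2, 3, 5, 13, 16], [2, 3, 5, 13, 16], [2, 3, 5, 13, 16], [4], [4], [4], [4], [4], [4], [4],
    [4]]

/-- Neighbours in configurations of `tiles2`, refined 2 times. -/
def adjacency2_2 : Adjacency where
  rightTable := [
    [6], [7], [0, 1, 3], [4, 5], [4, 5], [0, 2, 3], [5], [0, 3], [10, 11, 18], [8, 19], [9, 17],
    [8, 19], [10, 11, 18], [8, 19], [9, 17], [14], [13], [15, 16], [15, 16], [12]]
  leftTable := [
    [2, 5, 7], [2], [5], [2, 5, 7], [3, 4], [3, 4, 6], [0], [1], [9, 11, 13], [10, 14], [8, 12],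
    [8, 12], [19], [16], [15], [17, 18], [17, 18], [10, 14], [8, 12], [9, 11, 13]]
  upTable := [
    [3, 4], [5], [4, 8, 9, 10, 11], [3, 4, 8, 9, 10, 11], [12, 13, 14, 15, 16, 17, 18, 19],
    [3, 4, 8, 9, 10, 11], [5], [2], [1, 5, 6], [0, 3], [5, 7], [2], [5, 6], [4], [5], [3], [3, 4],
    [3], [2], [0, 3, 4]]
  downTable := [
    [9, 19], [8], [7, 11, 18], [0, 3, 5, 9, 15, 16, 17, 19], [0, 2, 3, 5, 13, 16, 19],
    [1, 6, 8, 10, 12, 14], [8, 12], [10], [2, 3, 5], [2, 3, 5], [2, 3, 5], [2, 3, 5], [4], [4],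
    [4], [4], [4], [4], [4], [4]]

/-- The neighbours in `tiles3`. -/
def adjacency3 : Adjacency where
  rightTable := [
    [0, 1], [2, 3], [2, 3], [0, 1], [10], [11, 20], [9], [6], [5, 23], [7, 8, 19], [7, 8, 19],
    [4, 21, 22], [11, 20], [9], [5, 23], [7, 8, 19], [15], [14], [14], [18], [16, 17], [13], [12],
    [12]]
  leftTable := [
    [0, 3], [0, 3], [1, 2], [1, 2], [11], [8, 14], [7], [9, 10, 15], [9, 10, 15], [6, 13], [4],
    [5, 12], [22, 23], [21], [17, 18], [16], [20], [20], [19], [9, 10, 15], [5, 12], [11], [11],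
    [8, 14]]
  upTable := [
    [1, 2, 4, 5, 6, 7, 8, 9, 10, 11], [1, 2, 4, 5, 6, 7, 8, 9, 10, 11],
    [12, 13, 14, 15, 16, 17, 18, 19, 20, 21, 22, 23], [1, 2, 4, 5, 6, 7, 8, 9, 10, 11], [3],
    [1, 2, 4, 5, 6, 7, 8, 9, 10, 11], [3], [1, 2, 4, 5, 6, 7, 8, 9, 10, 11],
    [1, 2, 4, 5, 6, 7, 8, 9, 10, 11], [1, 2, 4, 5, 6, 7, 8, 9, 10, 11], [0],
    [1, 2, 4, 5, 6, 7, 8, 9, 10, 11], [1, 2, 4, 5, 6, 7, 8, 9, 10, 11], [3],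
    [12, 13, 14, 15, 16, 17, 18, 19, 20, 21, 22, 23], [1, 2, 4, 5, 6, 7, 8, 9, 10, 11],
    [1, 2, 4, 5, 6, 7, 8, 9, 10, 11], [1, 2, 4, 5, 6, 7, 8, 9, 10, 11],
    [12, 13, 14, 15, 16, 17, 18, 19, 20, 21, 22, 23], [1, 2, 4, 5, 6, 7, 8, 9, 10, 11],
    [1, 2, 4, 5, 6, 7, 8, 9, 10, 11], [1, 2, 4, 5, 6, 7, 8, 9, 10, 11],
    [1, 2, 4, 5, 6, 7, 8, 9, 10, 11], [12, 13, 14, 15, 16, 17, 18, 19, 20, 21, 22, 23]]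
  downTable := [
    [10], [0, 1, 3, 5, 7, 8, 9, 11, 12, 15, 16, 17, 19, 20, 21, 22],
    [0, 1, 3, 5, 7, 8, 9, 11, 12, 15, 16, 17, 19, 20, 21, 22], [4, 6, 13],
    [0, 1, 3, 5, 7, 8, 9, 11, 12, 15, 16, 17, 19, 20, 21, 22],
    [0, 1, 3, 5, 7, 8, 9, 11, 12, 15, 16, 17, 19, 20, 21, 22],
    [0, 1, 3, 5, 7, 8, 9, 11, 12, 15, 16, 17, 19, 20, 21, 22],
    [0, 1, 3, 5, 7, 8, 9, 11, 12, 15, 16, 17, 19, 20, 21, 22],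
    [0, 1, 3, 5, 7, 8, 9, 11, 12, 15, 16, 17, 19, 20, 21, 22],
    [0, 1, 3, 5, 7, 8, 9, 11, 12, 15, 16, 17, 19, 20, 21, 22],
    [0, 1, 3, 5, 7, 8, 9, 11, 12, 15, 16, 17, 19, 20, 21, 22],
    [0, 1, 3, 5, 7, 8, 9, 11, 12, 15, 16, 17, 19, 20, 21, 22], [2, 14, 18, 23], [2, 14, 18, 23],
    [2, 14, 18, 23], [2, 14, 18, 23], [2, 14, 18, 23], [2, 14, 18, 23], [2, 14, 18, 23],
    [2, 14, 18, 23], [2, 14, 18, 23], [2, 14, 18, 23], [2, 14, 18, 23], [2, 14, 18, 23]]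

/-- Neighbours in configurations of `tiles3`, refined 1 time. -/
def adjacency3_1 : Adjacency where
  rightTable := [
    [1], [2, 3], [2, 3], [0, 1], [10], [11, 20], [9], [6], [5, 23], [7, 8, 19], [7, 8, 19],
    [4, 21, 22], [11, 20], [9], [5, 23], [7, 8, 19], [15], [14], [14], [18], [16, 17], [13], [12],
    [12]]
  leftTable := [
    [3], [0, 3], [1, 2], [1, 2], [11], [8, 14], [7], [9, 10, 15], [9, 10, 15], [6, 13], [4],
    [5, 12], [22, 23], [21], [17, 18], [16], [20], [20], [19], [9, 10, 15], [5, 12], [11], [11],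
    [8, 14]]
  upTable := [
    [4, 5, 6, 7, 8, 11], [4, 5, 6, 7, 8, 9, 10, 11],
    [12, 13, 14, 15, 16, 17, 18, 19, 20, 21, 22, 23], [4, 5, 6, 7, 8, 9, 10, 11], [3],
    [2, 4, 5, 6, 7, 8, 9, 10, 11], [3], [1, 2], [1, 2, 4, 5, 6, 7, 8, 9, 10, 11], [1], [0],
    [2, 4, 5, 6, 7, 8, 9, 10, 11], [2, 4, 5, 6, 7, 8, 9, 10, 11], [3], [12, 13, 16, 21, 22],
    [2, 4, 5, 6, 7, 8, 9, 10, 11], [2, 4, 5, 6, 7, 8, 9, 10, 11], [11], [20, 21, 22], [5, 11],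
    [2, 4, 5, 6, 7, 8, 9, 10, 11], [2], [2, 4, 5, 6, 7, 8, 9, 10, 11], [12, 13, 15]]
  downTable := [
    [10], [7, 8, 9], [5, 7, 8, 11, 12, 15, 16, 20, 21, 22], [4, 6, 13],
    [0, 1, 3, 5, 8, 11, 12, 15, 16, 20, 22], [0, 1, 3, 5, 8, 11, 12, 15, 16, 19, 20, 22],
    [0, 1, 3, 5, 8, 11, 12, 15, 16, 20, 22], [0, 1, 3, 5, 8, 11, 12, 15, 16, 20, 22],
    [0, 1, 3, 5, 8, 11, 12, 15, 16, 20, 22], [1, 3, 5, 8, 11, 12, 15, 16, 20, 22],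
    [1, 3, 5, 8, 11, 12, 15, 16, 20, 22], [0, 1, 3, 5, 8, 11, 12, 15, 16, 17, 19, 20, 22],
    [2, 14, 23], [2, 14, 23], [2], [2, 23], [2, 14], [2], [2], [2], [2, 18], [2, 14, 18],
    [2, 14, 18], [2]]

/-- The neighbours in `tiles4`. -/
def adjacency4 : Adjacency where
  rightTable := [
    [2, 10], [0, 12], [11], [2, 10], [0, 12], [1, 9], [5], [4], [4], [8], [6, 7], [3], [3], [21],
    [22, 27], [20], [15], [15], [14], [14], [17, 19], [16, 18], [13, 28, 29], [22, 27], [20],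
    [17, 19], [25], [26], [24], [23]]
  leftTable := [
    [1, 4], [5], [0, 3], [11, 12], [7, 8], [6], [10], [10], [9], [5], [0, 3], [2], [1, 4], [22],
    [18, 19], [16, 17], [21], [20, 25], [21], [20, 25], [15, 24], [13], [14, 23], [29], [28],
    [26], [27], [14, 23], [22], [22]]
  upTable := [
    [0, 1, 2, 13, 14, 15, 16, 17, 18, 19, 20, 21, 22],
    [0, 1, 2, 13, 14, 15, 16, 17, 18, 19, 20, 21, 22],
    [0, 1, 2, 13, 14, 15, 16, 17, 18, 19, 20, 21, 22],
    [0, 1, 2, 13, 14, 15, 16, 17, 18, 19, 20, 21, 22],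
    [3, 4, 5, 6, 7, 8, 9, 10, 11, 12, 23, 24, 25, 26, 27, 28, 29],
    [0, 1, 2, 13, 14, 15, 16, 17, 18, 19, 20, 21, 22],
    [0, 1, 2, 13, 14, 15, 16, 17, 18, 19, 20, 21, 22],
    [0, 1, 2, 13, 14, 15, 16, 17, 18, 19, 20, 21, 22],
    [3, 4, 5, 6, 7, 8, 9, 10, 11, 12, 23, 24, 25, 26, 27, 28, 29],
    [0, 1, 2, 13, 14, 15, 16, 17, 18, 19, 20, 21, 22],
    [0, 1, 2, 13, 14, 15, 16, 17, 18, 19, 20, 21, 22],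
    [0, 1, 2, 13, 14, 15, 16, 17, 18, 19, 20, 21, 22],
    [3, 4, 5, 6, 7, 8, 9, 10, 11, 12, 23, 24, 25, 26, 27, 28, 29],
    [0, 1, 2, 13, 14, 15, 16, 17, 18, 19, 20, 21, 22],
    [3, 4, 5, 6, 7, 8, 9, 10, 11, 12, 23, 24, 25, 26, 27, 28, 29],
    [0, 1, 2, 13, 14, 15, 16, 17, 18, 19, 20, 21, 22],
    [0, 1, 2, 13, 14, 15, 16, 17, 18, 19, 20, 21, 22],
    [3, 4, 5, 6, 7, 8, 9, 10, 11, 12, 23, 24, 25, 26, 27, 28, 29],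
    [0, 1, 2, 13, 14, 15, 16, 17, 18, 19, 20, 21, 22],
    [3, 4, 5, 6, 7, 8, 9, 10, 11, 12, 23, 24, 25, 26, 27, 28, 29],
    [0, 1, 2, 13, 14, 15, 16, 17, 18, 19, 20, 21, 22],
    [0, 1, 2, 13, 14, 15, 16, 17, 18, 19, 20, 21, 22],
    [3, 4, 5, 6, 7, 8, 9, 10, 11, 12, 23, 24, 25, 26, 27, 28, 29],
    [3, 4, 5, 6, 7, 8, 9, 10, 11, 12, 23, 24, 25, 26, 27, 28, 29],
    [0, 1, 2, 13, 14, 15, 16, 17, 18, 19, 20, 21, 22],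
    [3, 4, 5, 6, 7, 8, 9, 10, 11, 12, 23, 24, 25, 26, 27, 28, 29],
    [3, 4, 5, 6, 7, 8, 9, 10, 11, 12, 23, 24, 25, 26, 27, 28, 29],
    [3, 4, 5, 6, 7, 8, 9, 10, 11, 12, 23, 24, 25, 26, 27, 28, 29],
    [3, 4, 5, 6, 7, 8, 9, 10, 11, 12, 23, 24, 25, 26, 27, 28, 29],
    [3, 4, 5, 6, 7, 8, 9, 10, 11, 12, 23, 24, 25, 26, 27, 28, 29]]
  downTable := [
    [0, 1, 2, 3, 5, 6, 7, 9, 10, 11, 13, 15, 16, 18, 20, 21, 24],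
    [0, 1, 2, 3, 5, 6, 7, 9, 10, 11, 13, 15, 16, 18, 20, 21, 24],
    [0, 1, 2, 3, 5, 6, 7, 9, 10, 11, 13, 15, 16, 18, 20, 21, 24],
    [4, 8, 12, 14, 17, 19, 22, 23, 25, 26, 27, 28, 29],
    [4, 8, 12, 14, 17, 19, 22, 23, 25, 26, 27, 28, 29],
    [4, 8, 12, 14, 17, 19, 22, 23, 25, 26, 27, 28, 29],
    [4, 8, 12, 14, 17, 19, 22, 23, 25, 26, 27, 28, 29],
    [4, 8, 12, 14, 17, 19, 22, 23, 25, 26, 27, 28, 29],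
    [4, 8, 12, 14, 17, 19, 22, 23, 25, 26, 27, 28, 29],
    [4, 8, 12, 14, 17, 19, 22, 23, 25, 26, 27, 28, 29],
    [4, 8, 12, 14, 17, 19, 22, 23, 25, 26, 27, 28, 29],
    [4, 8, 12, 14, 17, 19, 22, 23, 25, 26, 27, 28, 29],
    [4, 8, 12, 14, 17, 19, 22, 23, 25, 26, 27, 28, 29],
    [0, 1, 2, 3, 5, 6, 7, 9, 10, 11, 13, 15, 16, 18, 20, 21, 24],
    [0, 1, 2, 3, 5, 6, 7, 9, 10, 11, 13, 15, 16, 18, 20, 21, 24],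
    [0, 1, 2, 3, 5, 6, 7, 9, 10, 11, 13, 15, 16, 18, 20, 21, 24],
    [0, 1, 2, 3, 5, 6, 7, 9, 10, 11, 13, 15, 16, 18, 20, 21, 24],
    [0, 1, 2, 3, 5, 6, 7, 9, 10, 11, 13, 15, 16, 18, 20, 21, 24],
    [0, 1, 2, 3, 5, 6, 7, 9, 10, 11, 13, 15, 16, 18, 20, 21, 24],
    [0, 1, 2, 3, 5, 6, 7, 9, 10, 11, 13, 15, 16, 18, 20, 21, 24],
    [0, 1, 2, 3, 5, 6, 7, 9, 10, 11, 13, 15, 16, 18, 20, 21, 24],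
    [0, 1, 2, 3, 5, 6, 7, 9, 10, 11, 13, 15, 16, 18, 20, 21, 24],
    [0, 1, 2, 3, 5, 6, 7, 9, 10, 11, 13, 15, 16, 18, 20, 21, 24],
    [4, 8, 12, 14, 17, 19, 22, 23, 25, 26, 27, 28, 29],
    [4, 8, 12, 14, 17, 19, 22, 23, 25, 26, 27, 28, 29],
    [4, 8, 12, 14, 17, 19, 22, 23, 25, 26, 27, 28, 29],
    [4, 8, 12, 14, 17, 19, 22, 23, 25, 26, 27, 28, 29],
    [4, 8, 12, 14, 17, 19, 22, 23, 25, 26, 27, 28, 29],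
    [4, 8, 12, 14, 17, 19, 22, 23, 25, 26, 27, 28, 29],
    [4, 8, 12, 14, 17, 19, 22, 23, 25, 26, 27, 28, 29]]

/-- The neighbours in `tiles5`. -/
def adjacency5 : Adjacency where
  rightTable := [
    [2, 10], [0, 12], [11], [2, 10], [0, 12], [1, 9], [5], [4], [4], [8], [6, 7], [3], [3], [21],
    [22, 26], [20], [15], [15], [14], [14], [17, 19], [16, 18], [13, 27], [22, 26], [17, 19],
    [24], [25], [23]]
  leftTable := [
    [1, 4], [5], [0, 3], [11, 12], [7, 8], [6], [10], [10], [9], [5], [0, 3], [2], [1, 4], [22],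
    [18, 19], [16, 17], [21], [20, 24], [21], [20, 24], [15], [13], [14, 23], [27], [25], [26],
    [14, 23], [22]]
  upTable := [
    [1, 2, 16, 17, 18, 19, 20, 21, 22], [0, 13, 14, 15], [0, 13, 14, 15],
    [1, 2, 16, 17, 18, 19, 20, 21, 22], [6, 7, 8, 11, 12, 25, 27],
    [1, 2, 16, 17, 18, 19, 20, 21, 22], [1, 2, 16, 17, 18, 19, 20, 21, 22],
    [1, 2, 16, 17, 18, 19, 20, 21, 22], [3, 4, 5, 9, 10, 23, 24, 26], [0, 13, 14, 15],
    [0, 13, 14, 15], [1, 2, 16, 17, 18, 19, 20, 21, 22], [3, 4, 5, 9, 10, 23, 24, 26],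
    [1, 2, 16, 17, 18, 19, 20, 21, 22], [6, 7, 8, 11, 12, 25, 27],
    [1, 2, 16, 17, 18, 19, 20, 21, 22], [1, 2, 16, 17, 18, 19, 20, 21, 22],
    [3, 4, 5, 9, 10, 23, 24, 26], [1, 2, 16, 17, 18, 19, 20, 21, 22],
    [3, 4, 5, 9, 10, 23, 24, 26], [0, 13, 14, 15], [0, 13, 14, 15], [3, 4, 5, 9, 10, 23, 24, 26],
    [6, 7, 8, 11, 12, 25, 27], [6, 7, 8, 11, 12, 25, 27], [3, 4, 5, 9, 10, 23, 24, 26],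
    [3, 4, 5, 9, 10, 23, 24, 26], [3, 4, 5, 9, 10, 23, 24, 26]]
  downTable := [
    [1, 2, 9, 10, 20, 21], [0, 3, 5, 6, 7, 11, 13, 15, 16, 18],
    [0, 3, 5, 6, 7, 11, 13, 15, 16, 18], [8, 12, 17, 19, 22, 25, 26, 27],
    [8, 12, 17, 19, 22, 25, 26, 27], [8, 12, 17, 19, 22, 25, 26, 27], [4, 14, 23, 24],
    [4, 14, 23, 24], [4, 14, 23, 24], [8, 12, 17, 19, 22, 25, 26, 27],
    [8, 12, 17, 19, 22, 25, 26, 27], [4, 14, 23, 24], [4, 14, 23, 24], [1, 2, 9, 10, 20, 21],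
    [1, 2, 9, 10, 20, 21], [1, 2, 9, 10, 20, 21], [0, 3, 5, 6, 7, 11, 13, 15, 16, 18],
    [0, 3, 5, 6, 7, 11, 13, 15, 16, 18], [0, 3, 5, 6, 7, 11, 13, 15, 16, 18],
    [0, 3, 5, 6, 7, 11, 13, 15, 16, 18], [0, 3, 5, 6, 7, 11, 13, 15, 16, 18],
    [0, 3, 5, 6, 7, 11, 13, 15, 16, 18], [0, 3, 5, 6, 7, 11, 13, 15, 16, 18],
    [8, 12, 17, 19, 22, 25, 26, 27], [8, 12, 17, 19, 22, 25, 26, 27], [4, 14, 23, 24],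
    [8, 12, 17, 19, 22, 25, 26, 27], [4, 14, 23, 24]]

/-- Neighbours in configurations of `tiles5`, refined 1 time. -/
def adjacency5_1 : Adjacency where
  rightTable := [
    [2, 10], [0, 12], [11], [2, 10], [12], [1, 9], [5], [4], [4], [8], [6, 7], [3], [3], [21],
    [22, 26], [20], [15], [15], [14], [14], [17, 19], [16, 18], [13, 27], [22, 26], [17, 19],
    [24], [25], [23]]
  leftTable := [
    [1], [5], [0, 3], [11, 12], [7, 8], [6], [10], [10], [9], [5], [0, 3], [2], [1, 4], [22],
    [18, 19], [16, 17], [21], [20, 24], [21], [20, 24], [15], [13], [14, 23], [27], [25], [26],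
    [14, 23], [22]]
  upTable := [
    [22], [0, 13, 14, 15], [0, 13, 14, 15], [1, 16, 17, 18, 19, 22], [6, 7, 8, 11, 12, 25, 27],
    [16, 18, 19], [20, 21], [2, 22], [10, 26], [0, 14], [0, 13, 14, 15], [20, 21], [3, 5, 23, 24],
    [1, 17, 19, 22], [6, 7, 8, 11, 12, 25, 27], [1, 16, 17, 18, 19, 22], [20, 21], [3, 5, 23, 24],
    [2, 22], [4, 10, 26], [0, 14], [0, 13, 14, 15], [3, 5, 23, 24], [6, 7, 8, 12, 25],
    [6, 7, 8, 12, 25], [9, 10, 26], [3, 5, 23], [9, 10, 26]]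
  downTable := [
    [1, 2, 9, 10, 20, 21], [3, 13, 15], [7, 18], [12, 17, 22, 26], [19], [12, 17, 22, 26],
    [4, 14, 23, 24], [4, 14, 23, 24], [4, 14, 23, 24], [25, 27], [8, 19, 25, 27], [4, 14],
    [4, 14, 23, 24], [1, 2, 10, 21], [1, 2, 9, 10, 20, 21], [1, 2, 10, 21], [3, 5, 15],
    [3, 13, 15], [3, 5, 15], [3, 5, 13, 15], [6, 11, 16], [6, 11, 16], [0, 3, 7, 13, 15, 18],
    [12, 17, 22, 26], [12, 17, 22], [4, 14, 23, 24], [8, 19, 25, 27], [4, 14]]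

/-- Neighbours in configurations of `tiles5`, refined 2 times. -/
def adjacency5_2 : Adjacency where
  rightTable := [
    [2, 10], [0], [11], [10], [12], [1, 9], [5], [4], [4], [8], [6, 7], [3], [3], [21], [22, 26],
    [20], [15], [15], [14], [14], [19], [16, 18], [13, 27], [22, 26], [17, 19], [24], [25], [23]]
  leftTable := [
    [1], [5], [0], [11, 12], [7, 8], [6], [10], [10], [9], [5], [0, 3], [2], [4], [22], [18, 19],
    [16, 17], [21], [24], [21], [20, 24], [15], [13], [14, 23], [27], [25], [26], [14, 23], [22]]
  upTable := [
    [22], [14], [13], [1, 16, 17, 18, 19, 22], [6, 11, 25, 27], [16, 18, 19], [20, 21], [2, 22],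
    [10, 26], [14], [0, 13, 14, 15], [20, 21], [5, 23, 24], [1, 17, 19, 22], [6, 11, 12, 25, 27],
    [1, 18, 19], [20, 21], [5, 24], [2, 22], [4, 10, 26], [0, 14], [0, 13, 14, 15],
    [3, 5, 23, 24], [6, 25], [6, 7, 8, 25], [9, 10, 26], [3, 5, 23], [9, 10, 26]]
  downTable := [
    [10, 20, 21], [3, 13, 15], [7, 18], [22, 26], [19], [12, 17, 22, 26], [4, 14, 23, 24], [24],
    [24], [25, 27], [8, 19, 25, 27], [4, 14], [14], [2, 10, 21], [1, 9, 10, 20, 21], [10, 21],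
    [3, 5], [3, 13], [3, 5, 15], [3, 5, 13, 15], [6, 11, 16], [6, 11, 16], [0, 3, 7, 13, 18],
    [12, 22, 26], [12, 17, 22], [4, 14, 23, 24], [8, 19, 25, 27], [4, 14]]

/-- The neighbours in `tiles6`. -/
def adjacency6 : Adjacency where
  rightTable := [
    [2, 10], [0], [11], [2, 10], [12], [1, 9], [5], [4], [4], [8], [6, 7], [3], [3], [21],
    [22, 23, 27], [20], [15], [15], [14], [14], [17, 19], [16, 18], [28], [13], [22, 23, 27],
    [17, 19], [25], [26], [24]]
  leftTable := [
    [1], [5], [0, 3], [11, 12], [7, 8], [6], [10], [10], [9], [5], [0, 3], [2], [4], [23],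
    [18, 19], [16, 17], [21], [20, 25], [21], [20, 25], [15], [13], [14, 24], [14, 24], [28],
    [26], [27], [14, 24], [22]]
  upTable := [
    [0, 13, 14, 15], [1, 2, 16, 17, 18, 19, 20, 21, 22, 23],
    [1, 2, 16, 17, 18, 19, 20, 21, 22, 23], [0, 13, 14, 15], [3, 4, 5, 9, 10, 24, 25, 27],
    [0, 13, 14, 15], [1, 2, 16, 17, 18, 19, 20, 21, 22, 23], [6, 7, 8, 11, 12, 26, 28],
    [6, 7, 8, 11, 12, 26, 28], [3, 4, 5, 9, 10, 24, 25, 27],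
    [1, 2, 16, 17, 18, 19, 20, 21, 22, 23], [1, 2, 16, 17, 18, 19, 20, 21, 22, 23],
    [1, 2, 16, 17, 18, 19, 20, 21, 22, 23], [0, 13, 14, 15], [3, 4, 5, 9, 10, 24, 25, 27],
    [0, 13, 14, 15], [1, 2, 16, 17, 18, 19, 20, 21, 22, 23],
    [1, 2, 16, 17, 18, 19, 20, 21, 22, 23], [6, 7, 8, 11, 12, 26, 28], [6, 7, 8, 11, 12, 26, 28],
    [3, 4, 5, 9, 10, 24, 25, 27], [1, 2, 16, 17, 18, 19, 20, 21, 22, 23],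
    [3, 4, 5, 9, 10, 24, 25, 27], [1, 2, 16, 17, 18, 19, 20, 21, 22, 23],
    [3, 4, 5, 9, 10, 24, 25, 27], [3, 4, 5, 9, 10, 24, 25, 27], [6, 7, 8, 11, 12, 26, 28],
    [3, 4, 5, 9, 10, 24, 25, 27], [6, 7, 8, 11, 12, 26, 28]]
  downTable := [
    [0, 3, 5, 13, 15], [1, 2, 6, 10, 11, 12, 16, 17, 21, 23],
    [1, 2, 6, 10, 11, 12, 16, 17, 21, 23], [4, 9, 14, 20, 22, 24, 25, 27],
    [4, 9, 14, 20, 22, 24, 25, 27], [4, 9, 14, 20, 22, 24, 25, 27], [7, 8, 18, 19, 26, 28],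
    [7, 8, 18, 19, 26, 28], [7, 8, 18, 19, 26, 28], [4, 9, 14, 20, 22, 24, 25, 27],
    [4, 9, 14, 20, 22, 24, 25, 27], [7, 8, 18, 19, 26, 28], [7, 8, 18, 19, 26, 28],
    [0, 3, 5, 13, 15], [0, 3, 5, 13, 15], [0, 3, 5, 13, 15],
    [1, 2, 6, 10, 11, 12, 16, 17, 21, 23], [1, 2, 6, 10, 11, 12, 16, 17, 21, 23],
    [1, 2, 6, 10, 11, 12, 16, 17, 21, 23], [1, 2, 6, 10, 11, 12, 16, 17, 21, 23],
    [1, 2, 6, 10, 11, 12, 16, 17, 21, 23], [1, 2, 6, 10, 11, 12, 16, 17, 21, 23],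
    [1, 2, 6, 10, 11, 12, 16, 17, 21, 23], [1, 2, 6, 10, 11, 12, 16, 17, 21, 23],
    [4, 9, 14, 20, 22, 24, 25, 27], [4, 9, 14, 20, 22, 24, 25, 27], [7, 8, 18, 19, 26, 28],
    [4, 9, 14, 20, 22, 24, 25, 27], [7, 8, 18, 19, 26, 28]]

/-- The neighbours in `tiles7`. -/
def adjacency7 : Adjacency where
  rightTable := [
    [11], [10], [8, 9], [14, 16], [13, 15], [19], [18], [0, 2], [1, 7], [12], [12], [0, 2],
    [0, 2], [3], [3], [5, 6, 17], [5, 6, 17], [4], [14, 16], [5, 6, 17]]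
  leftTable := [
    [7, 11, 12], [8], [7, 11, 12], [13, 14], [17], [15, 16, 19], [15, 16, 19], [8], [2], [2], [1],
    [0], [9, 10], [4], [3, 18], [4], [3, 18], [15, 16, 19], [6], [5]]
  upTable := [
    [0, 3, 4, 5], [1, 2, 6], [0, 3, 4, 5], [1, 2, 6], [0, 3, 4, 5], [1, 2, 6], [1, 2, 6],
    [7, 13, 14, 15, 16, 17], [7, 13, 14, 15, 16, 17], [8, 9, 10, 11, 12, 18, 19],
    [8, 9, 10, 11, 12, 18, 19], [7, 13, 14, 15, 16, 17], [7, 13, 14, 15, 16, 17],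
    [7, 13, 14, 15, 16, 17], [7, 13, 14, 15, 16, 17], [8, 9, 10, 11, 12, 18, 19],
    [8, 9, 10, 11, 12, 18, 19], [7, 13, 14, 15, 16, 17], [8, 9, 10, 11, 12, 18, 19],
    [8, 9, 10, 11, 12, 18, 19]]
  downTable := [
    [0, 2, 4], [1, 3, 5, 6], [1, 3, 5, 6], [0, 2, 4], [0, 2, 4], [0, 2, 4], [1, 3, 5, 6],
    [7, 8, 11, 12, 13, 14, 17], [9, 10, 15, 16, 18, 19], [9, 10, 15, 16, 18, 19],
    [9, 10, 15, 16, 18, 19], [9, 10, 15, 16, 18, 19], [9, 10, 15, 16, 18, 19],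
    [7, 8, 11, 12, 13, 14, 17], [7, 8, 11, 12, 13, 14, 17], [7, 8, 11, 12, 13, 14, 17],
    [7, 8, 11, 12, 13, 14, 17], [7, 8, 11, 12, 13, 14, 17], [9, 10, 15, 16, 18, 19],
    [9, 10, 15, 16, 18, 19]]

/-- Neighbours in configurations of `tiles7`, refined 1 time. -/
def adjacency7_1 : Adjacency where
  rightTable := [
    [11], [10], [8, 9], [16], [13, 15], [19], [18], [0, 2], [1, 7], [12], [12], [2], [2], [3],
    [3], [5, 6, 17], [5, 6, 17], [4], [14, 16], [6, 17]]
  leftTable := [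
    [7], [8], [7, 11, 12], [13, 14], [17], [15, 16], [15, 16, 19], [8], [2], [2], [1], [0],
    [9, 10], [4], [18], [4], [3, 18], [15, 16, 19], [6], [5]]
  upTable := [
    [3, 4], [2, 6], [0, 3, 4, 5], [2, 6], [0, 3, 4, 5], [1, 2, 6], [1, 2, 6], [17], [15, 16],
    [19], [8, 18], [13, 15, 16], [7, 14, 16, 17], [15, 16], [7, 16], [11, 19], [8, 12, 18],
    [7, 14, 16, 17], [8, 9, 10, 18], [8, 18]]
  downTable := [
    [2, 4], [5, 6], [1, 3, 5, 6], [0, 2, 4], [0, 2, 4], [2, 4], [1, 3, 5, 6], [12, 14, 17],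
    [10, 16, 18, 19], [18], [18], [15], [16], [11], [12, 17], [8, 11, 13],
    [8, 11, 12, 13, 14, 17], [7, 12, 17], [10, 16, 18, 19], [9, 15]]

/-- The neighbours in `tiles8`. -/
def adjacency8 : Adjacency where
  rightTable := [
    [7, 8], [11], [11], [18], [18], [4, 13, 16, 17], [18], [10], [0, 1, 9], [2], [0, 1, 9],
    [0, 1, 9], [4, 13, 16, 17], [4, 13, 16, 17], [6, 19], [5], [6, 19], [5], [3, 12, 14, 15], [5]]
  leftTable := [
    [8, 10, 11], [8, 10, 11], [9], [18], [5, 12, 13], [15, 17, 19], [14, 16], [0], [0],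
    [8, 10, 11], [7], [1, 2], [18], [5, 12, 13], [18], [18], [5, 12, 13], [5, 12, 13], [3, 4, 6],
    [14, 16]]
  upTable := [
    [3, 4], [0, 1, 2, 5, 6], [0, 1, 2, 5, 6], [0, 1, 2, 5, 6], [0, 1, 2, 5, 6], [0, 1, 2, 5, 6],
    [0, 1, 2, 5, 6], [7, 12, 13, 14, 16, 18], [7, 12, 13, 14, 16, 18], [8, 15, 17],
    [7, 12, 13, 14, 16, 18], [7, 12, 13, 14, 16, 18], [8, 15, 17], [8, 15, 17], [9, 10, 11, 19],
    [9, 10, 11, 19], [9, 10, 11, 19], [9, 10, 11, 19], [7, 12, 13, 14, 16, 18], [9, 10, 11, 19]]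
  downTable := [
    [1, 2, 3, 4, 5, 6], [1, 2, 3, 4, 5, 6], [1, 2, 3, 4, 5, 6], [0], [0], [1, 2, 3, 4, 5, 6],
    [1, 2, 3, 4, 5, 6], [7, 8, 10, 11, 18], [9, 12, 13], [14, 15, 16, 17, 19],
    [14, 15, 16, 17, 19], [14, 15, 16, 17, 19], [7, 8, 10, 11, 18], [7, 8, 10, 11, 18],
    [7, 8, 10, 11, 18], [9, 12, 13], [7, 8, 10, 11, 18], [9, 12, 13], [7, 8, 10, 11, 18],
    [14, 15, 16, 17, 19]]

/-- Neighbours in configurations of `tiles8`, refined 1 time. -/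
def adjacency8_1 : Adjacency where
  rightTable := [
    [7, 8], [11], [11], [18], [18], [13, 16, 17], [18], [10], [0, 1, 9], [2], [0, 1, 9],
    [0, 1, 9], [4, 16, 17], [4, 16, 17], [6, 19], [5], [6, 19], [5], [3, 12, 14, 15], [5]]
  leftTable := [
    [8, 10, 11], [8, 10, 11], [9], [18], [12, 13], [15, 17, 19], [14, 16], [0], [0], [8, 10, 11],
    [7], [1, 2], [18], [5], [18], [18], [5, 12, 13], [5, 12, 13], [3, 4, 6], [14, 16]]
  upTable := [
    [3, 4], [6], [0, 5], [6], [0, 5], [0, 1, 2, 5], [0, 5], [18], [18], [15, 17], [12, 14, 16],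
    [13, 16, 18], [15, 17], [8, 17], [10, 19], [10, 19], [9, 11], [9, 11], [7, 13, 16, 18], [9]]
  downTable := [
    [2, 4, 5, 6], [5], [5], [0], [0], [2, 4, 5, 6], [1, 3], [18], [13], [16, 17, 19], [14, 15],
    [16, 17], [10], [11, 18], [10], [9, 12], [10, 11, 18], [9, 12, 13], [7, 8, 11, 18], [14, 15]]

/-- Neighbours in configurations of `tiles8`, refined 2 times. -/
def adjacency8_2 : Adjacency where
  rightTable := [
    [7, 8], [11], [11], [18], [18], [13, 16, 17], [18], [10], [0, 9], [2], [0, 1, 9], [0, 1, 9],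
    [4], [4, 17], [6], [5], [6, 19], [5], [3, 12, 14, 15], [5]]
  leftTable := [
    [8, 10, 11], [10, 11], [9], [18], [12, 13], [15, 17, 19], [14, 16], [0], [0], [8, 10, 11],
    [7], [1, 2], [18], [5], [18], [18], [5], [5, 13], [3, 4, 6], [16]]
  upTable := [
    [3, 4], [6], [5], [6], [0, 5], [0, 1, 2, 5], [0, 5], [18], [18], [15, 17], [12, 14],
    [13, 16, 18], [15, 17], [8, 17], [10, 19], [10, 19], [11], [9, 11], [7, 13, 16, 18], [9]]
  downTable := [
    [4, 5, 6], [5], [5], [0], [0], [2, 4, 5, 6], [1, 3], [18], [13], [17, 19], [14, 15], [16, 17],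
    [10], [11, 18], [10], [9, 12], [11, 18], [9, 12, 13], [7, 8, 11, 18], [14, 15]]

/-- The neighbours in `tiles9`. -/
def adjacency9 : Adjacency where
  rightTable := [
    [8, 9], [7], [7], [3, 4, 13, 16, 17], [19], [12, 14, 15], [0, 1, 6], [2, 10, 11], [0, 1, 6],
    [2, 10, 11], [0, 1, 6], [2, 10, 11], [5, 18], [5, 18], [5, 18], [3, 4, 13, 16, 17], [5, 18],
    [3, 4, 13, 16, 17], [5, 18], [3, 4, 13, 16, 17]]
  leftTable := [
    [6, 8, 10], [6, 8, 10], [7, 9, 11], [3, 15, 17, 19], [3, 15, 17, 19], [12, 13, 14, 16, 18],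
    [6, 8, 10], [1, 2], [0], [0], [7, 9, 11], [7, 9, 11], [5], [3, 15, 17, 19], [5], [5],
    [3, 15, 17, 19], [3, 15, 17, 19], [12, 13, 14, 16, 18], [4]]
  upTable := [
    [0, 3, 4, 5], [0, 3, 4, 5], [0, 3, 4, 5], [1], [2], [0, 3, 4, 5], [12, 13, 18], [6, 15, 17],
    [12, 13, 18], [14, 16], [12, 13, 18], [14, 16], [6, 15, 17], [6, 15, 17],
    [7, 8, 9, 10, 11, 19], [7, 8, 9, 10, 11, 19], [7, 8, 9, 10, 11, 19], [7, 8, 9, 10, 11, 19],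
    [14, 16], [7, 8, 9, 10, 11, 19]]
  downTable := [
    [0, 1, 2, 5], [3], [4], [0, 1, 2, 5], [0, 1, 2, 5], [0, 1, 2, 5], [7, 12, 13],
    [14, 15, 16, 17, 19], [14, 15, 16, 17, 19], [14, 15, 16, 17, 19], [14, 15, 16, 17, 19],
    [14, 15, 16, 17, 19], [6, 8, 10], [6, 8, 10], [9, 11, 18], [7, 12, 13], [9, 11, 18],
    [7, 12, 13], [6, 8, 10], [14, 15, 16, 17, 19]]

/-- Neighbours in configurations of `tiles9`, refined 1 time. -/
def adjacency9_1 : Adjacency where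
  rightTable := [
    [8, 9], [7], [7], [16, 17], [19], [12, 14, 15], [0], [2, 10, 11], [0, 1, 6], [2, 10],
    [0, 1, 6], [2, 10], [5, 18], [5, 18], [5, 18], [3, 4, 13, 16], [5, 18], [3, 4, 13, 16], [5],
    [3, 4, 16, 17]]
  leftTable := [
    [6, 8, 10], [8, 10], [7, 9, 11], [15, 17, 19], [15, 17, 19], [12, 13, 14, 16, 18], [8, 10],
    [1, 2], [0], [0], [7, 9, 11], [7], [5], [15, 17], [5], [5], [3, 15, 17, 19], [3, 19],
    [12, 13, 14, 16], [4]]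
  upTable := [
    [5], [5], [3, 5], [1], [2], [0, 3, 4, 5], [18], [15, 17], [12], [14], [13, 18], [16],
    [15, 17], [6, 17], [8, 19], [8, 9, 19], [10], [7, 10, 11], [16], [7]]
  downTable := [
    [5], [3], [4], [2, 5], [5], [0, 1, 2, 5], [13], [17, 19], [14, 15], [15], [16, 17], [17], [8],
    [10], [9], [7, 12], [11, 18], [7, 12, 13], [6, 10], [14, 15]]

/-- The neighbours in `tiles10`. -/
def adjacency10 : Adjacency where
  rightTable := [
    [1, 3, 4], [0, 5], [0, 5], [0, 5], [2], [0, 5], [14], [17], [10, 11, 12], [8], [8], [6, 9],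
    [7, 13, 15, 16], [8], [7, 13, 15, 16], [6, 9], [7, 13, 15, 16], [7, 13, 15, 16]]
  leftTable := [
    [1, 2, 3, 5], [0], [4], [0], [0], [1, 2, 3, 5], [11, 15], [12, 14, 16, 17], [9, 10, 13],
    [11, 15], [8], [8], [8], [12, 14, 16, 17], [6], [12, 14, 16, 17], [12, 14, 16, 17], [7]]
  upTable := [
    [0, 6, 7, 8], [4, 11, 12, 14, 15, 16], [4, 11, 12, 14, 15, 16], [17], [17], [3, 10, 13],
    [0, 6, 7, 8], [0, 6, 7, 8], [0, 6, 7, 8], [1, 2, 5, 9], [1, 2, 5, 9], [1, 2, 5, 9],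
    [3, 10, 13], [1, 2, 5, 9], [4, 11, 12, 14, 15, 16], [1, 2, 5, 9], [3, 10, 13],
    [4, 11, 12, 14, 15, 16]]
  downTable := [
    [0, 6, 7, 8], [9, 10, 11, 13, 15], [9, 10, 11, 13, 15], [5, 12, 16], [1, 2, 14, 17],
    [9, 10, 11, 13, 15], [0, 6, 7, 8], [0, 6, 7, 8], [0, 6, 7, 8], [9, 10, 11, 13, 15],
    [5, 12, 16], [1, 2, 14, 17], [1, 2, 14, 17], [5, 12, 16], [1, 2, 14, 17], [1, 2, 14, 17],
    [1, 2, 14, 17], [3, 4]]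

/-- Neighbours in configurations of `tiles10`, refined 1 time. -/
def adjacency10_1 : Adjacency where
  rightTable := [
    [1, 3, 4], [0, 5], [0, 5], [0, 5], [2], [0], [14], [17], [10, 11, 12], [8], [8], [6, 9],
    [7, 13], [8], [7, 13], [6, 9], [7, 13], [7, 13, 15, 16]]
  leftTable := [
    [1, 2, 3, 5], [0], [4], [0], [0], [1, 2, 3], [11, 15], [12, 14, 16, 17], [9, 10, 13],
    [11, 15], [8], [8], [8], [12, 14, 16, 17], [6], [17], [17], [7]]
  upTable := [
    [0, 6, 7, 8], [11, 12, 14], [15, 16], [17], [17], [13], [0, 8], [0, 6, 8], [0, 8], [5], [1],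
    [1], [3, 10], [2, 5, 9], [4, 11, 12, 14], [2, 9], [13], [4, 11, 12, 14]]
  downTable := [
    [0, 6, 7, 8], [10, 11], [13, 15], [12], [14, 17], [9, 13], [0, 7], [0], [0, 6, 7, 8],
    [13, 15], [12], [1, 14, 17], [1, 14, 17], [5, 16], [1, 14, 17], [2], [2], [3, 4]]

/-- Neighbours in configurations of `tiles10`, refined 2 times. -/
def adjacency10_2 : Adjacency where
  rightTable := [
    [1, 3, 4], [0, 5], [0, 5], [0, 5], [2], [0], [14], [17], [10, 11, 12], [8], [8], [6, 9],
    [7, 13], [8], [7, 13], [6], [7], [7, 13, 15, 16]]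
  leftTable := [
    [1, 2, 3, 5], [0], [4], [0], [0], [1, 2, 3], [11, 15], [12, 14, 16, 17], [9, 10, 13], [11],
    [8], [8], [8], [12, 14, 17], [6], [17], [17], [7]]
  upTable := [
    [6, 7, 8], [11, 12, 14], [15, 16], [17], [17], [13], [0, 8], [0, 6, 8], [0, 8], [5], [1], [1],
    [3, 10], [2, 5, 9], [4, 11], [2, 9], [13], [4, 11, 12, 14]]
  downTable := [
    [6, 7, 8], [10, 11], [13, 15], [12], [14, 17], [9, 13], [0, 7], [0], [0, 6, 7, 8], [13, 15],
    [12], [1, 14, 17], [1, 17], [5, 16], [1, 17], [2], [2], [3, 4]]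

/-- The neighbours in `tiles11`. -/
def adjacency11 : Adjacency where
  rightTable := [
    [5], [8], [3], [1, 4, 6, 7], [2], [1, 4, 6, 7], [0], [1, 4, 6, 7], [1, 4, 6, 7], [18], [20],
    [13, 14, 15], [11], [11], [9, 12], [10, 17], [11], [11], [16, 19], [9, 12], [16, 19]]
  leftTable := [
    [6], [3, 5, 7, 8], [4], [2], [3, 5, 7, 8], [0], [3, 5, 7, 8], [3, 5, 7, 8], [1], [14, 19],
    [15], [12, 13, 16, 17], [14, 19], [11], [11], [11], [18, 20], [15], [9], [18, 20], [10]]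
  upTable := [
    [0, 1, 2, 9, 10, 11], [0, 1, 2, 9, 10, 11], [0, 1, 2, 9, 10, 11], [4, 13, 16, 17], [12],
    [3, 5, 6, 7, 14, 15, 18, 19], [12], [4, 13, 16, 17], [3, 5, 6, 7, 14, 15, 18, 19],
    [0, 1, 2, 9, 10, 11], [0, 1, 2, 9, 10, 11], [0, 1, 2, 9, 10, 11], [4, 13, 16, 17],
    [3, 5, 6, 7, 14, 15, 18, 19], [3, 5, 6, 7, 14, 15, 18, 19], [8, 20],
    [3, 5, 6, 7, 14, 15, 18, 19], [4, 13, 16, 17], [8, 20], [3, 5, 6, 7, 14, 15, 18, 19], [8, 20]]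
  downTable := [
    [0, 1, 2, 9, 10, 11], [0, 1, 2, 9, 10, 11], [0, 1, 2, 9, 10, 11], [5, 8, 13, 14, 16, 19],
    [3, 7, 12, 17], [5, 8, 13, 14, 16, 19], [5, 8, 13, 14, 16, 19], [5, 8, 13, 14, 16, 19],
    [15, 18, 20], [0, 1, 2, 9, 10, 11], [0, 1, 2, 9, 10, 11], [0, 1, 2, 9, 10, 11], [4, 6],
    [3, 7, 12, 17], [5, 8, 13, 14, 16, 19], [5, 8, 13, 14, 16, 19], [3, 7, 12, 17],
    [3, 7, 12, 17], [5, 8, 13, 14, 16, 19], [5, 8, 13, 14, 16, 19], [15, 18, 20]]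

/-- Neighbours in configurations of `tiles11`, refined 1 time. -/
def adjacency11_1 : Adjacency where
  rightTable := [
    [5], [8], [3], [1], [2], [1, 4], [0], [1], [1, 4, 6, 7], [18], [20], [13, 14, 15], [11], [11],
    [9, 12], [10, 17], [11], [11], [16], [9, 12], [16, 19]]
  leftTable := [
    [6], [3, 5, 7, 8], [4], [2], [5, 8], [0], [8], [8], [1], [14, 19], [15], [12, 13, 16, 17],
    [14, 19], [11], [11], [11], [18, 20], [15], [9], [20], [10]]
  upTable := [
    [11], [0, 2, 9, 11], [11], [13], [12], [3, 5, 14, 15], [12], [4, 16, 17], [3, 5, 14, 15, 18],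
    [1, 10], [1], [0, 1, 2, 9, 10, 11], [4, 16, 17], [3, 5, 14, 15], [3, 5, 14, 15, 18], [8, 20],
    [6, 7, 19], [4, 16], [8, 20], [6, 7, 19], [8, 20]]
  downTable := [
    [1, 11], [9, 10, 11], [1, 11], [5, 8, 13, 14], [7, 12, 17], [5, 8, 13, 14], [16, 19],
    [16, 19], [15, 18, 20], [1, 11], [9, 11], [0, 1, 2, 11], [4, 6], [3], [5, 8, 13, 14],
    [5, 8, 13, 14], [7, 12, 17], [7, 12], [8, 14], [16, 19], [15, 18, 20]]

/-- The neighbours in `tilesU`. -/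
def adjacency12 : Adjacency where
  rightTable := [
    [2, 3, 6], [2, 3, 6], [0, 4], [7], [1, 5], [1, 5], [1, 5], [1, 5], [16], [12, 14], [12, 14],
    [17], [9], [9], [8, 11, 13, 15, 18], [8, 11, 13, 15, 18], [8, 11, 13, 15, 18],
    [8, 11, 13, 15, 18], [10]]
  leftTable := [
    [2], [4, 5, 6, 7], [0, 1], [0, 1], [2], [4, 5, 6, 7], [0, 1], [3], [14, 15, 16, 17], [12, 13],
    [18], [14, 15, 16, 17], [9, 10], [14, 15, 16, 17], [9, 10], [14, 15, 16, 17], [8], [11],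
    [14, 15, 16, 17]]
  upTable := [
    [0, 8, 9, 11], [0, 8, 9, 11], [16], [16], [2, 4, 6, 7, 12, 13, 18], [2, 4, 6, 7, 12, 13, 18],
    [3, 14, 15, 17], [3, 14, 15, 17], [0, 8, 9, 11], [1, 10], [1, 10], [1, 10],
    [2, 4, 6, 7, 12, 13, 18], [2, 4, 6, 7, 12, 13, 18], [2, 4, 6, 7, 12, 13, 18],
    [2, 4, 6, 7, 12, 13, 18], [3, 14, 15, 17], [3, 14, 15, 17], [5]]
  downTable := [
    [0, 1, 8], [9, 10, 11], [4, 5, 12, 13, 14, 15], [6, 7, 16, 17], [4, 5, 12, 13, 14, 15], [18],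
    [4, 5, 12, 13, 14, 15], [4, 5, 12, 13, 14, 15], [0, 1, 8], [0, 1, 8], [9, 10, 11], [0, 1, 8],
    [4, 5, 12, 13, 14, 15], [4, 5, 12, 13, 14, 15], [6, 7, 16, 17], [6, 7, 16, 17], [2, 3],
    [6, 7, 16, 17], [4, 5, 12, 13, 14, 15]]

/-- Neighbours in configurations of `tilesU`, refined 1 time. -/
def adjacency12_1 : Adjacency where
  rightTable := [
    [3], [2, 3, 6], [0, 4], [7], [1, 5], [1], [1, 5], [1, 5], [16], [14], [12, 14], [17], [9],
    [9], [8, 11, 13, 18], [8, 11, 13, 18], [8, 13, 15], [8, 13], [10]]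
  leftTable := [
    [2], [4, 5, 6, 7], [1], [0, 1], [2], [4, 6, 7], [1], [3], [14, 15, 16, 17], [12, 13], [18],
    [14, 15], [10], [14, 15, 16, 17], [9, 10], [16], [8], [11], [14, 15]]
  upTable := [
    [8], [0, 8, 9, 11], [16], [16], [13], [13], [3, 14, 17], [15], [0, 9, 11], [1, 10], [1],
    [1, 10], [6], [4, 7, 18], [2, 6, 12], [7, 13, 18], [3, 14, 17], [3, 14], [5]]
  downTable := [
    [1, 8], [9, 10, 11], [14], [6, 16, 17], [13], [18], [12, 14], [13, 15], [0, 1], [1, 8],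
    [9, 11], [1, 8], [14], [4, 5, 15], [6, 16, 17], [7], [2, 3], [6, 16], [13, 15]]

/-- Neighbours in configurations of `tilesU`, refined 2 times. -/
def adjacency12_2 : Adjacency where
  rightTable := [
    [3], [2, 3, 6], [0, 4], [7], [1], [1], [1, 5], [1, 5], [16], [14], [12, 14], [17], [9], [9],
    [8, 11, 13, 18], [8, 11], [8, 13, 15], [8, 13], [10]]
  leftTable := [
    [2], [4, 5, 6, 7], [1], [0, 1], [2], [6, 7], [1], [3], [14, 15, 16, 17], [12, 13], [18],
    [14, 15], [10], [14, 16, 17], [9, 10], [16], [8], [11], [14]]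
  upTable := [
    [8], [8, 9, 11], [16], [16], [13], [13], [14, 17], [15], [0, 9, 11], [1, 10], [1], [1, 10],
    [6], [4, 7, 18], [2, 6, 12], [7, 13, 18], [3, 14, 17], [3, 14], [5]]
  downTable := [
    [8], [9, 10, 11], [14], [16, 17], [13], [18], [12, 14], [13, 15], [0, 1], [1, 8], [9, 11],
    [1, 8], [14], [4, 5, 15], [6, 16, 17], [7], [2, 3], [6, 16], [13, 15]]

/-- Neighbours in configurations of `tilesU`, refined 3 times. -/
def adjacency12_3 : Adjacency where
  rightTable := [
    [3], [2, 3, 6], [0, 4], [7], [1], [1], [1, 5], [1], [16], [14], [12, 14], [17], [9], [9],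
    [8, 11, 13, 18], [8, 11], [8, 13, 15], [8, 13], [10]]
  leftTable := [
    [2], [4, 5, 6, 7], [1], [0, 1], [2], [6], [1], [3], [14, 15, 16, 17], [12, 13], [18],
    [14, 15], [10], [14, 16, 17], [9, 10], [16], [8], [11], [14]]
  upTable := [
    [8], [8, 9, 11], [16], [16], [13], [13], [14, 17], [15], [0, 9, 11], [1, 10], [1], [1, 10],
    [6], [4, 7, 18], [2, 6, 12], [7, 13, 18], [3, 14, 17], [3, 14], [5]]
  downTable := [
    [8], [9, 10, 11], [14], [16, 17], [13], [18], [12, 14], [13, 15], [0, 1], [1, 8], [9, 11],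
    [1, 8], [14], [4, 5, 15], [6, 16, 17], [7], [2, 3], [6, 16], [13, 15]]

theorem codedBy0 : jeandelRaoTiles.CodedBy 11 adjacency0 :=
  WangTileSet.codedBy tileList0 (fun t => by simp [tileList0]) (by decide +kernel) rfl (by decide +kernel)

theorem codedBy1 : tiles1.CodedBy 13 adjacency1 :=
  WangTileSet.codedBy tileList1 (fun _ => List.mem_toFinset) (by decide +kernel) rfl (by decide +kernel)

theorem codedBy2 : tiles2.CodedBy 20 adjacency2 :=
  WangTileSet.codedBy tileList2 (fun _ => List.mem_toFinset) (by decide +kernel) rfl (by decide +kernel)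

theorem codedBy3 : tiles3.CodedBy 24 adjacency3 :=
  WangTileSet.codedBy tileList3 (fun _ => List.mem_toFinset) (by decide +kernel) rfl (by decide +kernel)

theorem codedBy4 : tiles4.CodedBy 30 adjacency4 :=
  WangTileSet.codedBy tileList4 (fun _ => List.mem_toFinset) (by decide +kernel) rfl (by decide +kernel)

theorem codedBy5 : tiles5.CodedBy 28 adjacency5 :=
  WangTileSet.codedBy tileList5 (fun _ => List.mem_toFinset) (by decide +kernel) rfl (by decide +kernel)

theorem codedBy6 : tiles6.CodedBy 29 adjacency6 :=
  WangTileSet.codedBy tileList6 (fun _ => List.mem_toFinset) (by decide +kernel) rfl (by decide +kernel)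

theorem codedBy7 : tiles7.CodedBy 20 adjacency7 :=
  WangTileSet.codedBy tileList7 (fun _ => List.mem_toFinset) (by decide +kernel) rfl (by decide +kernel)

theorem codedBy8 : tiles8.CodedBy 20 adjacency8 :=
  WangTileSet.codedBy tileList8 (fun _ => List.mem_toFinset) (by decide +kernel) rfl (by decide +kernel)

theorem codedBy9 : tiles9.CodedBy 20 adjacency9 :=
  WangTileSet.codedBy tileList9 (fun _ => List.mem_toFinset) (by decide +kernel) rfl (by decide +kernel)

theorem codedBy10 : tiles10.CodedBy 18 adjacency10 :=
  WangTileSet.codedBy tileList10 (fun _ => List.mem_toFinset) (by decide +kernel) rfl (by decide +kernel)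

theorem codedBy11 : tiles11.CodedBy 21 adjacency11 :=
  WangTileSet.codedBy tileList11 (fun _ => List.mem_toFinset) (by decide +kernel) rfl (by decide +kernel)

theorem codedBy12 : tilesU.CodedBy 19 adjacency12 :=
  WangTileSet.codedBy tileList12 (fun t => by simp [tileList12]) (by decide +kernel) rfl (by decide +kernel)

/-! ## The substitutions -/

/-- The substitution from `tiles1` to `jeandelRaoTiles`. -/
def substitution0 : CodedSubstitution where
  source := adjacency1
  target := adjacency0
  refined := adjacency0
  blocks := [
    [[2]], [[3]], [[4]], [[5]], [[6]], [[7]], [[8]], [[10]], [[0, 9]], [[1, 3]], [[1, 7]],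
    [[1, 8]], [[1, 10]]]
  colTest := fun _ _ => false
  rowTest := fun a _ => memB a [0, 1]

theorem exists_morphism0 : ∃ ω : Word tiles1.Alphabet → Word jeandelRaoTiles.Alphabet,
    IsMorphismBetween tiles1.wangShift jeandelRaoTiles.wangShift ω ∧
      IsRecognizable tiles1.wangShift ω ∧
      IsOntoUpToShift tiles1.wangShift jeandelRaoTiles.wangShift ω :=
  WangTileSet.exists_morphism substitution0 codedBy1 codedBy0 (k := 1) (l := [])
    (by decide +kernel) (by decide +kernel)

/-- The substitution from `tiles2` to `tiles1`. -/
def substitution1 : CodedSubstitution where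
  source := adjacency2
  target := adjacency1
  refined := adjacency1_1
  blocks := [
    [[0]], [[1]], [[2]], [[3]], [[4]], [[5]], [[6]], [[7]], [[8, 1]], [[8, 5]], [[8, 6]],
    [[8, 7]], [[9, 1]], [[9, 5]], [[9, 6]], [[10, 0]], [[10, 3]], [[11, 5]], [[11, 7]], [[12, 2]]]
  colTest := fun _ _ => false
  rowTest := fun a _ => memB a [8, 9, 10, 11, 12]

theorem exists_morphism1 : ∃ ω : Word tiles2.Alphabet → Word tiles1.Alphabet,
    IsMorphismBetween tiles2.wangShift tiles1.wangShift ω ∧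
      IsRecognizable tiles2.wangShift ω ∧
      IsOntoUpToShift tiles2.wangShift tiles1.wangShift ω :=
  WangTileSet.exists_morphism substitution1 codedBy2 codedBy1 (k := 1) (l := [])
    (by decide +kernel) (by decide +kernel)

/-- The substitution from `tiles3` to `tiles2`. -/
def substitution2 : CodedSubstitution where
  source := adjacency3
  target := adjacency2
  refined := adjacency2_2
  blocks := [
    [[2]], [[3]], [[4]], [[5]], [[8, 1]], [[8, 5]], [[8, 6]], [[9, 0]], [[9, 3]], [[10, 5]],
    [[10, 7]], [[11, 2]], [[12, 5]], [[12, 6]], [[13, 4]], [[14, 5]], [[15, 3]], [[16, 3]],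
    [[16, 4]], [[17, 3]], [[18, 2]], [[19, 0]], [[19, 3]], [[19, 4]]]
  colTest := fun _ _ => false
  rowTest := fun a _ => memB a [8, 9, 10, 11, 12, 13, 14, 15, 16, 17, 18, 19]

theorem exists_morphism2 : ∃ ω : Word tiles3.Alphabet → Word tiles2.Alphabet,
    IsMorphismBetween tiles3.wangShift tiles2.wangShift ω ∧
      IsRecognizable tiles3.wangShift ω ∧
      IsOntoUpToShift tiles3.wangShift tiles2.wangShift ω :=
  WangTileSet.exists_morphism substitution2 codedBy3 codedBy2 (k := 1) (l := [adjacency2_1])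
    (by decide +kernel) (by decide +kernel)

/-- The substitution from `tiles4` to `tiles3`. -/
def substitution3 : CodedSubstitution where
  source := adjacency4
  target := adjacency3
  refined := adjacency3_1
  blocks := [
    [[5]], [[8]], [[11]], [[12]], [[14]], [[15]], [[16]], [[17]], [[18]], [[19]], [[20]], [[22]],
    [[23]], [[4, 3]], [[5, 2]], [[6, 3]], [[7, 1]], [[7, 2]], [[8, 1]], [[8, 2]], [[9, 1]],
    [[10, 0]], [[11, 2]], [[12, 2]], [[13, 3]], [[15, 2]], [[16, 2]], [[20, 2]], [[21, 2]],
    [[22, 2]]]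
  colTest := fun _ _ => false
  rowTest := fun _ b => memB b [0, 1, 2, 3]

theorem exists_morphism3 : ∃ ω : Word tiles4.Alphabet → Word tiles3.Alphabet,
    IsMorphismBetween tiles4.wangShift tiles3.wangShift ω ∧
      IsRecognizable tiles4.wangShift ω ∧
      IsOntoUpToShift tiles4.wangShift tiles3.wangShift ω :=
  WangTileSet.exists_morphism substitution3 codedBy4 codedBy3 (k := 3) (l := [])
    (by decide +kernel) (by decide +kernel)

/-- The substitution from `tiles7` to `tiles6`. -/
def substitution6 : CodedSubstitution where
  source := adjacency7
  target := adjacency6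
  refined := adjacency6
  blocks := [
    [[2]], [[9]], [[10]], [[20]], [[21]], [[22]], [[27]], [[1], [0]], [[6], [5]], [[7], [4]],
    [[8], [4]], [[11], [3]], [[12], [3]], [[16], [15]], [[17], [15]], [[18], [14]], [[19], [14]],
    [[23], [13]], [[26], [25]], [[28], [24]]]
  colTest := fun _ b => memB b [0, 3, 4, 5, 13, 14, 15, 24, 25]
  rowTest := fun _ _ => false

theorem exists_morphism6 : ∃ ω : Word tiles7.Alphabet → Word tiles6.Alphabet,
    IsMorphismBetween tiles7.wangShift tiles6.wangShift ω ∧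
      IsRecognizable tiles7.wangShift ω ∧
      IsOntoUpToShift tiles7.wangShift tiles6.wangShift ω :=
  WangTileSet.exists_morphism substitution6 codedBy7 codedBy6 (k := 1) (l := [])
    (by decide +kernel) (by decide +kernel)

/-- The substitution from `tiles8` to `tiles7`. -/
def substitution7 : CodedSubstitution where
  source := adjacency8
  target := adjacency7
  refined := adjacency7_1
  blocks := [
    [[8]], [[9]], [[10]], [[15]], [[16]], [[18]], [[19]], [[7], [0]], [[7], [2]], [[8], [1]],
    [[11], [2]], [[12], [2]], [[13], [3]], [[14], [3]], [[15], [5]], [[15], [6]], [[16], [5]],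
    [[16], [6]], [[17], [4]], [[19], [6]]]
  colTest := fun _ b => memB b [0, 1, 2, 3, 4, 5, 6]
  rowTest := fun _ _ => false

theorem exists_morphism7 : ∃ ω : Word tiles8.Alphabet → Word tiles7.Alphabet,
    IsMorphismBetween tiles8.wangShift tiles7.wangShift ω ∧
      IsRecognizable tiles8.wangShift ω ∧
      IsOntoUpToShift tiles8.wangShift tiles7.wangShift ω :=
  WangTileSet.exists_morphism substitution7 codedBy8 codedBy7 (k := 1) (l := [])
    (by decide +kernel) (by decide +kernel)

/-- The substitution from `tiles9` to `tiles8`. -/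
def substitution8 : CodedSubstitution where
  source := adjacency9
  target := adjacency8
  refined := adjacency8_2
  blocks := [
    [[7]], [[8]], [[11]], [[13]], [[16]], [[18]], [[8], [0]], [[9], [2]], [[10], [0]],
    [[10], [1]], [[11], [0]], [[11], [1]], [[12], [4]], [[13], [4]], [[14], [6]], [[15], [5]],
    [[16], [6]], [[17], [5]], [[18], [3]], [[19], [5]]]
  colTest := fun _ b => memB b [0, 1, 2, 3, 4, 5, 6]
  rowTest := fun _ _ => false

theorem exists_morphism8 : ∃ ω : Word tiles9.Alphabet → Word tiles8.Alphabet,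
    IsMorphismBetween tiles9.wangShift tiles8.wangShift ω ∧
      IsRecognizable tiles9.wangShift ω ∧
      IsOntoUpToShift tiles9.wangShift tiles8.wangShift ω :=
  WangTileSet.exists_morphism substitution8 codedBy9 codedBy8 (k := 1) (l := [adjacency8_1])
    (by decide +kernel) (by decide +kernel)

/-- The substitution from `tiles10` to `tiles9`. -/
def substitution9 : CodedSubstitution where
  source := adjacency10
  target := adjacency9
  refined := adjacency9_1
  blocks := [
    [[5]], [[12]], [[13]], [[14]], [[15]], [[18]], [[3, 1]], [[4, 2]], [[5, 0]], [[13, 6]],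
    [[14, 8]], [[15, 8]], [[15, 9]], [[16, 10]], [[17, 7]], [[17, 10]], [[17, 11]], [[19, 7]]]
  colTest := fun _ _ => false
  rowTest := fun _ b => memB b [0, 1, 2, 6, 7, 8, 9, 10, 11]

theorem exists_morphism9 : ∃ ω : Word tiles10.Alphabet → Word tiles9.Alphabet,
    IsMorphismBetween tiles10.wangShift tiles9.wangShift ω ∧
      IsRecognizable tiles10.wangShift ω ∧
      IsOntoUpToShift tiles10.wangShift tiles9.wangShift ω :=
  WangTileSet.exists_morphism substitution9 codedBy10 codedBy9 (k := 1) (l := [])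
    (by decide +kernel) (by decide +kernel)

/-- The substitution from `tiles11` to `tiles10`. -/
def substitution10 : CodedSubstitution where
  source := adjacency11
  target := adjacency10
  refined := adjacency10_2
  blocks := [
    [[6]], [[7]], [[8]], [[12]], [[13]], [[14]], [[15]], [[16]], [[17]], [[6, 0]], [[7, 0]],
    [[8, 0]], [[9, 5]], [[10, 1]], [[11, 1]], [[12, 3]], [[13, 2]], [[13, 5]], [[14, 4]],
    [[15, 2]], [[17, 4]]]
  colTest := fun _ _ => false
  rowTest := fun _ b => memB b [0, 1, 2, 3, 4, 5]

theorem exists_morphism10 : ∃ ω : Word tiles11.Alphabet → Word tiles10.Alphabet,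
    IsMorphismBetween tiles11.wangShift tiles10.wangShift ω ∧
      IsRecognizable tiles11.wangShift ω ∧
      IsOntoUpToShift tiles11.wangShift tiles10.wangShift ω :=
  WangTileSet.exists_morphism substitution10 codedBy11 codedBy10 (k := 1) (l := [adjacency10_1])
    (by decide +kernel) (by decide +kernel)

/-- The substitution from `tilesU` to `tiles11`. -/
def substitution11 : CodedSubstitution where
  source := adjacency12
  target := adjacency11
  refined := adjacency11_1
  blocks := [
    [[5]], [[8]], [[6], [0]], [[4], [2]], [[5], [1]], [[8], [1]], [[7], [1]], [[3], [1]], [[14]],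
    [[18]], [[20]], [[15]], [[19], [9]], [[14], [9]], [[16], [11]], [[13], [11]], [[12], [11]],
    [[17], [11]], [[15], [10]]]
  colTest := fun _ b => memB b [0, 1, 2, 9, 10, 11]
  rowTest := fun _ _ => false

theorem exists_morphism11 : ∃ ω : Word tilesU.Alphabet → Word tiles11.Alphabet,
    IsMorphismBetween tilesU.wangShift tiles11.wangShift ω ∧
      IsRecognizable tilesU.wangShift ω ∧
      IsOntoUpToShift tilesU.wangShift tiles11.wangShift ω :=
  WangTileSet.exists_morphism substitution11 codedBy12 codedBy11 (k := 1) (l := [])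
    (by decide +kernel) (by decide +kernel)

/-- The substitution from `tilesU` to itself. -/
def substitution12 : CodedSubstitution where
  source := adjacency12
  target := adjacency12
  refined := adjacency12_3
  blocks := [
    [[17]], [[16]], [[15], [11]], [[13], [9]], [[17], [8]], [[16], [8]], [[15], [8]], [[14], [8]],
    [[14, 6]], [[17, 3]], [[16, 3]], [[14, 2]], [[15, 7], [11, 1]], [[14, 6], [11, 1]],
    [[13, 7], [9, 1]], [[12, 6], [9, 1]], [[18, 5], [10, 1]], [[13, 4], [9, 1]], [[14, 2], [8, 0]]]
  colTest := fun _ b => memB b [0, 1, 8, 9, 10, 11]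
  rowTest := fun _ b => memB b [0, 1, 2, 3, 4, 5, 6, 7]

/-- The squares in configurations of `tilesU`. -/
def squaresU : List (ℕ × ℕ × ℕ × ℕ) := [
  (0, 3, 8, 16), (1, 2, 8, 16), (1, 3, 8, 16), (1, 6, 9, 14), (1, 6, 11, 17), (2, 0, 16, 8),
  (2, 4, 16, 13), (3, 7, 16, 15), (4, 1, 13, 9), (5, 1, 13, 9), (6, 1, 14, 8), (6, 1, 14, 11),
  (6, 1, 17, 8), (6, 5, 14, 13), (6, 5, 17, 13), (7, 1, 15, 8), (7, 1, 15, 11), (8, 16, 0, 3),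
  (8, 16, 9, 14), (8, 16, 11, 17), (9, 14, 1, 2), (9, 14, 1, 6), (9, 14, 10, 12), (10, 12, 1, 6),
  (10, 14, 1, 2), (10, 14, 1, 6), (11, 17, 1, 3), (11, 17, 10, 14), (12, 9, 6, 1), (13, 9, 4, 1),
  (13, 9, 7, 1), (13, 9, 18, 10), (14, 8, 2, 0), (14, 8, 12, 9), (14, 11, 6, 1), (14, 13, 2, 4),
  (14, 18, 6, 5), (15, 8, 13, 9), (15, 11, 7, 1), (15, 11, 18, 10), (16, 8, 14, 11),
  (16, 13, 3, 7), (16, 13, 14, 18), (16, 15, 3, 7), (16, 15, 14, 13), (16, 15, 14, 18),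
  (16, 15, 17, 13), (17, 8, 14, 11), (17, 13, 3, 7), (17, 13, 14, 18), (18, 10, 5, 1)]

/-- The indices of the squares in the images of the squares in `squaresU`. -/
def childrenU : List (List ℕ) := [
  [49, 36, 31, 50], [45, 36, 39, 50], [42, 36, 31, 50], [46, 48, 37, 30], [44, 35, 37, 29],
  [39, 50, 27, 25], [39, 50, 27, 25, 47, 34], [31, 50, 22, 23, 33, 28], [47, 34, 19, 26],
  [40, 34, 19, 26], [37, 30, 18, 21], [37, 30, 18, 20], [37, 29, 18, 21],
  [37, 30, 18, 21, 40, 34], [37, 29, 18, 21, 40, 34], [33, 28, 18, 21], [33, 28, 18, 20],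
  [36, 14, 50, 9], [36, 14, 48, 50, 9, 30], [36, 13, 35, 50, 9, 29], [48, 7, 30, 16],
  [48, 7, 30, 15], [48, 7, 43, 30, 16, 38], [43, 7, 38, 15], [41, 7, 30, 16], [41, 7, 30, 15],
  [35, 6, 29, 8], [35, 6, 41, 29, 8, 30], [38, 15, 26, 2], [34, 12, 26, 2], [34, 10, 26, 2],
  [34, 10, 32, 26, 2, 17], [30, 16, 21, 4], [30, 16, 38, 21, 4, 26], [30, 15, 20, 1],
  [30, 16, 21, 4, 34, 12], [30, 15, 20, 1, 32, 5], [28, 11, 34, 21, 4, 26], [28, 10, 20, 1],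
  [28, 10, 32, 20, 1, 17], [50, 9, 30, 25, 3, 20], [50, 9, 25, 3, 34, 10],
  [50, 9, 30, 25, 3, 20, 34, 10, 32], [50, 9, 23, 3, 28, 10], [50, 9, 30, 23, 3, 21, 28, 11, 34],
  [50, 9, 30, 23, 3, 20, 28, 10, 32], [50, 9, 29, 23, 3, 21, 28, 11, 34], [29, 8, 30, 21, 3, 20],
  [29, 8, 21, 3, 34, 10], [29, 8, 30, 21, 3, 20, 34, 10, 32], [32, 5, 17, 0]]

/-- The bit masks of the iterated images of the squares in `squaresU`. -/
def levelsU : List (List ℕ) := [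
  [1, 2, 4, 8, 16, 32, 64, 128, 256, 512, 1024, 2048, 4096, 8192, 16384, 32768, 65536, 131072,
  262144, 524288, 1048576, 2097152, 4194304, 8388608, 16777216, 33554432, 67108864, 134217728,
  268435456, 536870912, 1073741824, 2147483648, 4294967296, 8589934592, 17179869184, 34359738368,
  68719476736, 137438953472, 274877906944, 549755813888, 1099511627776, 2199023255552,
  4398046511104, 8796093022208, 17592186044416, 35184372088832, 70368744177664, 140737488355328,
  281474976710656, 562949953421312, 1125899906842624], [1688920727224320, 1161702754222080,
  1130368820314112, 351982233583616, 17764521607168, 1126449830428672, 1267204498653184,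
  1125910925279232, 140754735857664, 1116759130112, 138515054592, 138514006016, 137978183680,
  1255206551552, 1254669680640, 8860729344, 8859680768, 1125968626336256, 1407444676788736,
  1126003522937344, 281476050518144, 281476050485376, 290547021447296, 9070970962048,
  2200097063040, 2200097030272, 34896609600, 2234993606976, 274945048580, 17246982148,
  17246979076, 21542077444, 1075904528, 276020920336, 1074823170, 18255777808, 5369790498,
  17517512720, 269485058, 4564583426, 1125901015187976, 1125917120267784, 1125922490025480,
  1125900183668232, 1125918439377416, 1125905553425928, 1125917902506504, 1613758728, 17718838536,
  23088596232, 4295098401], [23155868975, 1125905553589803, 1125922557298223, 1125917969616668,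
  1125918506555932, 2239558223331, 2239560320491, 290568565654709, 1126004599857994,
  1126004631315274, 1407462194335380, 1407462194368148, 1407462194338452, 1407462228938398,
  1407462228941470, 1407719624000148, 1407719624000148, 1260107235363, 1260107236655,
  1259570434103, 1125928712537356, 1125928711488780, 1125928712537870, 1125910928688650,
  1125928207123980, 1125928208172556, 1267205642194964, 1267205642196508, 1130412578702658,
  1130542233059650, 1130542233059650, 1130542233142098, 299266678752388, 299266678752710,
  1443204912448644, 299266680849542, 1443205080220820, 299515518419398, 1443591191101572,
  1443591191118484, 355302311167141, 355302314508451, 355302314575031, 362174261133477,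
  362174260085927, 362174261200053, 362174260088999, 492736969544836, 492736972886150,
  492736972952726, 1689471726731792], [2221833797359574, 2086838142486197, 2084399138981879,
  1650907653509607, 1510179023521255, 2147306999502492, 2217675743680156, 1993135390836702,
  1655552560043191, 1657751583298743, 1431014198904303, 1431014198904303, 1431014198904303,
  1539316094305775, 1539316094305775, 1430739320997359, 1430739320997359, 2006192078847966,
  2221833797369822, 2028319750352862, 1632215955920887, 1632215955920887, 1669049595451383,
  1523877015439029, 1494777002444791, 1494777002444791, 1431838819526639, 1503307075856367,
  1584350323791551, 1583946865303231, 1583946865303231, 1602810898538175, 1412318205698014,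
  1588789990252510, 1412322500790271, 1448052333600734, 1432113710090239, 1588377673359326,
  1411910183866367, 1430739321016319, 1694068228091742, 2006192091426782, 2028319762935774,
  1975405765849054, 2010727576891358, 1993135390846942, 2010727576891358, 1130568351002462,
  1447777455697886, 1465369641742302, 302569511355887], [1609685006286847, 1996713099259903,
  2172634959708159, 2151469360873471, 2151744238780415, 1512378059452415, 1512378059452415,
  1688849843478527, 2030797959196671, 2030797959196671, 2230909075980287, 2230909075980287,
  2230909075980287, 2230909075980287, 2230909075980287, 2230909075980287, 2230909075980287,
  1680053750454271, 1680053750464511, 1680053750456319, 2170161058545663, 2170161058545663,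
  2170161058545663, 1994239198097407, 2170161058545663, 2170161058545663, 2223212494577663,
  2223212494585855, 2101991337619455, 2102266215524351, 2102266215524351, 2102266215530495,
  1686650820222975, 1688849843486719, 2249600773644287, 1686650820222975, 2249600773644287,
  1688849843484671, 2249600773642239, 2249600773652479, 1688849830895615, 1688849843476479,
  1688849843478527, 1688849843476479, 1688849843478527, 1688849843478527, 1688849843478527,
  1686650807640063, 1686650820222975, 1686650820222975, 2222108687859678], [2251799796908031,
  2251799796908031, 2251799796908031, 2251799796908031, 2251799796908031, 2249600773652479,
  2249600773652479, 2251799796908031, 2251799796899839, 2251799796899839, 2251799796908031,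
  2251799796908031, 2251799796908031, 2251799796908031, 2251799796908031, 2251799796908031,
  2251799796908031, 2251799796908031, 2251799796908031, 2251799796908031, 2251799796908031,
  2251799796908031, 2251799796908031, 2251799796908031, 2251799796908031, 2251799796908031,
  2251799796908031, 2251799796908031, 2251799796908031, 2251799796908031, 2251799796908031,
  2251799796908031, 2251799796908031, 2251799796908031, 2251799796908031, 2251799796908031,
  2251799796908031, 2251799796908031, 2251799796908031, 2251799796908031, 2243003703885823,
  2251799796908031, 2251799796908031, 2251799796908031, 2251799796908031, 2251799796908031,
  2251799796908031, 2243003703885823, 2251799796908031, 2251799796908031, 1688849843486719],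
  [2251799796908031, 2251799796908031, 2251799796908031, 2251799796908031, 2251799796908031,
  2251799796908031, 2251799796908031, 2251799796908031, 2251799796908031, 2251799796908031,
  2251799796908031, 2251799796908031, 2251799796908031, 2251799796908031, 2251799796908031,
  2251799796908031, 2251799796908031, 2251799796908031, 2251799796908031, 2251799796908031,
  2251799796908031, 2251799796908031, 2251799796908031, 2251799796908031, 2251799796908031,
  2251799796908031, 2251799796908031, 2251799796908031, 2251799796908031, 2251799796908031,
  2251799796908031, 2251799796908031, 2251799796908031, 2251799796908031, 2251799796908031,
  2251799796908031, 2251799796908031, 2251799796908031, 2251799796908031, 2251799796908031,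
  2251799796908031, 2251799796908031, 2251799796908031, 2251799796908031, 2251799796908031,
  2251799796908031, 2251799796908031, 2251799796908031, 2251799796908031, 2251799796908031,
  2251799796908031]]

theorem exists_isExpandingSubstitution_tilesU : ∃ Q₁ Q₂ τ,
    IsExpandingSubstitution tilesU.horizontal tilesU.vertical Q₁ Q₂ τ := by
  obtain ⟨e, he⟩ := codedBy12
  exact ⟨_, _, _, substitution12.isExpandingSubstitution he rfl
    (fun _ hy => hy.of_refinesAll (k := 1) (l := [adjacency12_1, adjacency12_2]) (by decide +kernel))
    (by decide +kernel) (by decide +kernel) (r := 6) (Q := squaresU) (children := childrenU)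
    (levels := levelsU) (by decide +kernel) (by decide +kernel) (by decide +kernel)
    (by decide +kernel)⟩

theorem exists_embedding_tiles5 : ∃ j : tiles5.wangShift → tiles4.wangShift,
    IsShiftEmbedding j ∧ IsConjugacyOntoImage j :=
  WangTileSet.exists_embedding codedBy5 codedBy4
    [0, 1, 2, 3, 4, 5, 6, 7, 8, 9, 10, 11, 12, 13, 14, 15, 16, 17, 18, 19, 20, 21, 22, 23, 25, 26, 27, 29]
    (by decide +kernel)

/-- The tile of `tiles6` which is sheared to the tile `a` of `tiles5` with right neighbour `b`. -/
def unshear (a b : ℕ) : ℕ :=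
  if a < 22 then a else if a = 22 then if b = 27 then 22 else 23 else a + 1

theorem exists_shear_tiles6 : ∃ η : tiles6.wangShift → tiles5.wangShift,
    IsGLConjugacy shearMatrix η ∧ ∃ f : tiles6.Alphabet → tiles5.Alphabet,
      ∀ (y : tiles6.wangShift) (p : ℤ × ℤ), (η y).1 (matAct shearMatrix.1 p) = f (y.1 p) :=
  WangTileSet.exists_shear codedBy6 codedBy5 (F := adjacency5_2) (k := 1)
    (l := [adjacency5_1])
    (by decide +kernel)
    [0, 1, 2, 3, 4, 5, 6, 7, 8, 9, 10, 11, 12, 13, 14, 15, 16, 17, 18, 19, 20, 21, 22, 22, 23, 24, 25, 26, 27]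
    unshear (by decide +kernel)

theorem isSelfSimilar_isAperiodic_isMinimal_tilesU : IsSelfSimilar tilesU.wangShift ∧
    IsAperiodic tilesU.wangShift ∧ IsMinimalSubshift tilesU.wangShift := by
  obtain ⟨Q₁, Q₂, τ, S⟩ := exists_isExpandingSubstitution_tilesU
  have : Nonempty tilesU.Alphabet := ⟨codedBy12.choose.symm 0⟩
  exact ⟨S.isSelfSimilar, S.isAperiodic, S.isMinimalSubshift⟩

theorem mainTheorem1 :
    ∃ T : Fin 13 → WangTileSet, T 0 = jeandelRaoTiles ∧
      -- (i) `Ω₀ ← Ω₁ ← Ω₂ ← Ω₃ ← Ω₄`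
      (∀ i : Fin 12, (i : ℕ) ≤ 3 →
        ∃ ω : Word (T i.succ).Alphabet → Word (T i.castSucc).Alphabet,
          IsMorphismBetween (T i.succ).wangShift (T i.castSucc).wangShift ω ∧
          IsRecognizable (T i.succ).wangShift ω ∧
          IsOntoUpToShift (T i.succ).wangShift (T i.castSucc).wangShift ω) ∧
      -- (ii) the embedding `Ω₅ → Ω₄`
      (∃ j : (T 5).wangShift → (T 4).wangShift,
        IsShiftEmbedding j ∧ IsConjugacyOntoImage j) ∧
      -- (iii) the shear conjugacy `Ω₆ → Ω₅`, moving the tile at `p` to the position `M p`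
      (∃ η : (T 6).wangShift → (T 5).wangShift, IsGLConjugacy shearMatrix η ∧
        ∃ f : (T 6).Alphabet → (T 5).Alphabet, ∀ (y : (T 6).wangShift) (p : ℤ × ℤ),
          (η y).1 (matAct shearMatrix.1 p) = f (y.1 p)) ∧
      -- (iv) `Ω₆ ← Ω₇ ← Ω₈ ← Ω₉ ← Ω₁₀ ← Ω₁₁ ← Ω₁₂`
      (∀ i : Fin 12, 6 ≤ (i : ℕ) →
        ∃ ω : Word (T i.succ).Alphabet → Word (T i.castSucc).Alphabet,
          IsMorphismBetween (T i.succ).wangShift (T i.castSucc).wangShift ω ∧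
          IsRecognizable (T i.succ).wangShift ω ∧
          IsOntoUpToShift (T i.succ).wangShift (T i.castSucc).wangShift ω) ∧
      -- (v) `Ω₁₂` and `Ω_U`
      (T 12).Equivalent tilesU ∧
      IsSelfSimilar (T 12).wangShift ∧ IsAperiodic (T 12).wangShift ∧
      IsMinimalSubshift (T 12).wangShift ∧
      IsSelfSimilar tilesU.wangShift ∧ IsAperiodic tilesU.wangShift ∧
      IsMinimalSubshift tilesU.wangShift := by
  refine ⟨![jeandelRaoTiles, tiles1, tiles2, tiles3, tiles4, tiles5, tiles6, tiles7, tiles8,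
    tiles9, tiles10, tiles11, tilesU], rfl, ?_, exists_embedding_tiles5, exists_shear_tiles6, ?_,
    ⟨Equiv.refl _, Equiv.refl _, fun s => ⟨fun hs => ⟨s, hs, rfl⟩, ?_⟩⟩,
    isSelfSimilar_isAperiodic_isMinimal_tilesU.1, isSelfSimilar_isAperiodic_isMinimal_tilesU.2.1,
    isSelfSimilar_isAperiodic_isMinimal_tilesU.2.2, isSelfSimilar_isAperiodic_isMinimal_tilesU⟩
  · intro i hi
    have : i = 0 ∨ i = 1 ∨ i = 2 ∨ i = 3 := by omega
    rcases this with rfl | rfl | rfl | rfl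
    exacts [exists_morphism0, exists_morphism1, exists_morphism2, exists_morphism3]
  · intro i hi
    have : i = 6 ∨ i = 7 ∨ i = 8 ∨ i = 9 ∨ i = 10 ∨ i = 11 := by omega
    rcases this with rfl | rfl | rfl | rfl | rfl | rfl
    exacts [exists_morphism6, exists_morphism7, exists_morphism8, exists_morphism9,
      exists_morphism10, exists_morphism11]
  · rintro ⟨t, ht, rfl⟩
    exact ht
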